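/- Let $p$ be a prime and let $H^*(BG)$ denote the mod $p$ cohomology ring of (the classifying space of) a finite group $G$. Let $P$ be a finite $p$-group, let $C=C(P)\le P$ be its maximal central elementary abelian $p$-subgroup, let $c=c(P)$ be the rank of $C$, and let $i^*\colon H^*(BP)\to H^*(BC)$ be the restriction map. Let $e(P)$ denote the top degree of a generator of $H^*(BC)$ as an $H^*(BP)$-module via $i^*$, i.e. the largest degree in which the indecomposables $H^*(BC)\otimes_{H^*(BP)}\mathbb F_p$ are nonzero. Let $A\le P$ be an abelian subgroup of maximal order. Then, for every basis $x_1,\dots,x_c$ of $H^1(BC)$, with Bocksteins $y_i=\beta(x_i)\in H^2(BC)$, the image of $i^*$ contains the subalgebra $\mathbb F_p[y_1^{|P|/|A|},\dots,y_c^{|P|/|A|}]$ of $H^*(BC)$ generated by the elements $y_i^{|P|/|A|}$. Moreover, $e(P)$ is finite and $$e(P)\le c(P)\left(\frac{2|P|}{|A|}-1\right).$$ -/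

import Mathlib

noncomputable section

namespace ModPCohomology

open CategoryTheory

/-! ### Inhomogeneous cochains with trivial coefficients -/

/-- The coboundary `Cⁿ(G, k) → Cⁿ⁺¹(G, k)` of Mathlib's complex of inhomogeneous cochains, for the
trivial coefficient module `k`. -/
abbrev coboundary (k G : Type) [CommRing k] [Group G] (n : ℕ) :
    ((Fin n → G) → k) →ₗ[k] ((Fin (n + 1) → G) → k) :=
  (inhomogeneousCochains.d (Rep.trivial k G k) n).hom

/-- The cochain cup product `(f ∪ g)(v₁, …, vₘ₊ₙ) = f(v₁, …, vₘ) g(vₘ₊₁, …, vₘ₊ₙ)`. -/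
def cochainCup {k G : Type} [CommRing k] {m n : ℕ}
    (f : (Fin m → G) → k) (g : (Fin n → G) → k) : (Fin (m + n) → G) → k :=
  fun v => f (fun i => v (Fin.castAdd n i)) * g (fun j => v (Fin.natAdd m j))

set_option linter.unusedSectionVars false

section Auxiliary

variable {k G : Type} [CommRing k]

/-- A cochain evaluated on the first entries of an infinite sequence. -/
def onSeq {n : ℕ} (f : (Fin n → G) → k) (v : ℕ → G) : k := f fun i => v i

lemma onSeq_injective [Group G] {n : ℕ} {f g : (Fin n → G) → k} (h : onSeq f = onSeq g) :
    f = g := by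
  funext v
  have := congrFun h (fun i => if hi : i < n then v ⟨i, hi⟩ else 1)
  simpa [onSeq] using this

/-- Multiply the entries `j` and `j + 1` of a sequence. -/
def contractSeq [Group G] (j : ℕ) (v : ℕ → G) : ℕ → G := fun i =>
  if i < j then v i else if i = j then v i * v (i + 1) else v (i + 1)

lemma onSeq_coboundary [Group G] {n : ℕ} (f : (Fin n → G) → k) (v : ℕ → G) :
    onSeq (coboundary k G n f) v = onSeq f (fun i => v (i + 1)) +
      ∑ j ∈ Finset.range (n + 1), (-1 : k) ^ (j + 1) * onSeq f (contractSeq j v) := by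
  rw [Finset.sum_range]
  simp only [onSeq, coboundary]
  rw [inhomogeneousCochains.d_hom_apply]
  simp only [Representation.trivial, smul_eq_mul]
  congr 1

lemma onSeq_cup {m n : ℕ} (f : (Fin m → G) → k) (g : (Fin n → G) → k) (v : ℕ → G) :
    onSeq (cochainCup f g) v = onSeq f v * onSeq g (fun i => v (m + i)) := rfl

lemma onSeq_congr {n : ℕ} (f : (Fin n → G) → k) {v w : ℕ → G} (h : ∀ i < n, v i = w i) :
    onSeq f v = onSeq f w := by
  unfold onSeq; congr 1; funext i; exact h i i.2

lemma onSeq_coboundary_cup [Group G] {m n : ℕ} (f : (Fin m → G) → k) (g : (Fin n → G) → k)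
    (v : ℕ → G) :
    onSeq (coboundary k G (m + n) (cochainCup f g)) v =
      onSeq (coboundary k G m f) v * onSeq g (fun i => v (m + 1 + i)) +
      (-1) ^ m * (onSeq f v * onSeq (coboundary k G n g) (fun i => v (m + i))) := by
  rw [onSeq_coboundary, onSeq_coboundary, onSeq_coboundary, add_assoc m n 1,
    Finset.sum_range_add, Finset.sum_range_succ (n := m)]
  simp only [onSeq_cup]
  have h1 : ∀ j ∈ Finset.range m,
      (-1 : k) ^ (j + 1) * (onSeq f (contractSeq j v) *
        onSeq g (fun i => contractSeq j v (m + i))) =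
      (-1 : k) ^ (j + 1) * onSeq f (contractSeq j v) * onSeq g (fun i => v (m + 1 + i)) := by
    intro j hj
    rw [mul_assoc]
    congr 2
    apply onSeq_congr
    intro i _
    have := Finset.mem_range.1 hj
    simp only [contractSeq]
    rw [if_neg (by omega), if_neg (by omega)]
    congr 1; omega
  have h2 : ∀ j, onSeq f (contractSeq (m + j) v) = onSeq f v := by
    intro j
    apply onSeq_congr
    intro i hi
    simp only [contractSeq]
    rw [if_pos (by omega)]
  have h3 : ∀ j, (fun i => contractSeq (m + j) v (m + i)) =
      contractSeq j (fun i => v (m + i)) := by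
    intro j
    funext i
    simp only [contractSeq, add_lt_add_iff_left, add_right_inj, add_assoc]
  have h4 : (fun i => v (m + i + 1)) = fun i => v (m + 1 + i) := by
    funext i; congr 1; omega
  have h5 : onSeq f (contractSeq m v) = onSeq f v := h2 0
  have h6 : (fun i => v (m + (i + 1))) = fun i => v (m + 1 + i) := by
    funext i; congr 1; omega
  rw [Finset.sum_congr rfl h1, ← Finset.sum_mul]
  simp only [h2, h3, h4, h5, h6]
  have h7 : ∀ S : ℕ → k, ∑ x ∈ Finset.range (n + 1), (-1 : k) ^ (m + x + 1) * (onSeq f v * S x) =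
      (-1) ^ m * (onSeq f v * ∑ x ∈ Finset.range (n + 1), (-1 : k) ^ (x + 1) * S x) := by
    intro S
    rw [Finset.mul_sum, Finset.mul_sum]
    refine Finset.sum_congr rfl fun x _ => ?_
    ring
  rw [h7]
  ring

lemma coboundary_coboundary [Group G] {n : ℕ} (f : (Fin n → G) → k) :
    coboundary k G (n + 1) (coboundary k G n f) = 0 := by
  have := groupCohomology.inhomogeneousCochains.d_comp_d n (Rep.trivial k G k)
  exact congrArg (fun φ => φ.hom f) this

end Auxiliary

/-! ### Mod `p` cohomology groups and cohomology classes of cocycles -/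

/-- `Hⁿ(BG)`: the mod `p` cohomology of the group `G` in degree `n`. -/
abbrev H (p : ℕ) (G : Type) [Group G] (n : ℕ) : Type :=
  groupCohomology (Rep.trivial (ZMod p) G (ZMod p)) n

section Classes

variable (p : ℕ) (G : Type) [Group G]

/-- The inhomogeneous mod `p` cocycles. -/
abbrev Cocycle (n : ℕ) : Submodule (ZMod p) ((Fin n → G) → ZMod p) :=
  LinearMap.ker (coboundary (ZMod p) G n)

/-- The cohomology class of a cocycle. -/
def cls (n : ℕ) : Cocycle p G n →ₗ[ZMod p] H p G n where
  toFun f := groupCohomology.π (Rep.trivial (ZMod p) G (ZMod p)) n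
    (groupCohomology.cocyclesMk f.1 f.2)
  map_add' f g := by
    rw [← map_add]
    congr 1
    apply (ModuleCat.mono_iff_injective
      (groupCohomology.iCocycles (Rep.trivial (ZMod p) G (ZMod p)) n)).1 inferInstance
    rw [map_add]
    erw [groupCohomology.iCocycles_mk, groupCohomology.iCocycles_mk, groupCohomology.iCocycles_mk]
    rfl
  map_smul' r f := by
    rw [RingHom.id_apply, ← map_smul]
    congr 1
    apply (ModuleCat.mono_iff_injective
      (groupCohomology.iCocycles (Rep.trivial (ZMod p) G (ZMod p)) n)).1 inferInstance
    rw [map_smul]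
    erw [groupCohomology.iCocycles_mk, groupCohomology.iCocycles_mk]
    rfl

variable {p G}


lemma cls_surjective (n : ℕ) : Function.Surjective (cls p G n) := by
  intro x
  induction x using groupCohomology_induction_on with
  | h y =>
    have hy : coboundary (ZMod p) G n
        (groupCohomology.iCocycles (Rep.trivial (ZMod p) G (ZMod p)) n y) = 0 := by
      have h := (groupCohomology.inhomogeneousCochains
        (Rep.trivial (ZMod p) G (ZMod p))).iCycles_d n (n + 1)
      rw [groupCohomology.inhomogeneousCochains.d_def] at h
      exact congrArg (fun φ => φ.hom y) h
    refine ⟨⟨_, hy⟩, ?_⟩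
    change groupCohomology.π _ n _ = groupCohomology.π _ n _
    congr 1
    apply (ModuleCat.mono_iff_injective
      (groupCohomology.iCocycles (Rep.trivial (ZMod p) G (ZMod p)) n)).1 inferInstance
    erw [groupCohomology.iCocycles_mk]

/-- A cochain is a coboundary (in degree `0`: it vanishes). -/
def IsCoboundary {n : ℕ} (f : (Fin n → G) → ZMod p) : Prop :=
  f = 0 ∨ ∃ (m : ℕ) (g : (Fin m → G) → ZMod p), m + 1 = n ∧ onSeq f = onSeq (coboundary (ZMod p) G m g)

lemma cls_eq_zero_iff {n : ℕ} (f : Cocycle p G n) : cls p G n f = 0 ↔ IsCoboundary f.1 := by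
  set K := groupCohomology.inhomogeneousCochains (Rep.trivial (ZMod p) G (ZMod p)) with hK
  have key : ∀ i, (ComplexShape.up ℕ).prev n = i →
      (cls p G n f = 0 ↔ ∃ g : K.X i, K.d i n g = f.1) := by
    intro i hi
    have hex : (ShortComplex.mk (K.toCycles i n) (K.homologyπ n) (by simp)).Exact :=
      ShortComplex.exact_of_g_is_cokernel _ (K.homologyIsCokernel i n hi)
    rw [ShortComplex.moduleCat_exact_iff] at hex
    have hi' : groupCohomology.iCocycles (Rep.trivial (ZMod p) G (ZMod p)) n
        (groupCohomology.cocyclesMk f.1 f.2) = f.1 := by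
      exact groupCohomology.iCocycles_mk (A := Rep.trivial (ZMod p) G (ZMod p)) f.1 f.2
    constructor
    · intro h
      obtain ⟨g, hg⟩ := hex _ h
      refine ⟨g, ?_⟩
      rw [← K.toCycles_i i n, ← hi']
      exact congrArg (K.iCycles n) hg
    · rintro ⟨g, hg⟩
      have : K.toCycles i n g = groupCohomology.cocyclesMk
          (A := Rep.trivial (ZMod p) G (ZMod p)) f.1 f.2 := by
        apply (ModuleCat.mono_iff_injective (K.iCycles n)).1 inferInstance
        refine Eq.trans ?_ hi'.symm
        rw [← hg, ← K.toCycles_i i n]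
        rfl
      change K.homologyπ n (groupCohomology.cocyclesMk
        (A := Rep.trivial (ZMod p) G (ZMod p)) f.1 f.2) = 0
      rw [← this]
      have h0 : K.toCycles i n ≫ K.homologyπ n = 0 := by simp
      exact congrArg (fun φ => φ.hom g) h0
  cases n with
  | zero =>
    rw [key 0 (by simp)]
    constructor
    · rintro ⟨g, hg⟩
      rw [K.shape 0 0 (by simp)] at hg
      exact Or.inl hg.symm
    · rintro (h | ⟨m, g, h, -⟩)
      · exact ⟨0, by rw [map_zero]; exact h.symm⟩
      · omega
  | succ m =>
    rw [key m (by simp)]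
    have hd : K.d m (m + 1) = inhomogeneousCochains.d (Rep.trivial (ZMod p) G (ZMod p)) m :=
      groupCohomology.inhomogeneousCochains.d_def _ m
    rw [hd]
    constructor
    · rintro ⟨g, hg⟩
      exact Or.inr ⟨m, g, rfl, congrArg onSeq hg.symm⟩
    · rintro (h | ⟨m', g, h, hg⟩)
      · exact ⟨0, by rw [map_zero]; exact h.symm⟩
      · obtain rfl : m' = m := by omega
        exact ⟨g, (onSeq_injective hg).symm⟩

/-- Two cocycles (of equal degree) given by the same formula have the same class. -/
lemma mk_cls_congr {m n : ℕ} (h : m = n) (f : Cocycle p G m) (g : Cocycle p G n)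
    (hfg : onSeq f.1 = onSeq g.1) :
    GradedMonoid.mk (A := H p G) m (cls p G m f) = GradedMonoid.mk n (cls p G n g) := by
  subst h
  rw [Subtype.ext (onSeq_injective hfg)]

end Classes

/-- Descend a linear map along a surjective linear map. -/
def descend {R M N L : Type} [Ring R] [AddCommGroup M] [AddCommGroup N] [AddCommGroup L]
    [Module R M] [Module R N] [Module R L] (q : M →ₗ[R] N) (hq : Function.Surjective q)
    (f : M →ₗ[R] L) (h : LinearMap.ker q ≤ LinearMap.ker f) : N →ₗ[R] L :=
  (LinearMap.ker q).liftQ f h ∘ₗ (q.quotKerEquivOfSurjective hq).symm.toLinearMap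

lemma descend_apply {R M N L : Type} [Ring R] [AddCommGroup M] [AddCommGroup N] [AddCommGroup L]
    [Module R M] [Module R N] [Module R L] (q : M →ₗ[R] N) (hq : Function.Surjective q)
    (f : M →ₗ[R] L) (h : LinearMap.ker q ≤ LinearMap.ker f) (x : M) :
    descend q hq f h (q x) = f x := by
  have : (q.quotKerEquivOfSurjective hq).symm (q x) = Submodule.Quotient.mk x := by
    rw [LinearEquiv.symm_apply_eq]; rfl
  simp [descend, this]

/-! ### The cup product -/

section Cup

variable {p : ℕ} {G : Type} [Group G]

/-- The cup product of two cocycles. -/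
def cocycleCup {m n : ℕ} (f : Cocycle p G m) (g : Cocycle p G n) : Cocycle p G (m + n) :=
  ⟨cochainCup f.1 g.1, by
    apply onSeq_injective
    funext v
    rw [onSeq_coboundary_cup, LinearMap.mem_ker.1 f.2, LinearMap.mem_ker.1 g.2]
    simp [onSeq]⟩

/-- The cup product of cocycles, with values in cohomology, as a bilinear map. -/
def cocycleCupClass (m n : ℕ) :
    Cocycle p G m →ₗ[ZMod p] Cocycle p G n →ₗ[ZMod p] H p G (m + n) :=
  LinearMap.mk₂ (ZMod p) (fun f g => cls p G (m + n) (cocycleCup f g))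
    (fun f f' g => by
      rw [← map_add]; congr 1; ext v; simp [cocycleCup, cochainCup, add_mul])
    (fun r f g => by
      rw [← map_smul]; congr 1; ext v; simp [cocycleCup, cochainCup, mul_assoc])
    (fun f g g' => by
      rw [← map_add]; congr 1; ext v; simp [cocycleCup, cochainCup, mul_add])
    (fun r f g => by
      rw [← map_smul]; congr 1; ext v; simp [cocycleCup, cochainCup, mul_left_comm])

lemma cocycleCup_isCoboundary_right {m n : ℕ} (f : Cocycle p G m) (g : Cocycle p G n)
    (hg : IsCoboundary g.1) : IsCoboundary (cocycleCup f g).1 := by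
  rcases hg with h0 | ⟨m', h, hm, hh⟩
  · left
    funext v
    simp [cocycleCup, cochainCup, h0]
  · right
    refine ⟨m + m', (-1 : ZMod p) ^ m • cochainCup f.1 h, by omega, ?_⟩
    funext v
    rw [map_smul]
    change _ = (-1 : ZMod p) ^ m * onSeq _ v
    rw [onSeq_coboundary_cup, LinearMap.mem_ker.1 f.2]
    change onSeq (cochainCup f.1 g.1) v = _
    have h1 : ((-1 : ZMod p) ^ m) * (-1) ^ m = 1 := by rw [← mul_pow]; simp
    have h2 : onSeq (0 : (Fin (m + 1) → G) → ZMod p) v = 0 := rfl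
    rw [onSeq_cup, hh, h2, zero_mul, zero_add, ← mul_assoc, h1, one_mul]

lemma cocycleCup_isCoboundary_left {m n : ℕ} (f : Cocycle p G m) (g : Cocycle p G n)
    (hf : IsCoboundary f.1) : IsCoboundary (cocycleCup f g).1 := by
  rcases hf with h0 | ⟨m', h, hm, hh⟩
  · left
    funext v
    simp [cocycleCup, cochainCup, h0]
  · right
    refine ⟨m' + n, cochainCup h g.1, by omega, ?_⟩
    funext v
    rw [onSeq_coboundary_cup, LinearMap.mem_ker.1 g.2]
    change onSeq (cochainCup f.1 g.1) v = _
    rw [onSeq_cup, hh, ← hm]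
    simp [onSeq]

/-- The cup product `Hᵐ(BG) × Hⁿ(BG) → Hᵐ⁺ⁿ(BG)`. -/
def cup (m n : ℕ) : H p G m →ₗ[ZMod p] H p G n →ₗ[ZMod p] H p G (m + n) :=
  descend (cls p G m) (cls_surjective m)
    { toFun := fun f => descend (cls p G n) (cls_surjective n) (cocycleCupClass m n f)
        (fun g hg => LinearMap.mem_ker.2 <| (cls_eq_zero_iff _).2 <|
          cocycleCup_isCoboundary_right f g ((cls_eq_zero_iff _).1 hg))
      map_add' := fun f f' => by
        ext x
        obtain ⟨g, rfl⟩ := cls_surjective n x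
        simp [descend_apply]
      map_smul' := fun r f => by
        ext x
        obtain ⟨g, rfl⟩ := cls_surjective n x
        simp [descend_apply] }
    (fun f hf => by
      rw [LinearMap.mem_ker]
      ext x
      obtain ⟨g, rfl⟩ := cls_surjective n x
      simp only [LinearMap.coe_mk, AddHom.coe_mk, descend_apply, LinearMap.zero_apply]
      exact (cls_eq_zero_iff _).2 <|
          cocycleCup_isCoboundary_left f g ((cls_eq_zero_iff _).1 hf))

lemma cup_cls {m n : ℕ} (f : Cocycle p G m) (g : Cocycle p G n) :
    cup m n (cls p G m f) (cls p G n g) = cls p G (m + n) (cocycleCup f g) := by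
  simp only [cup, descend_apply, LinearMap.coe_mk, AddHom.coe_mk]
  rfl

variable (p G) in
/-- The constant `0`-cocycle `1`. -/
def oneCocycle : Cocycle p G 0 :=
  ⟨fun _ => 1, by
    apply onSeq_injective
    funext v
    rw [onSeq_coboundary]
    simp [onSeq]⟩

lemma mk_mul_mk_cls {m n : ℕ} (f : Cocycle p G m) (g : Cocycle p G n) :
    (⟨m + n, cup m n (cls p G m f) (cls p G n g)⟩ : GradedMonoid (H p G)) =
      ⟨m + n, cls p G (m + n) (cocycleCup f g)⟩ := by
  rw [cup_cls]

instance instGMul : GradedMonoid.GMul (H p G) where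
  mul {m n} a b := cup m n a b

instance instGOne : GradedMonoid.GOne (H p G) where
  one := cls p G 0 (oneCocycle p G)

instance instGMonoid : GradedMonoid.GMonoid (H p G) where
  one_mul := by
    rintro ⟨n, a⟩
    obtain ⟨f, rfl⟩ := cls_surjective n a
    refine (mk_mul_mk_cls _ f).trans (mk_cls_congr (zero_add n) _ _ ?_)
    funext v
    refine (onSeq_cup _ _ v).trans ?_
    simp [onSeq, oneCocycle]
  mul_one := by
    rintro ⟨n, a⟩
    obtain ⟨f, rfl⟩ := cls_surjective n a
    refine (mk_mul_mk_cls f _).trans (mk_cls_congr (add_zero n) _ _ ?_)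
    funext v
    refine (onSeq_cup _ _ v).trans ?_
    simp [onSeq, oneCocycle]
  mul_assoc := by
    rintro ⟨l, a⟩ ⟨m, b⟩ ⟨n, c⟩
    obtain ⟨f, rfl⟩ := cls_surjective l a
    obtain ⟨g, rfl⟩ := cls_surjective m b
    obtain ⟨h, rfl⟩ := cls_surjective n c
    change (⟨l + m + n, cup (l + m) n (cup l m _ _) _⟩ : GradedMonoid (H p G)) =
      ⟨l + (m + n), cup l (m + n) _ (cup m n _ _)⟩
    rw [cup_cls, cup_cls, cup_cls, cup_cls]
    refine mk_cls_congr (add_assoc l m n) _ _ ?_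
    funext v
    change onSeq (cochainCup (cochainCup f.1 g.1) h.1) v =
      onSeq (cochainCup f.1 (cochainCup g.1 h.1)) v
    simp only [onSeq_cup, mul_assoc, add_assoc]

instance instGRing : DirectSum.GRing (H p G) where
  mul_zero a := map_zero (cup _ _ a)
  zero_mul b := by
    change cup _ _ 0 b = 0
    simp
  mul_add a b c := map_add (cup _ _ a) b c
  add_mul a b c := by
    change cup _ _ (a + b) c = cup _ _ a c + cup _ _ b c
    simp
  natCast n := n • cls p G 0 (oneCocycle p G)
  natCast_zero := zero_smul _ _
  natCast_succ n := succ_nsmul _ _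
  intCast n := n • cls p G 0 (oneCocycle p G)
  intCast_ofNat n := natCast_zsmul _ _
  intCast_negSucc_ofNat n := negSucc_zsmul _ _

lemma gmul_def {m n : ℕ} (a : H p G m) (b : H p G n) :
    GradedMonoid.GMul.mul a b = cup m n a b := rfl

lemma gone_def : (GradedMonoid.GOne.one : H p G 0) = cls p G 0 (oneCocycle p G) := rfl

instance instGAlgebra : DirectSum.GAlgebra (ZMod p) (H p G) where
  toFun := (LinearMap.toSpanSingleton (ZMod p) (H p G 0)
    (cls p G 0 (oneCocycle p G))).toAddMonoidHom
  map_one := one_smul _ _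
  map_mul r s := by
    change (⟨0, (r * s) • cls p G 0 (oneCocycle p G)⟩ : GradedMonoid (H p G)) =
      ⟨0 + 0, cup 0 0 (r • cls p G 0 (oneCocycle p G)) (s • cls p G 0 (oneCocycle p G))⟩
    rw [← map_smul, ← map_smul, ← map_smul, cup_cls]
    refine mk_cls_congr rfl _ _ ?_
    funext v
    refine Eq.trans ?_ (onSeq_cup _ _ v).symm
    simp [onSeq, oneCocycle]
  commutes r := by
    rintro ⟨n, a⟩
    obtain ⟨f, rfl⟩ := cls_surjective n a
    change (⟨0 + n, cup 0 n (r • cls p G 0 (oneCocycle p G)) _⟩ : GradedMonoid (H p G)) =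
      ⟨n + 0, cup n 0 _ (r • cls p G 0 (oneCocycle p G))⟩
    rw [← map_smul, cup_cls, cup_cls]
    refine mk_cls_congr (by omega) _ _ ?_
    funext v
    refine (onSeq_cup _ _ v).trans (Eq.trans ?_ (onSeq_cup _ _ v).symm)
    simp [onSeq, oneCocycle, mul_comm]
  smul_def r := by
    rintro ⟨n, a⟩
    obtain ⟨f, rfl⟩ := cls_surjective n a
    change (⟨n, r • _⟩ : GradedMonoid (H p G)) =
      ⟨0 + n, cup 0 n (r • cls p G 0 (oneCocycle p G)) _⟩
    rw [← map_smul, ← map_smul, cup_cls]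
    refine mk_cls_congr (by omega) _ _ ?_
    funext v
    refine Eq.trans ?_ (onSeq_cup _ _ v).symm
    simp [onSeq, oneCocycle]

end Cup

open DirectSum in
/-- The mod `p` cohomology ring `H*(BG)`, an `𝔽_p`-algebra under the cup product. -/
abbrev HStar (p : ℕ) (G : Type) [Group G] : Type := ⨁ n, H p G n

/-- A class of degree `n`, viewed in the cohomology ring. -/
abbrev inDegree (p : ℕ) (G : Type) [Group G] (n : ℕ) : H p G n →ₗ[ZMod p] HStar p G :=
  DirectSum.lof (ZMod p) ℕ (H p G) n

/-! ### Restriction -/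

section Restriction

variable (p : ℕ) {G K : Type} [Group G] [Group K] (φ : K →* G)

/-- The map `Hⁿ(BG) → Hⁿ(BK)` induced by `φ : K →* G` (restriction, if `φ` is an inclusion). -/
def resDegree (n : ℕ) : H p G n →ₗ[ZMod p] H p K n :=
  (groupCohomology.map (A := Rep.trivial (ZMod p) G (ZMod p))
    (B := Rep.trivial (ZMod p) K (ZMod p)) φ (Rep.ofHom ⟨LinearMap.id, fun _ => rfl⟩) n).hom

variable {p}

/-- The pull-back of a cocycle. -/
def cocycleRes {n : ℕ} (f : Cocycle p G n) : Cocycle p K n :=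
  ⟨fun v => f.1 (φ ∘ v), by
    have h : ∀ {n : ℕ} (f : (Fin n → G) → ZMod p) (v : ℕ → K),
      onSeq (fun v => f (φ ∘ v)) v = onSeq f (φ ∘ v) := fun _ _ => rfl
    have h' : ∀ j (v : ℕ → K), contractSeq j (φ ∘ v) = φ ∘ contractSeq j v := by
      intro j v
      funext i
      simp only [contractSeq, Function.comp_apply]
      split_ifs <;> simp
    apply onSeq_injective
    funext v
    have hf := congrFun (congrArg onSeq (LinearMap.mem_ker.1 f.2)) (φ ∘ v)
    rw [onSeq_coboundary] at hf ⊢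
    simp only [h, h'] at hf ⊢
    exact hf⟩

lemma resDegree_cls {n : ℕ} (f : Cocycle p G n) :
    resDegree p φ n (cls p G n f) = cls p K n (cocycleRes φ f) := by
  have h := groupCohomology.π_map_apply (A := Rep.trivial (ZMod p) G (ZMod p))
    (B := Rep.trivial (ZMod p) K (ZMod p)) φ (Rep.ofHom ⟨LinearMap.id, fun _ => rfl⟩) n
    (groupCohomology.cocyclesMk f.1 f.2)
  refine h.trans ?_
  change groupCohomology.π _ n _ = groupCohomology.π _ n _
  congr 1
  apply (ModuleCat.mono_iff_injective
    (groupCohomology.iCocycles (Rep.trivial (ZMod p) K (ZMod p)) n)).1 inferInstance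
  erw [groupCohomology.iCocycles_mk]
  have h1 := HomologicalComplex.cyclesMap_i (groupCohomology.cochainsMap
    (A := Rep.trivial (ZMod p) G (ZMod p)) (B := Rep.trivial (ZMod p) K (ZMod p)) φ
    (Rep.ofHom ⟨LinearMap.id, fun _ => rfl⟩)) n
  refine (congrArg (fun ψ => ψ.hom (groupCohomology.cocyclesMk
    (A := Rep.trivial (ZMod p) G (ZMod p)) f.1 f.2)) h1).trans ?_
  have h2 := groupCohomology.iCocycles_mk (A := Rep.trivial (ZMod p) G (ZMod p)) f.1 f.2
  exact congrArg (fun x => ((groupCohomology.cochainsMap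
    (A := Rep.trivial (ZMod p) G (ZMod p)) (B := Rep.trivial (ZMod p) K (ZMod p)) φ
    (Rep.ofHom ⟨LinearMap.id, fun _ => rfl⟩)).f n).hom x) h2

variable (p) in
/-- The ring homomorphism `H*(BG) → H*(BK)` induced by `φ : K →* G`. -/
def res : HStar p G →ₐ[ZMod p] HStar p K :=
  DirectSum.toAlgebra (ZMod p) (H p G) (fun n => inDegree p K n ∘ₗ resDegree p φ n)
    (by
      rw [gone_def, LinearMap.comp_apply, resDegree_cls]
      rfl)
    (by
      intro i j a b
      obtain ⟨f, rfl⟩ := cls_surjective i a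
      obtain ⟨g, rfl⟩ := cls_surjective j b
      simp only [gmul_def, LinearMap.comp_apply, cup_cls, resDegree_cls, inDegree,
        DirectSum.lof_eq_of, DirectSum.of_mul_of]
      rfl)

end Restriction

/-! ### The Bockstein -/

section Bockstein

variable {p : ℕ} {G : Type} [Group G]

/-- Reduction modulo `p` of an integral cochain. -/
def reduce (p : ℕ) {n : ℕ} (F : (Fin n → G) → ℤ) : (Fin n → G) → ZMod p := fun v => (F v : ZMod p)

lemma coboundary_reduce {n : ℕ} (F : (Fin n → G) → ℤ) :
    coboundary (ZMod p) G n (reduce p F) = reduce p (coboundary ℤ G n F) := by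
  apply onSeq_injective
  funext v
  have h : ∀ {n : ℕ} (F : (Fin n → G) → ℤ) (v : ℕ → G),
      onSeq (reduce p F) v = ((onSeq F v : ℤ) : ZMod p) := fun _ _ => rfl
  rw [h, onSeq_coboundary, onSeq_coboundary]
  simp [h]

lemma exists_of_reduce_eq_zero {n : ℕ} {F : (Fin n → G) → ℤ} (h : reduce p F = 0) :
    ∃ D : (Fin n → G) → ℤ, F = (p : ℤ) • D := by
  have : ∀ v, ∃ d : ℤ, F v = p * d := fun v =>
    (ZMod.intCast_zmod_eq_zero_iff_dvd (F v) p).1 (congrFun h v)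
  choose D hD using this
  exact ⟨D, funext fun v => by simp [hD]⟩

variable [NeZero p]

lemma smul_cancel {n : ℕ} {D E : (Fin n → G) → ℤ} (h : (p : ℤ) • D = (p : ℤ) • E) : D = E :=
  smul_right_injective _ (Int.natCast_ne_zero.2 (NeZero.ne p)) h

/-- If an integral cochain `F` satisfies `δF = p E` then `E` is a cocycle modulo `p`. -/
lemma reduce_mem_cocycle {n : ℕ} {F : (Fin n → G) → ℤ} {E : (Fin (n + 1) → G) → ℤ}
    (h : coboundary ℤ G n F = (p : ℤ) • E) : reduce p E ∈ Cocycle p G (n + 1) := by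
  rw [LinearMap.mem_ker, coboundary_reduce]
  have h0 : coboundary ℤ G (n + 1) E = 0 := by
    apply smul_cancel (p := p)
    rw [← map_smul, ← h, coboundary_coboundary, smul_zero]
  rw [h0]
  funext v
  simp [reduce]

lemma isCoboundary_reduce {n : ℕ} {F : (Fin n → G) → ℤ} {E : (Fin (n + 1) → G) → ℤ}
    (h : coboundary ℤ G n F = (p : ℤ) • E) (hF : IsCoboundary (reduce p F)) :
    IsCoboundary (reduce p E) := by
  have main : ∀ F' : (Fin n → G) → ℤ, coboundary ℤ G n F' = (p : ℤ) • E → reduce p F' = 0 →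
      IsCoboundary (reduce p E) := by
    intro F' h' hF'
    obtain ⟨D, rfl⟩ := exists_of_reduce_eq_zero hF'
    rw [map_smul] at h'
    refine Or.inr ⟨n, reduce p D, rfl, ?_⟩
    rw [coboundary_reduce, smul_cancel h']
  rcases hF with hF | ⟨m, g, rfl, hg⟩
  · exact main F h hF
  · let g' : (Fin m → G) → ℤ := fun v => (g v).cast
    have hg' : reduce p g' = g := by
      funext v
      simp [reduce, g']
    refine main (F - coboundary ℤ G m g') ?_ ?_
    · rw [map_sub, h, coboundary_coboundary, sub_zero]
    · have h1 := onSeq_injective hg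
      have h2 := coboundary_reduce (p := p) g'
      rw [hg', ← h1] at h2
      funext v
      have h3 := congrFun h2 v
      simp only [reduce] at h3
      simp [reduce, h3]

/-- The standard integral lift of a mod `p` cochain. -/
def lift {n : ℕ} (f : (Fin n → G) → ZMod p) : (Fin n → G) → ℤ := fun v => ((f v).cast : ℤ)

/-- For a mod `p` cocycle `f` with integral lift `F`, the integral cochain `δF / p`. -/
def divCoboundary {n : ℕ} (f : (Fin n → G) → ZMod p) : (Fin (n + 1) → G) → ℤ :=
  fun v => coboundary ℤ G n (lift f) v / (p : ℤ)

lemma reduce_lift {n : ℕ} (f : (Fin n → G) → ZMod p) : reduce p (lift f) = f := by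
  funext v
  simp [reduce, lift]

lemma coboundary_lift {n : ℕ} (f : Cocycle p G n) :
    coboundary ℤ G n (lift f.1) = (p : ℤ) • divCoboundary f.1 := by
  have h := coboundary_reduce (p := p) (lift f.1)
  rw [reduce_lift, LinearMap.mem_ker.1 f.2] at h
  funext v
  have hv := (ZMod.intCast_zmod_eq_zero_iff_dvd _ p).1 (congrFun h v).symm
  simp only [Pi.smul_apply, smul_eq_mul, divCoboundary]
  exact (Int.mul_ediv_cancel' hv).symm

/-- The Bockstein of a cocycle `f`: the class of `δF / p`, where `F` is an integral lift of `f`. -/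
def bocksteinCocycle (n : ℕ) : Cocycle p G n →+ H p G (n + 1) :=
  AddMonoidHom.mk' (fun f => cls p G (n + 1)
      ⟨reduce p (divCoboundary f.1), reduce_mem_cocycle (coboundary_lift f)⟩) <| by
    intro f g
    rw [← sub_eq_zero, ← map_add, ← map_sub, cls_eq_zero_iff]
    have h : coboundary ℤ G n (lift (f + g).1 - (lift f.1 + lift g.1)) =
        (p : ℤ) • (divCoboundary (f + g).1 - (divCoboundary f.1 + divCoboundary g.1)) := by
      rw [map_sub, map_add, coboundary_lift, coboundary_lift, coboundary_lift, smul_sub, smul_add]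
    have h' := isCoboundary_reduce h (Or.inl (by funext v; simp [reduce, lift]))
    convert h' using 1
    funext v
    simp [reduce]

/-- The Bockstein `β : Hⁿ(BG) → Hⁿ⁺¹(BG)`, the connecting homomorphism of the coefficient sequence
`0 → ℤ/p → ℤ/p² → ℤ/p → 0`: lift a cocycle to an integral cochain `F` and take the class of
`δF / p`. -/
def bockstein (n : ℕ) : H p G n →ₗ[ZMod p] H p G (n + 1) :=
  descend (cls p G n) (cls_surjective n) ((bocksteinCocycle n).toZModLinearMap p) (by
    intro f hf
    refine (cls_eq_zero_iff _).2 (isCoboundary_reduce (coboundary_lift f) ?_)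
    rw [reduce_lift]
    exact (cls_eq_zero_iff _).1 hf)

/-- The Bockstein may be computed from any integral lift `F` of any representing cocycle. -/
lemma bockstein_cls {n : ℕ} (f : Cocycle p G n) {F : (Fin n → G) → ℤ}
    {E : (Fin (n + 1) → G) → ℤ} (hF : reduce p F = f.1)
    (h : coboundary ℤ G n F = (p : ℤ) • E) :
    bockstein n (cls p G n f) = cls p G (n + 1) ⟨reduce p E, reduce_mem_cocycle h⟩ := by
  refine (descend_apply (cls p G n) (cls_surjective n)
    ((bocksteinCocycle n).toZModLinearMap p) _ f).trans ?_
  change cls p G (n + 1) _ = _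
  rw [← sub_eq_zero, ← map_sub, cls_eq_zero_iff]
  have h1 : coboundary ℤ G n (lift f.1 - F) = (p : ℤ) • (divCoboundary f.1 - E) := by
    rw [map_sub, coboundary_lift, h, smul_sub]
  have h' := isCoboundary_reduce h1 (Or.inl (by
    funext v
    have := congrFun hF v
    simp only [reduce] at this
    simp [reduce, lift, this]))
  convert h' using 1
  funext v
  simp [reduce]

end Bockstein

/-! ### The central elementary abelian subgroup and the invariants `c` and `e` -/

section Invariants

variable (p : ℕ) (G : Type) [Group G]

/-- `C(G)`: the elements of the centre of `G` whose `p`-th power is `1`. -/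
def C : Subgroup G where
  carrier := {x | x ∈ Subgroup.center G ∧ x ^ p = 1}
  one_mem' := ⟨one_mem _, one_pow p⟩
  mul_mem' := by
    rintro x y ⟨hx, hx'⟩ ⟨hy, hy'⟩
    have hxy : Commute x y := Subgroup.mem_center_iff.1 hy x
    exact ⟨mul_mem hx hy, by rw [hxy.mul_pow, hx', hy', one_mul]⟩
  inv_mem' := by
    rintro x ⟨hx, hx'⟩
    exact ⟨inv_mem hx, by rw [inv_pow, hx', inv_one]⟩

/-- `C(G)` is the maximal central elementary abelian `p`-subgroup of `G`. -/
lemma isGreatest_C :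
    IsGreatest {V : Subgroup G | V ≤ Subgroup.center G ∧ ∀ x ∈ V, x ^ p = 1} (C p G) :=
  ⟨⟨fun _ hx => hx.1, fun _ hx => hx.2⟩, fun _ hV x hx => ⟨hV.1 hx, hV.2 x hx⟩⟩

instance instAddCommGroupC : AddCommGroup (Additive (C p G)) where
  add_comm x y := Subtype.ext (Subgroup.mem_center_iff.1 y.toMul.2.1 x.toMul.1)

instance instModuleC : Module (ZMod p) (Additive (C p G)) :=
  AddCommGroup.zmodModule fun x => Subtype.ext x.toMul.2.2

/-- `c(G)`: the rank of `C(G)`, i.e. its dimension as a vector space over `𝔽_p`. -/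
def c : ℕ := Module.finrank (ZMod p) (Additive (C p G))

/-- The restriction `i* : H*(BG) → H*(BC(G))`. -/
def resC : HStar p G →ₐ[ZMod p] HStar p (C p G) := res p (C p G).subtype

/-- The `H*(BG)`-decomposables of `H*(BC(G))`: the span of the products `i*(a) b` with `a` of
positive degree. -/
def decomposables : Submodule (ZMod p) (HStar p (C p G)) :=
  Submodule.span (ZMod p) {z | ∃ (n : ℕ) (a : H p G n) (b : HStar p (C p G)),
    0 < n ∧ z = resC p G (inDegree p G n a) * b}

/-- `e(G)`: the top degree of an `H*(BG)`-module generator of `H*(BC(G))`, that is, the top degree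
in which the indecomposables `H*(BC(G)) ⊗_{H*(BG)} 𝔽_p = H*(BC(G)) / decomposables` are nonzero
(`⊤` if they are nonzero in arbitrarily high degrees). -/
def e : ℕ∞ :=
  ⨆ n ∈ {n : ℕ | ∃ b : H p (C p G) n, inDegree p (C p G) n b ∉ decomposables p G}, (n : ℕ∞)

end Invariants

end ModPCohomology

end

noncomputable section

namespace ModPCohomology

set_option linter.unusedSectionVars false

/-! ### Homogeneous cochains on sequences -/

section Sequences

variable {G M N : Type*}

/-! Put `n = |P|/|A| = [P : A]`. Maximality forces `A` to contain every central subgroup, in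
particular `C = C(P)`.

Powers in the image. A class `x` in `H¹(BC)` is a character of `C`. It extends to a character `χ` of
the abelian group `A` with values in `ℤ/M`, `M = pq`, such that `χ = q x` on `C`. The induced
monomial representation of `P` has dimension `n`, and the central subgroup `C` acts on it by the
scalar character `χ`. Its mod `p` Euler class therefore restricts to `β(x)ⁿ`
(`exists_res_eq_bockstein_pow`).

The Euler class is built as an obstruction class. `P` acts on the join of `n` polygons with `M`
vertices, indexed by `P/A`, by permuting and rotating them. This is a sphere of dimension `2n - 1`
(`spherical_sphereLang`) whose fundamental class is preserved, because circles have even degree in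
the join (`exists_invariant_functional`). Equivariant chains on it, indexed by sequences in `P`, can
be chosen up to the top dimension (`exists_equivariant_extension`). The failure to go one step
further is a multiple of the fundamental class, and the multiple is a cocycle of degree `2n`
(`exists_eulerClass`). Over `C` the chains are prescribed by an explicit formula, `rotationChain`,
whose failure is a product of `n` carries. The same product represents `β(x)ⁿ`
(`represents_bockstein_pow`), so the two classes already agree as cochains.

The bound. Split one cyclic factor off `C`, with degree one class `ξ`, Bockstein `y` and projection
`ρ` onto the complement. Every class of degree at least two is `u = ρ*u + ρ*s · ξ + y v`
(`CentralSplitting.exists_decomposition`). Applying this `n` times in each coordinate, a class is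
reduced, modulo multiples of the `y_iⁿ`, to products in which each coordinate contributes at most
`ξ_i y_i^(n-1)`, of degree `2n - 1`. Hence every class of degree above `c(2n - 1)` is a combination
of multiples of the `y_iⁿ` (`res_mem_powerSpan`). These powers are restricted from positive degree
on `P`, so such a class is decomposable. The full Künneth theorem is not needed, and graded
commutativity enters only for classes of degree two. -/

/-- Prepend an entry to a sequence. -/
def scons (a : G) (w : ℕ → G) : ℕ → G
  | 0 => a
  | j + 1 => w j

/-- Drop the first entry of a sequence. -/
def stail (w : ℕ → G) : ℕ → G := fun j => w (j + 1)

@[simp] lemma scons_zero (a : G) (w : ℕ → G) : scons a w 0 = a := rfl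

@[simp] lemma scons_succ (a : G) (w : ℕ → G) (j : ℕ) : scons a w (j + 1) = w j := rfl

@[simp] lemma stail_apply (w : ℕ → G) (j : ℕ) : stail w j = w (j + 1) := rfl

@[simp] lemma stail_scons (a : G) (w : ℕ → G) : stail (scons a w) = w := rfl

@[simp] lemma scons_stail (w : ℕ → G) : scons (w 0) (stail w) = w := by
  funext j; cases j <;> rfl

lemma comp_scons {H : Type*} (f : G → H) (a : G) (w : ℕ → G) :
    f ∘ scons a w = scons (f a) (f ∘ w) := by
  funext j; cases j <;> rfl

lemma comp_stail {H : Type*} (f : G → H) (w : ℕ → G) : f ∘ stail w = stail (f ∘ w) := rfl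

/-- The function depends only on the first `d` entries of the sequence. -/
def DependsOn (d : ℕ) (F : (ℕ → G) → M) : Prop :=
  ∀ w w' : ℕ → G, (∀ i < d, w i = w' i) → F w = F w'

variable [AddCommGroup M] [AddCommGroup N]

/-- The alternating sum of `F` over the sequences obtained by deleting one of the first `d`
entries. For `F` depending on the first `d - 1` entries this is the homogeneous coboundary. -/
def altSum : ℕ → ((ℕ → G) → M) → (ℕ → G) → M
  | 0, _, _ => 0
  | d + 1, F, w => F (stail w) - altSum d (fun u => F (scons (w 0) u)) (stail w)

lemma altSum_zero (F : (ℕ → G) → M) (w : ℕ → G) : altSum 0 F w = 0 := rfl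

lemma altSum_succ (d : ℕ) (F : (ℕ → G) → M) (w : ℕ → G) :
    altSum (d + 1) F w = F (stail w) - altSum d (fun u => F (scons (w 0) u)) (stail w) := rfl

lemma altSum_zero_fun (d : ℕ) (w : ℕ → G) : altSum d (fun _ => (0 : M)) w = 0 := by
  induction d generalizing w with
  | zero => rfl
  | succ d ih => rw [altSum_succ, ih, sub_zero]

lemma altSum_add (d : ℕ) (F F' : (ℕ → G) → M) (w : ℕ → G) :
    altSum d (fun u => F u + F' u) w = altSum d F w + altSum d F' w := by
  induction d generalizing w F F' with
  | zero => simp [altSum]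
  | succ d ih => simp only [altSum_succ, ih]; abel

lemma altSum_map (φ : M →+ N) (d : ℕ) (F : (ℕ → G) → M) (w : ℕ → G) :
    φ (altSum d F w) = altSum d (fun u => φ (F u)) w := by
  induction d generalizing w F with
  | zero => simp [altSum]
  | succ d ih => simp only [altSum_succ, map_sub, ih]

lemma altSum_neg (d : ℕ) (F : (ℕ → G) → M) (w : ℕ → G) :
    altSum d (fun u => -F u) w = -altSum d F w :=
  (altSum_map (-AddMonoidHom.id M) d F w).symm

lemma altSum_sub (d : ℕ) (F F' : (ℕ → G) → M) (w : ℕ → G) :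
    altSum d (fun u => F u - F' u) w = altSum d F w - altSum d F' w := by
  simp only [sub_eq_add_neg, altSum_add, altSum_neg]

lemma altSum_sum {ι : Type*} (s : Finset ι) (d : ℕ) (F : ι → (ℕ → G) → M) (w : ℕ → G) :
    altSum d (fun u => ∑ i ∈ s, F i u) w = ∑ i ∈ s, altSum d (F i) w := by
  classical
  induction s using Finset.induction_on with
  | empty => simp [altSum_zero_fun]
  | insert a s ha ih => simp only [Finset.sum_insert ha, altSum_add, ih]

lemma altSum_comp {H : Type*} (f : G → H) (d : ℕ) (F : (ℕ → H) → M) (w : ℕ → G) :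
    altSum d F (f ∘ w) = altSum d (fun u => F (f ∘ u)) w := by
  induction d generalizing w F with
  | zero => rfl
  | succ d ih =>
    simp only [altSum_succ, ← comp_stail, ih, comp_scons, Function.comp_apply]

lemma altSum_mem {S : Type*} [SetLike S M] [AddSubgroupClass S M] (X : S) (d : ℕ)
    (F : (ℕ → G) → M) (h : ∀ w, F w ∈ X) (w : ℕ → G) : altSum d F w ∈ X := by
  induction d generalizing w F with
  | zero => exact zero_mem X
  | succ d ih => exact sub_mem (h _) (ih _ (fun u => h _) _)

/-- The recursion makes the two terms that delete the first entry cancel, leaving the same identity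
with that entry frozen. It holds for arbitrary functions of infinite sequences, so no dependence
hypothesis is carried. -/
lemma altSum_altSum (d : ℕ) (F : (ℕ → G) → M) (w : ℕ → G) :
    altSum (d + 1) (altSum d F) w = 0 := by
  induction d generalizing w F with
  | zero => simp [altSum]
  | succ d ih =>
    have h : (fun u => altSum (d + 1) F (scons (w 0) u)) =
        fun u => F u - altSum d (fun u => F (scons (w 0) u)) u := rfl
    rw [altSum_succ, h, altSum_sub, ih, sub_zero, sub_self]

lemma DependsOn.altSum {d : ℕ} {F : (ℕ → G) → M} (h : DependsOn d F) :
    DependsOn (d + 1) (altSum (d + 1) F) := by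
  induction d generalizing F with
  | zero =>
    intro w w' hw
    simp only [altSum_succ, altSum_zero, sub_zero]
    exact h _ _ (by simp)
  | succ d ih =>
    intro w w' hw
    rw [altSum_succ, altSum_succ, hw 0 (by omega)]
    congr 1
    · exact h _ _ fun i hi => hw _ (by omega)
    · refine ih (fun u u' hu => h _ _ ?_) _ _ fun i hi => hw _ (by omega)
      rintro (_ | i) hi
      · rfl
      · exact hu i (by omega)

/-- The increasing map omitting the value `i`. -/
def skip (i j : ℕ) : ℕ := if j < i then j else j + 1

lemma altSum_eq_sum (d : ℕ) (F : (ℕ → G) → M) (w : ℕ → G) :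
    altSum d F w = ∑ i ∈ Finset.range d, (-1 : ℤ) ^ i • F (w ∘ skip i) := by
  induction d generalizing w F with
  | zero => rfl
  | succ d ih =>
    rw [altSum_succ, Finset.sum_range_succ', ih]
    have h0 : w ∘ skip 0 = stail w := by funext j; simp [skip]
    have h1 : ∀ i, scons (w 0) (stail w ∘ skip i) = w ∘ skip (i + 1) := by
      intro i; funext j
      cases j with
      | zero => simp [skip]
      | succ j =>
        simp only [scons_succ, Function.comp_apply, skip, stail_apply, add_lt_add_iff_right]
        split_ifs <;> rfl
    simp only [h0, h1, pow_succ, mul_neg, mul_one, neg_smul, Finset.sum_neg_distrib, pow_zero,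
      one_smul]
    abel

end Sequences

/-! ### Cup products of homogeneous cochains and the Leibniz rule -/

section CupSequences

variable {G k : Type*} [CommRing k]

/-- The homogeneous cup product; the first factor has degree `m`. -/
def hcup (m : ℕ) (F H : (ℕ → G) → k) : (ℕ → G) → k := fun w => F w * H fun j => w (m + j)

lemma altSum_const_mul (d : ℕ) (r : k) (F : (ℕ → G) → k) (w : ℕ → G) :
    altSum d (fun u => r * F u) w = r * altSum d F w :=
  (altSum_map (AddMonoidHom.mulLeft r) d F w).symm

/-- Leibniz rule. A cochain of degree `m` reads `m + 1` entries, so its coboundary is `altSum (m +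
2)`. The two factors share the entry `m`: deleting it in both produces two terms of opposite sign,
which is why the bounds on the right add up to more than the one on the left. -/
lemma altSum_hcup (m n : ℕ) (F H : (ℕ → G) → k) (hF : DependsOn (m + 1) F) (w : ℕ → G) :
    altSum (m + n + 2) (hcup m F H) w = altSum (m + 2) F w * H (fun j => w (m + 1 + j)) +
      (-1) ^ m * (F w * altSum (n + 2) H fun j => w (m + j)) := by
  induction m generalizing F w with
  | zero =>
    have hF' : ∀ u v : ℕ → G, u 0 = v 0 → F u = F v := fun u v h => hF u v fun i hi => by
      obtain rfl : i = 0 := by omega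
      exact h
    have e1 : (fun j => w (0 + 1 + j)) = stail w := by funext j; simp [add_comm]
    have e0 : ∀ v : ℕ → G, (fun j => v (0 + j)) = v := fun v => by funext j; simp
    have e2 : altSum (0 + n + 2) (hcup 0 F H) w = F (stail w) * H (stail w) -
        F w * altSum (n + 1) (fun u => H (scons (w 0) u)) (stail w) := by
      rw [zero_add, altSum_succ, ← altSum_const_mul]
      simp only [hcup, e0]
      congr 2
      funext u
      rw [hF' (scons (w 0) u) w rfl]
    rw [e2, e1, e0, altSum_succ (n + 1) H, altSum_succ 1 F, altSum_succ 0, altSum_zero,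
      hF' (scons (w 0) (stail (stail w))) w rfl]
    ring
  | succ m ih =>
    have e1 : ∀ u, hcup (m + 1) F H (scons (w 0) u) =
        hcup m (fun u => F (scons (w 0) u)) H u := by
      intro u
      simp only [hcup]
      congr 2
      funext j
      rw [show m + 1 + j = (m + j) + 1 by omega, scons_succ]
    have hF' : DependsOn (m + 1) (fun u => F (scons (w 0) u)) := by
      intro u u' hu
      refine hF _ _ ?_
      rintro (_ | i) hi
      · rfl
      · exact hu i (by omega)
    rw [show m + 1 + n + 2 = (m + n + 2) + 1 by omega, altSum_succ, altSum_succ (m + 2)]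
    simp only [e1]
    rw [ih _ hF']
    simp only [hcup, scons_stail, stail_apply]
    have e2 : ∀ c, (fun j => w (c + j + 1)) = fun j => w (c + 1 + j) := by
      intro c; funext j; congr 1; omega
    simp only [e2]
    ring

end CupSequences

/-! ### Homogeneous representatives of cohomology classes -/

section Representatives

variable {p : ℕ} {G : Type} [Group G]

/-- The sequence of successive quotients of a sequence in a group. -/
def quot (w : ℕ → G) : ℕ → G := fun i => (w i)⁻¹ * w (i + 1)

/-- The sequence of partial products. -/
def partialProd (v : ℕ → G) : ℕ → G
  | 0 => 1
  | i + 1 => partialProd v i * v i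

lemma quot_partialProd (v : ℕ → G) : quot (partialProd v) = v := by
  funext i; simp [quot, partialProd]

lemma mul_partialProd_quot (w : ℕ → G) (i : ℕ) : w 0 * partialProd (quot w) i = w i := by
  induction i with
  | zero => simp [partialProd]
  | succ i ih => rw [partialProd, ← mul_assoc, ih]; simp [quot]

lemma partialProd_congr {v v' : ℕ → G} {d : ℕ} (h : ∀ i < d, v i = v' i) :
    ∀ i < d + 1, partialProd v i = partialProd v' i := by
  intro i hi
  induction i with
  | zero => rfl
  | succ i ih => rw [partialProd, partialProd, ih (by omega), h i (by omega)]

lemma quot_mul (g : G) (w : ℕ → G) : quot ((g * ·) ∘ w) = quot w := by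
  funext i; simp [quot, mul_assoc]

/-- Deleting entry `j + 1` of `w` multiplies the quotients `j` and `j + 1`, and deleting entry `0`
drops the first quotient. This is the dictionary between the homogeneous and the inhomogeneous
coboundary. -/
lemma altSum_onSeq_quot {k : Type} [CommRing k] {n : ℕ} (f : (Fin n → G) → k) (w : ℕ → G) :
    altSum (n + 2) (fun u => onSeq f (quot u)) w = onSeq (coboundary k G n f) (quot w) := by
  rw [onSeq_coboundary, altSum_eq_sum, Finset.sum_range_succ', add_comm]
  congr 1
  · have : quot (w ∘ skip 0) = fun i => quot w (i + 1) := by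
      funext i; simp [quot, skip]
    simp [this]
  · refine Finset.sum_congr rfl fun j _ => ?_
    have : quot (w ∘ skip (j + 1)) = contractSeq j (quot w) := by
      funext i
      simp only [quot, skip, contractSeq, Function.comp_apply]
      rcases lt_trichotomy i j with h | h | h
      · rw [if_pos (by omega), if_pos (by omega), if_pos h]
      · subst h
        rw [if_pos (by omega), if_neg (by omega), if_neg (by omega), if_pos rfl]
        simp [mul_assoc]
      · rw [if_neg (by omega), if_neg (by omega), if_neg (by omega), if_neg (by omega)]
    rw [this]
    simp

/-- The homogeneous cochain `F` is the homogeneous form of a degree `d` cocycle with class `u`. -/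
def Represents (d : ℕ) (F : (ℕ → G) → ZMod p) (u : HStar p G) : Prop :=
  ∃ f : Cocycle p G d, (∀ w, onSeq f.1 (quot w) = F w) ∧ u = inDegree p G d (cls p G d f)

/-- A cochain is invariant under left translation by the elements satisfying `S`. -/
def InvariantUnder {M : Type*} (S : G → Prop) (F : (ℕ → G) → M) : Prop :=
  ∀ g, S g → ∀ w : ℕ → G, F ((g * ·) ∘ w) = F w

/-- The inhomogeneous form of an invariant homogeneous cochain. -/
lemma exists_inhomogeneous {k : Type} {d : ℕ} {F : (ℕ → G) → k} (hd : DependsOn (d + 1) F)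
    (hi : InvariantUnder (fun _ => True) F) :
    ∃ f : (Fin d → G) → k, ∀ w, onSeq f (quot w) = F w := by
  refine ⟨fun v => F (partialProd fun i => if h : i < d then v ⟨i, h⟩ else 1), fun w => ?_⟩
  simp only [onSeq]
  rw [← hi (w 0) trivial]
  refine hd _ _ fun i hi => ?_
  refine Eq.trans ?_ (mul_partialProd_quot w i)
  change w 0 * _ = _
  congr 1
  refine partialProd_congr (d := d) (fun i hi => ?_) i hi
  rw [dif_pos hi]

lemma exists_represents {d : ℕ} {F : (ℕ → G) → ZMod p} (hd : DependsOn (d + 1) F)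
    (hi : InvariantUnder (fun _ => True) F) (hc : ∀ w, altSum (d + 2) F w = 0) :
    ∃ u, Represents d F u := by
  obtain ⟨f, hf⟩ := exists_inhomogeneous hd hi
  have hf' : F = fun w => onSeq f (quot w) := funext fun w => (hf w).symm
  refine ⟨_, ⟨f, ?_⟩, hf, rfl⟩
  rw [LinearMap.mem_ker]
  apply onSeq_injective
  funext v
  rw [← quot_partialProd v, ← altSum_onSeq_quot, ← hf', hc]
  rfl

lemma represents_cls {d : ℕ} (f : Cocycle p G d) :
    Represents d (fun w => onSeq f.1 (quot w)) (inDegree p G d (cls p G d f)) :=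
  ⟨f, fun _ => rfl, rfl⟩

lemma onSeq_dependsOn {k : Type} [CommRing k] {d : ℕ} (f : (Fin d → G) → k) :
    DependsOn (d + 1) fun w => onSeq f (quot w) := by
  intro w w' h
  refine onSeq_congr f fun i hi => ?_
  simp only [quot]
  rw [h i (by omega), h (i + 1) (by omega)]

lemma Represents.dependsOn {d : ℕ} {F : (ℕ → G) → ZMod p} {u : HStar p G}
    (h : Represents d F u) : DependsOn (d + 1) F := by
  obtain ⟨f, hf, -⟩ := h
  rw [← show (fun w => onSeq f.1 (quot w)) = F from funext hf]
  exact onSeq_dependsOn f.1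

lemma Represents.invariant {d : ℕ} {F : (ℕ → G) → ZMod p} {u : HStar p G}
    (h : Represents d F u) : InvariantUnder (fun _ => True) F := by
  obtain ⟨f, hf, -⟩ := h
  intro g _ w
  rw [← hf, ← hf, quot_mul]

lemma Represents.closed {d : ℕ} {F : (ℕ → G) → ZMod p} {u : HStar p G}
    (h : Represents d F u) (w : ℕ → G) : altSum (d + 2) F w = 0 := by
  obtain ⟨f, hf, -⟩ := h
  rw [← show (fun w => onSeq f.1 (quot w)) = F from funext hf, altSum_onSeq_quot,
    LinearMap.mem_ker.1 f.2]
  rfl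

lemma Represents.add {d : ℕ} {F F' : (ℕ → G) → ZMod p} {u u' : HStar p G}
    (h : Represents d F u) (h' : Represents d F' u') :
    Represents d (fun w => F w + F' w) (u + u') := by
  obtain ⟨f, hf, rfl⟩ := h
  obtain ⟨f', hf', rfl⟩ := h'
  refine ⟨f + f', fun w => ?_, by rw [map_add, map_add]⟩
  exact congrArg₂ (· + ·) (hf w) (hf' w)

lemma Represents.smul {d : ℕ} {F : (ℕ → G) → ZMod p} {u : HStar p G} (r : ZMod p)
    (h : Represents d F u) : Represents d (fun w => r * F w) (r • u) := by
  obtain ⟨f, hf, rfl⟩ := h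
  refine ⟨r • f, fun w => ?_, by rw [map_smul, map_smul]⟩
  exact congrArg (r * ·) (hf w)

lemma Represents.sub {d : ℕ} {F F' : (ℕ → G) → ZMod p} {u u' : HStar p G}
    (h : Represents d F u) (h' : Represents d F' u') :
    Represents d (fun w => F w - F' w) (u - u') := by
  have := h.add (h'.smul (-1))
  simpa [sub_eq_add_neg] using this

lemma Represents.mul {m n : ℕ} {F H : (ℕ → G) → ZMod p} {u v : HStar p G}
    (hF : Represents m F u) (hH : Represents n H v) :
    Represents (m + n) (hcup m F H) (u * v) := by
  obtain ⟨f, hf, rfl⟩ := hF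
  obtain ⟨h, hh, rfl⟩ := hH
  refine ⟨cocycleCup f h, fun w => ?_, ?_⟩
  · rw [hcup, ← hf, ← hh]
    exact onSeq_cup _ _ _
  · simp only [inDegree, DirectSum.lof_eq_of, DirectSum.of_mul_of, gmul_def, cup_cls]

/-- Invariance of the primitive `K` is the essential condition: it is what makes `K` the homogeneous
form of an inhomogeneous cochain. -/
lemma Represents.eq_zero {d : ℕ} {F K : (ℕ → G) → ZMod p} {u : HStar p G}
    (h : Represents (d + 1) F u) (hd : DependsOn (d + 1) K)
    (hi : InvariantUnder (fun _ => True) K) (hK : ∀ w, F w = altSum (d + 2) K w) : u = 0 := by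
  obtain ⟨f, hf, rfl⟩ := h
  obtain ⟨g, hg⟩ := exists_inhomogeneous hd hi
  have hg' : K = fun w => onSeq g (quot w) := funext fun w => (hg w).symm
  rw [(cls_eq_zero_iff f).2, map_zero]
  refine Or.inr ⟨d, g, rfl, ?_⟩
  funext v
  rw [← quot_partialProd v, hf, ← altSum_onSeq_quot, hK, hg']

lemma Represents.unique {d : ℕ} {F : (ℕ → G) → ZMod p} {u u' : HStar p G}
    (h : Represents d F u) (h' : Represents d F u') : u = u' := by
  obtain ⟨f, hf, rfl⟩ := h
  obtain ⟨f', hf', rfl⟩ := h'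
  congr 2
  apply Subtype.ext
  apply onSeq_injective
  funext v
  rw [← quot_partialProd v, hf, hf']

lemma res_inDegree {K : Type} [Group K] (φ : K →* G) {d : ℕ} (f : Cocycle p G d) :
    res p φ (inDegree p G d (cls p G d f)) = inDegree p K d (cls p K d (cocycleRes φ f)) := by
  rw [← resDegree_cls]
  simp only [res, inDegree]
  exact DirectSum.toModule_lof (ZMod p) (φ := fun n => inDegree p K n ∘ₗ resDegree p φ n) d _

lemma Represents.res {K : Type} [Group K] (φ : K →* G) {d : ℕ} {F : (ℕ → G) → ZMod p}
    {u : HStar p G} (h : Represents d F u) :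
    Represents d (fun w => F (φ ∘ w)) (res p φ u) := by
  obtain ⟨f, hf, rfl⟩ := h
  refine ⟨cocycleRes φ f, fun w => ?_, res_inDegree φ f⟩
  refine Eq.trans (congrArg f.1 ?_) (hf _)
  funext i
  simp [quot]

end Representatives

/-! ### The prism homotopy -/

section Prism

variable {G M : Type*} [AddCommGroup M]

/-- The prism operator between the identity and a self-map `ρ`. -/
def prism (ρ : G → G) : ℕ → ((ℕ → G) → M) → (ℕ → G) → M
  | 0, _, _ => 0
  | m + 1, F, w => F (scons (w 0) (ρ ∘ w)) - prism ρ m (fun u => F (scons (w 0) u)) (stail w)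

lemma prism_succ (ρ : G → G) (m : ℕ) (F : (ℕ → G) → M) (w : ℕ → G) :
    prism ρ (m + 1) F w =
      F (scons (w 0) (ρ ∘ w)) - prism ρ m (fun u => F (scons (w 0) u)) (stail w) := rfl

lemma prism_sub (ρ : G → G) (m : ℕ) (F F' : (ℕ → G) → M) (w : ℕ → G) :
    prism ρ m (fun u => F u - F' u) w = prism ρ m F w - prism ρ m F' w := by
  induction m generalizing w F F' with
  | zero => simp [prism]
  | succ d ih => simp only [prism_succ, ih]; abel

lemma prism_zero_fun (ρ : G → G) (m : ℕ) (w : ℕ → G) : prism ρ m (fun _ => (0 : M)) w = 0 := by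
  induction m generalizing w with
  | zero => rfl
  | succ d ih => rw [prism_succ, ih, sub_zero]

lemma DependsOn.scons {m : ℕ} {F : (ℕ → G) → M} (h : DependsOn (m + 1) F) (a : G) :
    DependsOn m fun u => F (scons a u) := by
  intro u u' hu
  refine h _ _ ?_
  rintro (_ | i) hi
  · rfl
  · exact hu i (by omega)

lemma DependsOn.prism (ρ : G → G) {m : ℕ} {F : (ℕ → G) → M} (h : DependsOn (m + 1) F) :
    DependsOn m (prism ρ m F) := by
  induction m generalizing F with
  | zero => intro w w' _; rfl
  | succ m ih =>
    intro w w' hw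
    rw [prism_succ, prism_succ, hw 0 (by omega)]
    congr 1
    · refine h _ _ ?_
      rintro (_ | i) hi
      · rfl
      · simp [hw i (by omega)]
    · exact ih (h.scons _) _ _ fun i hi => hw _ (by omega)

lemma prism_translate [Mul G] (ρ : G → G) {g : G} (hg : ∀ h, ρ (g * h) = g * ρ h) (m : ℕ)
    (F : (ℕ → G) → M) (w : ℕ → G) :
    prism ρ m F ((g * ·) ∘ w) = prism ρ m (fun u => F ((g * ·) ∘ u)) w := by
  induction m generalizing F w with
  | zero => rfl
  | succ m ih =>
    simp only [prism_succ, ← comp_stail, ih, comp_scons, Function.comp_apply]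
    congr 3
    funext i
    simp [hg]

/-- The prism `w₀ … wᵢ ρ(wᵢ) … ρ(wₘ)` interpolates between `w` and `ρ ∘ w`; interior faces cancel in
pairs. The induction freezes the first entry. -/
lemma altSum_prism (ρ : G → G) (m : ℕ) (F : (ℕ → G) → M) (hF : DependsOn (m + 1) F)
    (w : ℕ → G) :
    altSum (m + 1) (prism ρ m F) w + prism ρ (m + 1) (altSum (m + 2) F) w =
      F (ρ ∘ w) - F w := by
  induction m generalizing F w with
  | zero =>
    have h0 : F (scons (w 0) (stail (ρ ∘ w))) = F w := hF _ _ fun i hi => by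
      obtain rfl : i = 0 := by omega
      rfl
    simp only [prism, altSum, scons_zero, stail_scons, h0]
    abel
  | succ m ih =>
    have e1 : altSum (m + 2) (prism ρ (m + 1) F) w = prism ρ (m + 1) F (stail w) -
        (altSum (m + 1) (fun u => F (scons (w 0) (scons (ρ (w 0)) (ρ ∘ u)))) (stail w) -
          altSum (m + 1) (prism ρ m fun u => F (scons (w 0) u)) (stail w)) := by
      rw [altSum_succ, ← altSum_sub]
      simp only [prism_succ ρ m, scons_zero, stail_scons, comp_scons]
    have e2 : prism ρ (m + 2) (altSum (m + 3) F) w = altSum (m + 3) F (scons (w 0) (ρ ∘ w)) -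
        (prism ρ (m + 1) F (stail w) -
          prism ρ (m + 1) (altSum (m + 2) fun u => F (scons (w 0) u)) (stail w)) := by
      rw [prism_succ, ← prism_sub]
      rfl
    have e3 : altSum (m + 3) F (scons (w 0) (ρ ∘ w)) = F (ρ ∘ w) -
        (F (scons (w 0) (ρ ∘ stail w)) -
          altSum (m + 1) (fun u => F (scons (w 0) (scons (ρ (w 0)) (ρ ∘ u)))) (stail w)) := by
      rw [altSum_succ, altSum_succ, ← altSum_comp ρ (m + 1) fun u =>
        F (scons (w 0) (scons (ρ (w 0)) u))]
      rfl
    have e4 := ih (fun u => F (scons (w 0) u)) (hF.scons _) (stail w)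
    rw [scons_stail] at e4
    rw [e1, e2, e3, sub_eq_iff_eq_add.1 e4.symm]
    abel

end Prism

/-! ### Carries -/

/-- The carry of the addition of two residues modulo `M`. -/
def carry {M : ℕ} (a b : ZMod M) : ℤ := ((a.val : ℤ) + b.val - (a + b).val) / M

lemma mul_carry {M : ℕ} [NeZero M] (a b : ZMod M) :
    (M : ℤ) * carry a b = (a.val : ℤ) + b.val - (a + b).val := by
  refine Int.mul_ediv_cancel' ?_
  rw [← ZMod.intCast_zmod_eq_zero_iff_dvd]
  simp

/-- `M` times the carry is the coboundary of the integral cochain `ZMod.val`, and `M` cancels in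
`ℤ`. -/
lemma carry_cocycle {M : ℕ} [NeZero M] (a b c : ZMod M) :
    carry b c - carry (a + b) c + carry a (b + c) - carry a b = 0 := by
  have h : (M : ℤ) ≠ 0 := Int.natCast_ne_zero.2 (NeZero.ne M)
  refine (mul_eq_zero.1 ?_).resolve_left h
  have h1 := mul_carry b c
  have h2 := mul_carry (a + b) c
  have h3 := mul_carry a (b + c)
  have h4 := mul_carry a b
  rw [add_assoc] at h2
  linear_combination h1 - h2 + h3 - h4

/-! ### Bocksteins of characters as carry cochains -/

section Bockstein

variable {p : ℕ} [NeZero p] {G : Type} [Group G]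

lemma oneCocycle_add (f : Cocycle p G 1) (g h : G) :
    f.1 (fun _ => g * h) = f.1 (fun _ => g) + f.1 (fun _ => h) := by
  have := congrFun (congrArg onSeq (LinearMap.mem_ker.1 f.2)) (scons g fun _ => h)
  rw [onSeq_coboundary] at this
  have e0 : onSeq (0 : (Fin 2 → G) → ZMod p) (scons g fun _ => h) = 0 := rfl
  rw [e0] at this
  have e1 : onSeq f.1 (fun i => scons g (fun _ => h) (i + 1)) = f.1 fun _ => h := rfl
  have e2 : onSeq f.1 (contractSeq 0 (scons g fun _ => h)) = f.1 fun _ => g * h :=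
    congrArg f.1 (by funext i; obtain rfl : i = 0 := Subsingleton.elim _ _; rfl)
  have e3 : onSeq f.1 (contractSeq 1 (scons g fun _ => h)) = f.1 fun _ => g :=
    congrArg f.1 (by funext i; obtain rfl : i = 0 := Subsingleton.elim _ _; rfl)
  rw [Finset.sum_range_succ, Finset.sum_range_one, e1, e2, e3] at this
  linear_combination -this

/-- The homogeneous cochain of carries represents the Bockstein of a character. -/
lemma represents_bockstein (f : Cocycle p G 1) :
    Represents 2 (fun w => ((carry (f.1 fun _ => (w 0)⁻¹ * w 1) (f.1 fun _ => (w 1)⁻¹ * w 2) : ℤ) :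
      ZMod p)) (inDegree p G 2 (bockstein 1 (cls p G 1 f))) := by
  let E : (Fin 2 → G) → ℤ := fun v => carry (f.1 fun _ => v 0) (f.1 fun _ => v 1)
  have hE : coboundary ℤ G 1 (lift f.1) = (p : ℤ) • E := by
    apply onSeq_injective
    funext v
    rw [onSeq_coboundary, Finset.sum_range_succ, Finset.sum_range_one]
    have e1 : ∀ u : ℕ → G, onSeq (lift f.1) u = ((f.1 fun _ => u 0).val : ℤ) := fun u => by
      simp only [onSeq, lift, ZMod.natCast_val]
      refine congrArg (fun a : ZMod p => (a.cast : ℤ)) (congrArg f.1 ?_)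
      funext i; obtain rfl : i = 0 := Subsingleton.elim _ _; rfl
    have e2 : onSeq ((p : ℤ) • E) v = p * carry (f.1 fun _ => v 0) (f.1 fun _ => v 1) := rfl
    rw [e2, mul_carry, e1, e1, e1, ← oneCocycle_add]
    simp [contractSeq]
    ring
  rw [bockstein_cls f (reduce_lift f.1) hE]
  exact ⟨_, fun w => rfl, rfl⟩

end Bockstein

/-! ### Cohomology of a group with a split central subgroup of order `p` -/

/-- A central element `t` of order `p` together with a character `x` with `x t = 1`; `ρ` is the
projection onto the kernel of `x` along `t`. -/
structure CentralSplitting (p : ℕ) (G : Type) [Group G] where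
  x : G → ZMod p
  t : G
  ρ : G →* G
  x_mul : ∀ g h, x (g * h) = x g + x h
  t_comm : ∀ g, t * g = g * t
  t_pow : t ^ p = 1
  x_t : x t = 1
  eq_mul : ∀ g, g = ρ g * t ^ (x g).val

namespace CentralSplitting

variable {p : ℕ} [Fact p.Prime] {G : Type} [Group G] (S : CentralSplitting p G)

lemma x_one : S.x 1 = 0 := by simpa using S.x_mul 1 1

lemma x_inv_mul (g h : G) : S.x (g⁻¹ * h) = S.x h - S.x g := by
  have := S.x_mul g (g⁻¹ * h)
  rw [mul_inv_cancel_left] at this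
  rw [this]; ring

lemma ρ_of_x_eq_zero {g : G} (h : S.x g = 0) : S.ρ g = g := by
  have := S.eq_mul g
  rw [h, ZMod.val_zero, pow_zero, mul_one] at this
  exact this.symm

lemma ρ_t : S.ρ S.t = 1 := by
  have h := S.eq_mul S.t
  rwa [S.x_t, ZMod.val_one, pow_one, eq_comm, mul_eq_right] at h

lemma x_t_pow (n : ℕ) : S.x (S.t ^ n) = n := by
  induction n with
  | zero => simp [S.x_one]
  | succ n ih => rw [pow_succ, S.x_mul, ih, S.x_t]; simp

lemma x_ρ (g : G) : S.x (S.ρ g) = 0 := by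
  have h := congrArg S.x (S.eq_mul g)
  rw [S.x_mul, S.x_t_pow, ZMod.natCast_val, ZMod.cast_id] at h
  simpa using h

/-- Invariance under the kernel of the character. -/
abbrev KerInvariant {M : Type*} (F : (ℕ → G) → M) : Prop := InvariantUnder (fun g => S.x g = 0) F

lemma invariant_of_ker {M : Type*} {F : (ℕ → G) → M} (h : S.KerInvariant F)
    (ht : ∀ w, F ((S.t * ·) ∘ w) = F w) : InvariantUnder (fun _ => True) F := by
  have htn : ∀ (n : ℕ) w, F ((S.t ^ n * ·) ∘ w) = F w := by
    intro n
    induction n with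
    | zero => intro w; congr 1; funext i; simp
    | succ n ih =>
      intro w
      rw [← ih w, ← ht ((S.t ^ n * ·) ∘ w)]
      congr 1; funext i; simp [pow_succ', mul_assoc]
  intro g _ w
  conv_lhs => rw [S.eq_mul g]
  rw [← htn (S.x g).val w, ← h (S.ρ g) (S.x_ρ g) ((S.t ^ (S.x g).val * ·) ∘ w)]
  congr 1; funext i; simp [mul_assoc]

lemma comp_t_comm (g : G) (w : ℕ → G) :
    (S.t * ·) ∘ (g * ·) ∘ w = (g * ·) ∘ (S.t * ·) ∘ w := by
  funext i
  simp only [Function.comp_apply]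
  rw [← mul_assoc, S.t_comm, mul_assoc]

variable {k : Type*} [CommRing k]

/-- The norm along the powers of `t`. -/
def norm (F : (ℕ → G) → k) : (ℕ → G) → k :=
  fun w => ∑ j ∈ Finset.range p, F ((S.t ^ j * ·) ∘ w)

lemma norm_t (F : (ℕ → G) → k) (w : ℕ → G) : S.norm F ((S.t * ·) ∘ w) = S.norm F w := by
  have h : ∀ j, F ((S.t ^ j * ·) ∘ (S.t * ·) ∘ w) = F ((S.t ^ (j + 1) * ·) ∘ w) := by
    intro j; congr 1; funext i; simp [pow_succ, mul_assoc]
  simp only [norm, h]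
  obtain ⟨q, hq⟩ : ∃ q, p = q + 1 := ⟨p - 1, by have := (Fact.out : p.Prime).pos; omega⟩
  have e : ∀ f : ℕ → k, f p = f 0 → ∑ j ∈ Finset.range p, f (j + 1) = ∑ j ∈ Finset.range p, f j := by
    intro f hf
    rw [hq] at hf ⊢
    rw [Finset.sum_range_succ, Finset.sum_range_succ' f, hf]
  refine e (fun j => F ((S.t ^ j * ·) ∘ w)) ?_
  simp only [S.t_pow, pow_zero]

lemma norm_ker {F : (ℕ → G) → k} (h : S.KerInvariant F) : S.KerInvariant (S.norm F) := by
  intro g hg w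
  refine Finset.sum_congr rfl fun j _ => ?_
  rw [← h g hg ((S.t ^ j * ·) ∘ w)]
  congr 1; funext i
  simp only [Function.comp_apply]
  rw [← mul_assoc, ← mul_assoc, (show Commute S.t g from S.t_comm g).pow_left j]

lemma altSum_norm (d : ℕ) (F : (ℕ → G) → k) (w : ℕ → G) :
    altSum d (S.norm F) w = S.norm (altSum d F) w := by
  unfold norm
  rw [altSum_sum]
  refine Finset.sum_congr rfl fun j _ => ?_
  rw [altSum_comp]

/-- Cochains invariant under the kernel of `x` form a coinduced module for the cyclic group of `t`,
so an element of norm zero is a translate difference. -/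
lemma exists_eq_translate_sub {d : ℕ} {F : (ℕ → G) → k} (hd : DependsOn (d + 1) F)
    (hk : S.KerInvariant F) (hn : ∀ w, S.norm F w = 0) :
    ∃ K : (ℕ → G) → k, DependsOn (d + 1) K ∧ S.KerInvariant K ∧
      ∀ w, K ((S.t * ·) ∘ w) - K w = F w := by
  -- Sum `F` along the `t`-orbit until `x` of the first entry wraps round to `0`. Translating by `t`
  -- shortens the sum by one term, except at the wrap, where the full norm appears and vanishes.
  refine ⟨fun w => -∑ j ∈ Finset.range (p - (S.x (w 0)).val), F ((S.t ^ j * ·) ∘ w), ?_, ?_, ?_⟩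
  · intro w w' hw
    simp only
    rw [hw 0 (by omega)]
    congr 1
    refine Finset.sum_congr rfl fun j _ => hd _ _ fun i hi => ?_
    simp [hw i hi]
  · intro g hg w
    simp only [Function.comp_apply, S.x_mul, hg, zero_add]
    congr 1
    refine Finset.sum_congr rfl fun j _ => ?_
    rw [← hk g hg ((S.t ^ j * ·) ∘ w)]
    congr 1; funext i
    simp only [Function.comp_apply]
    rw [← mul_assoc, ← mul_assoc, (show Commute S.t g from S.t_comm g).pow_left j]
  · intro w
    have h : ∀ j, F ((S.t ^ j * ·) ∘ (S.t * ·) ∘ w) = F ((S.t ^ (j + 1) * ·) ∘ w) := by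
      intro j; congr 1; funext i; simp [pow_succ, mul_assoc]
    have h0 : F ((S.t ^ 0 * ·) ∘ w) = F w := by congr 1; funext i; simp
    simp only [h, Function.comp_apply, S.x_mul, S.x_t]
    have hlt := ZMod.val_lt (S.x (w 0))
    rcases Nat.lt_or_ge ((S.x (w 0)).val + 1) p with hv | hv
    · have hv' : (1 + S.x (w 0)).val = (S.x (w 0)).val + 1 := by
        rw [add_comm, ZMod.val_add_of_lt] <;> rw [ZMod.val_one]
        exact hv
      rw [hv', show p - (S.x (w 0)).val = (p - ((S.x (w 0)).val + 1)) + 1 by omega,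
        Finset.sum_range_succ', h0]
      ring
    · have hv' : (1 + S.x (w 0)).val = 0 := by
        rw [ZMod.val_eq_zero]
        have := ZMod.natCast_zmod_val (S.x (w 0))
        rw [← this, show (S.x (w 0)).val = p - 1 by omega,
          Nat.cast_sub (Fact.out : p.Prime).one_le]
        simp
      have hs := hn ((S.t * ·) ∘ w)
      unfold norm at hs
      simp only [h] at hs
      rw [hv', Nat.sub_zero, hs, show p - (S.x (w 0)).val = 1 by omega, Finset.sum_range_one, h0]
      ring

end CentralSplitting

lemma DependsOn.hcup {G k : Type*} [CommRing k] {m n : ℕ} {F H : (ℕ → G) → k}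
    (hF : DependsOn (m + 1) F) (hH : DependsOn (n + 1) H) :
    DependsOn (m + n + 1) (hcup m F H) := by
  intro w w' hw
  simp only [ModPCohomology.hcup]
  rw [hF w w' fun i hi => hw i (by omega), hH _ _ fun i hi => hw (m + i) (by omega)]

namespace CentralSplitting

variable {p : ℕ} [Fact p.Prime] {G : Type} [Group G] (S : CentralSplitting p G)

/-- Adding `1` repeatedly runs once round `ℤ/p` and carries exactly once; after multiplication by
`p` the sum telescopes. -/
lemma sum_carry_one (a : ZMod p) : ∑ j ∈ Finset.range p, carry 1 ((j : ZMod p) + a) = 1 := by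
  have hp : (p : ℤ) ≠ 0 := Int.natCast_ne_zero.2 (NeZero.ne p)
  refine mul_left_cancel₀ hp ?_
  have h : ∀ j : ℕ, (p : ℤ) * carry 1 ((j : ZMod p) + a) =
      1 - ((((j + 1 : ℕ) : ZMod p) + a).val - ((j : ZMod p) + a).val : ℤ) := by
    intro j
    rw [mul_carry, ZMod.val_one, show (1 : ZMod p) + (j + a) = ((j + 1 : ℕ) : ZMod p) + a by
      push_cast; ring]
    push_cast; ring
  rw [Finset.mul_sum, Finset.sum_congr rfl fun j _ => h j, Finset.sum_sub_distrib,
    Finset.sum_range_sub (fun j : ℕ => (((j : ZMod p) + a).val : ℤ))]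
  simp

/-- `ρ` fixes the kernel of `x`, hence commutes with translation by it. It does not commute with
translation by `t`, so invariance under all of `G` is lost here. -/
lemma prism_ker {M : Type*} [AddCommGroup M] {m : ℕ} {F : (ℕ → G) → M} (h : S.KerInvariant F) :
    S.KerInvariant (prism S.ρ m F) := by
  intro g hg w
  rw [prism_translate]
  · congr 1; funext u; exact h g hg u
  · intro a; rw [map_mul, S.ρ_of_x_eq_zero hg]

/-- This replaces the Künneth formula for `G = ker x × ⟨t⟩`. The prism gives `δa = ρ*U - U` with `a`
invariant only under `ker x`. The failure of `t`-invariance of `a` is corrected by cochains built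
from `x` and from carries, and the coboundaries of these corrections are the terms containing `ξ`
and `y`. -/
theorem exists_decomposition {m : ℕ} {U : (ℕ → G) → ZMod p} {u ξ y : HStar p G}
    (hU : Represents (m + 2) U u) (hξ : Represents 1 (fun w => S.x ((w 0)⁻¹ * w 1)) ξ)
    (hy : Represents 2 (fun w => ((carry (S.x ((w 0)⁻¹ * w 1)) (S.x ((w 1)⁻¹ * w 2)) : ℤ) :
      ZMod p)) y) :
    ∃ s v : HStar p G, (∃ F, Represents (m + 1) F s) ∧ (∃ F, Represents m F v) ∧
      u = res p S.ρ u + res p S.ρ s * ξ + y * v := by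
  have cρ : ∀ w : ℕ → G, S.ρ ∘ (S.t * ·) ∘ w = S.ρ ∘ w := by
    intro w; funext i; simp [S.ρ_t]
  have cρg : ∀ g (w : ℕ → G), S.ρ ∘ (g * ·) ∘ w = (S.ρ g * ·) ∘ S.ρ ∘ w := by
    intro g w; funext i; simp
  have altt : ∀ (d : ℕ) (F : (ℕ → G) → ZMod p) w,
      altSum d (fun u => F ((S.t * ·) ∘ u)) w = altSum d F ((S.t * ·) ∘ w) := fun d F w =>
    (altSum_comp _ d F w).symm
  have Uinv := hU.invariant
  set a : (ℕ → G) → ZMod p := prism S.ρ (m + 2) U with ha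
  have aK : S.KerInvariant a := S.prism_ker fun g _ => Uinv g trivial
  have aD : DependsOn (m + 2) a := hU.dependsOn.prism S.ρ
  have aδ : ∀ w, altSum (m + 3) a w = U (S.ρ ∘ w) - U w := by
    intro w
    have h := altSum_prism S.ρ (m + 2) U hU.dependsOn w
    rwa [show altSum (m + 2 + 2) U = fun _ => 0 from funext hU.closed, prism_zero_fun,
      add_zero] at h
  -- `b` measures the failure of `t`-invariance. It is closed because `U` and `U ∘ ρ` are both
  -- `t`-invariant, and has norm zero as a translate difference.
  set b : (ℕ → G) → ZMod p := fun w => a ((S.t * ·) ∘ w) - a w with hb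
  have bK : S.KerInvariant b := by
    intro g hg w
    simp only [hb]
    rw [S.comp_t_comm, aK g hg, aK g hg]
  have bD : DependsOn (m + 2) b := by
    intro w w' hw
    simp only [hb]
    rw [aD w w' hw, aD _ _ fun i hi => ?_]
    simp [hw i hi]
  have bδ : ∀ w, altSum (m + 3) b w = 0 := by
    intro w
    rw [hb, altSum_sub, altt, aδ, aδ, cρ, Uinv S.t trivial]
    ring
  have bN : ∀ w, S.norm b w = 0 := by
    intro w
    have h := S.norm_t a w
    rw [← sub_eq_zero] at h
    rw [← h]
    simp only [norm, hb]
    rw [Finset.sum_sub_distrib]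
    congr 1
    refine Finset.sum_congr rfl fun j _ => ?_
    congr 1; funext i
    simp only [Function.comp_apply]
    rw [← mul_assoc, ← mul_assoc, ← pow_succ, ← pow_succ']
  -- Composing with `ρ` makes `b` invariant under all of `G`; the prism supplies `a'` with `δa' = b
  -- - s`.
  set s : (ℕ → G) → ZMod p := fun w => b (S.ρ ∘ w) with hs
  have sI : InvariantUnder (fun _ => True) s := by
    intro g _ w
    simp only [hs]
    rw [cρg, bK _ (S.x_ρ g)]
  have sD : DependsOn (m + 1 + 1) s := by
    intro w w' hw
    exact bD _ _ fun i hi => by simp [hw i hi]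
  have sδ : ∀ w, altSum (m + 1 + 2) s w = 0 := by
    intro w
    rw [hs, ← altSum_comp, bδ]
  obtain ⟨s', hs'⟩ := exists_represents sD sI sδ
  set a' : (ℕ → G) → ZMod p := fun w => -prism S.ρ (m + 1) b w with ha'
  have a'K : S.KerInvariant a' := by
    intro g hg w
    simp only [ha']
    rw [S.prism_ker bK g hg w]
  have a'D : DependsOn (m + 1) a' := by
    intro w w' hw
    simp only [ha']
    rw [bD.prism S.ρ w w' hw]
  have a'δ : ∀ w, altSum (m + 2) a' w = b w - s w := by
    intro w
    have h := altSum_prism S.ρ (m + 1) b bD w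
    rw [show altSum (m + 1 + 2) b = fun _ => 0 from funext bδ, prism_zero_fun, add_zero] at h
    rw [ha', altSum_neg, h]
    simp [hs]
  -- `δv = N b - N s = 0 - p s = 0`, and a norm of a `ker x`-invariant cochain is `G`-invariant.
  set v : (ℕ → G) → ZMod p := S.norm a' with hv
  have vI : InvariantUnder (fun _ => True) v := S.invariant_of_ker (S.norm_ker a'K) (S.norm_t a')
  have vD : DependsOn (m + 1) v := by
    intro w w' hw
    refine Finset.sum_congr rfl fun j _ => a'D _ _ fun i hi => ?_
    simp [hw i hi]
  have vδ : ∀ w, altSum (m + 2) v w = 0 := by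
    intro w
    rw [hv, S.altSum_norm, show altSum (m + 2) a' = fun w => b w - s w from funext a'δ]
    have h1 : S.norm (fun w => b w - s w) w = S.norm b w - S.norm s w := by
      simp only [norm, Finset.sum_sub_distrib]
    have h2 : S.norm s w = 0 := by
      simp only [norm]
      rw [Finset.sum_congr rfl fun j _ => sI (S.t ^ j) trivial w]
      simp
    rw [h1, h2, bN, sub_zero]
  obtain ⟨v', hv'⟩ := exists_represents vD vI vδ
  -- Primitives of the two standard cocycles: `δX` represents `ξ` and `δL` represents `y`. Under
  -- translation by `t`, `X` grows by `1` and `L` by `δD`, where `D` has norm `1`.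
  let X : (ℕ → G) → ZMod p := fun w => S.x (w 0)
  let D : (ℕ → G) → ZMod p := fun w => (carry 1 (S.x (w 0)) : ℤ)
  let L : (ℕ → G) → ZMod p := fun w => (carry (S.x (w 0)) (S.x ((w 0)⁻¹ * w 1)) : ℤ)
  have XD : DependsOn (0 + 1) X := fun w w' h => by simp only [X]; rw [h 0 (by omega)]
  have DD : DependsOn (0 + 1) D := fun w w' h => by simp only [D]; rw [h 0 (by omega)]
  have LD : DependsOn (1 + 1) L := fun w w' h => by
    simp only [L]; rw [h 0 (by omega), h 1 (by omega)]
  have Xδ : ∀ w, altSum 2 X w = S.x ((w 0)⁻¹ * w 1) := by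
    intro w; simp [altSum, X, S.x_inv_mul]
  have Lδ : ∀ w, altSum 3 L w =
      ((carry (S.x ((w 0)⁻¹ * w 1)) (S.x ((w 1)⁻¹ * w 2)) : ℤ) : ZMod p) := by
    intro w
    have h := carry_cocycle (S.x (w 0)) (S.x ((w 0)⁻¹ * w 1)) (S.x ((w 1)⁻¹ * w 2))
    have e1 : S.x (w 0) + S.x ((w 0)⁻¹ * w 1) = S.x (w 1) := by rw [S.x_inv_mul]; ring
    have e2 : S.x ((w 0)⁻¹ * w 1) + S.x ((w 1)⁻¹ * w 2) = S.x ((w 0)⁻¹ * w 2) := by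
      simp only [S.x_inv_mul]; ring
    rw [e1, e2] at h
    have h' := congrArg (Int.cast : ℤ → ZMod p) h
    push_cast at h'
    simp only [altSum, L, scons_zero, stail_apply, scons_succ]
    linear_combination -h'
  have Lt : ∀ w, L ((S.t * ·) ∘ w) - L w = altSum 2 D w := by
    intro w
    have h := carry_cocycle 1 (S.x (w 0)) (S.x ((w 0)⁻¹ * w 1))
    have e1 : S.x (w 0) + S.x ((w 0)⁻¹ * w 1) = S.x (w 1) := by rw [S.x_inv_mul]; ring
    rw [e1] at h
    have h' := congrArg (Int.cast : ℤ → ZMod p) h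
    push_cast at h'
    have e2 : (S.t * w 0)⁻¹ * (S.t * w 1) = (w 0)⁻¹ * w 1 := by group
    simp only [altSum, L, D, scons_zero, stail_apply, Function.comp_apply, e2, sub_zero]
    rw [S.x_mul, S.x_t]
    linear_combination -h'
  have DN : ∀ w, S.norm D w = 1 := by
    intro w
    simp only [norm, D, Function.comp_apply, S.x_mul, S.x_t_pow]
    exact_mod_cast congrArg (Int.cast : ℤ → ZMod p) (sum_carry_one (S.x (w 0)))
  have sh : ∀ (c : ℕ) (g : G) (w : ℕ → G), (fun j => ((g * ·) ∘ w) (c + j)) =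
    (g * ·) ∘ fun j => w (c + j) := fun _ _ _ => rfl
  -- The norm of `a' - D ∪ v` is `v - 1 · v = 0`, so it is the translate difference of some `K`.
  obtain ⟨K, KD, KK, Kt⟩ := S.exists_eq_translate_sub (d := m)
    (F := fun w => a' w - hcup 0 D v w)
    (by
      intro w w' hw
      simp only
      rw [a'D w w' hw, (DD.hcup vD) w w' fun i hi => hw i (by omega)])
    (by
      intro g hg w
      simp only [hcup]
      rw [a'K g hg, sh, vI g trivial]
      simp only [D, Function.comp_apply, S.x_mul, hg, zero_add])
    (by
      intro w
      have h1 : S.norm (fun w => a' w - hcup 0 D v w) w = v w - S.norm D w * v w := by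
        simp only [norm, Finset.sum_sub_distrib, Finset.sum_mul, hv]
        congr 1
        refine Finset.sum_congr rfl fun j _ => ?_
        simp only [hcup]
        rw [sh]
        have e0 : (fun j => w (0 + j)) = w := by funext j; simp
        rw [e0]
        exact congrArg (D ((S.t ^ j * ·) ∘ w) * ·) (vI (S.t ^ j) trivial w)
      rw [h1, DN, one_mul, sub_self])
  -- The translate difference of `κ` is `b - s - δD ∪ v - δ(a' - D ∪ v) = 0`, so `κ` is
  -- `G`-invariant. Its coboundary is the asserted relation, with signs absorbed at the end into `s`
  -- and `v`.
  let κ : (ℕ → G) → ZMod p := fun w =>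
    a w - hcup (m + 1) s X w - hcup 1 L v w - altSum (m + 2) K w
  have κD : DependsOn (m + 1 + 1) κ := by
    intro w w' hw
    simp only [κ]
    rw [aD w w' hw, (sD.hcup XD) w w' fun i hi => hw i (by omega),
      (LD.hcup vD) w w' fun i hi => hw i (by omega), KD.altSum w w' hw]
  have κK : S.KerInvariant κ := by
    intro g hg w
    simp only [κ, hcup]
    rw [aK g hg, sI g trivial, sh, sh, vI g trivial, altSum_comp]
    have e1 : X ((g * ·) ∘ fun j => w (m + 1 + j)) = X fun j => w (m + 1 + j) := by
      simp [X, S.x_mul, hg]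
    have e2 : L ((g * ·) ∘ w) = L w := by
      have e3 : (g * w 0)⁻¹ * (g * w 1) = (w 0)⁻¹ * w 1 := by group
      simp only [L, Function.comp_apply, e3]
      rw [S.x_mul, hg, zero_add]
    rw [e1, e2]
    congr 2
    funext u
    exact KK g hg u
  have κt : ∀ w, κ ((S.t * ·) ∘ w) = κ w := by
    intro w
    have e1 : X ((S.t * ·) ∘ fun j => w (m + 1 + j)) = 1 + X fun j => w (m + 1 + j) := by
      simp [X, S.x_mul, S.x_t]
    have e2 := Lt w
    have e3 : altSum (m + 2) K ((S.t * ·) ∘ w) - altSum (m + 2) K w =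
        altSum (m + 2) (fun w => a' w - hcup 0 D v w) w := by
      rw [altSum_comp, ← altSum_sub]
      simp only [Kt]
    have e4 := altSum_hcup 0 m D v DD w
    rw [altSum_sub, a'δ, show m + 2 = 0 + m + 2 by omega, e4, vδ] at e3
    simp only [κ, hcup]
    rw [sI S.t trivial, sh, sh, vI S.t trivial, e1]
    rw [show 0 + m + 2 = m + 2 by omega, show (0 + 1 : ℕ) = 1 from rfl] at e3
    simp only [hb] at e3
    simp only [Nat.zero_add] at e3
    linear_combination (-v fun j => w (1 + j)) * e2 - e3
  have κδ : ∀ w, U (S.ρ ∘ w) - U w - (-1) ^ (m + 1) *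
      hcup (m + 1) s (fun w => S.x ((w 0)⁻¹ * w 1)) w - hcup 2 (fun w => ((carry
        (S.x ((w 0)⁻¹ * w 1)) (S.x ((w 1)⁻¹ * w 2)) : ℤ) : ZMod p)) v w =
      altSum (m + 1 + 2) κ w := by
    intro w
    have e1 := altSum_hcup (m + 1) 0 s X sD w
    have e2 := altSum_hcup 1 m L v LD w
    have e3 := altSum_altSum (m + 2) K w
    rw [sδ] at e1
    rw [Lδ, vδ] at e2
    simp only [κ]
    rw [altSum_sub, altSum_sub, altSum_sub, aδ, show m + 1 + 2 = m + 2 + 1 by omega, e3]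
    rw [show m + 1 + 0 + 2 = m + 2 + 1 by omega] at e1
    rw [show 1 + m + 2 = m + 2 + 1 by omega] at e2
    rw [e1, e2, Xδ]
    simp only [hcup]
    simp
  have hR := (((hU.res S.ρ).sub hU).sub ((hs'.mul hξ).smul ((-1) ^ (m + 1)))).sub
    (show Represents (m + 2) _ _ from add_comm 2 m ▸ hy.mul hv')
  have hzero := hR.eq_zero κD (S.invariant_of_ker κK κt) κδ
  have hρs : res p S.ρ s' = s' := by
    refine (hs'.res S.ρ).unique ?_
    convert hs' using 2 with w
    simp only [hs]
    congr 1; funext i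
    simp [S.ρ_of_x_eq_zero (S.x_ρ _)]
  refine ⟨-((-1 : ZMod p) ^ (m + 1) • s'), -v', ⟨_, by simpa using (hs'.smul ((-1) ^ (m + 1))).smul (-1)⟩,
    ⟨_, by simpa using hv'.smul (-1)⟩, ?_⟩
  rw [map_neg, map_smul, hρs, neg_mul, smul_mul_assoc, mul_neg]
  rw [← sub_eq_zero, ← neg_eq_zero, ← hzero]
  abel

end CentralSplitting

/-! ### The ordered chain complex on words -/

section Words

variable (k : Type) [CommRing k] {V : Type}

/-- Prepend a letter to all words of a chain. -/
def pre (v : V) : (List V →₀ k) →ₗ[k] (List V →₀ k) := Finsupp.lmapDomain k k (List.cons v)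

@[simp] lemma pre_single (v : V) (w : List V) (r : k) :
    pre k v (Finsupp.single w r) = Finsupp.single (v :: w) r := by
  simp [pre, Finsupp.lmapDomain]

/-- The boundary of a word: the alternating sum of the words obtained by deleting a letter. -/
def wordBoundary : List V → (List V →₀ k)
  | [] => 0
  | v :: w => Finsupp.single w 1 - pre k v (wordBoundary w)

/-- The boundary map of the augmented ordered chain complex, graded by word length. -/
def bdry : (List V →₀ k) →ₗ[k] (List V →₀ k) := Finsupp.linearCombination k (wordBoundary k)

lemma bdry_single (w : List V) : bdry k (Finsupp.single w 1) = wordBoundary k w := by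
  simp [bdry]

@[simp] lemma bdry_pre (v : V) (x : List V →₀ k) : bdry k (pre k v x) = x - pre k v (bdry k x) := by
  suffices h : bdry k ∘ₗ pre k v = LinearMap.id - pre k v ∘ₗ bdry k from
    LinearMap.congr_fun h x
  ext w : 2
  simp [bdry_single, wordBoundary]

/-- The chains supported on the words of length `d` of a language. -/
def chains (L : Set (List V)) (d : ℕ) : Submodule k (List V →₀ k) :=
  Finsupp.supported k k {w | w ∈ L ∧ w.length = d}

variable {k}

lemma single_mem_chains {L : Set (List V)} {w : List V} (h : w ∈ L) (r : k) :
    Finsupp.single w r ∈ chains k L w.length :=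
  Finsupp.single_mem_supported k r ⟨h, rfl⟩

lemma chains_mono {L L' : Set (List V)} (h : L ⊆ L') (d : ℕ) : chains k L d ≤ chains k L' d :=
  Finsupp.supported_mono fun _ hw => ⟨h hw.1, hw.2⟩

/-- To check a linear condition on chains it suffices to check it on words. -/
lemma chains_induction {L : Set (List V)} {d : ℕ} {N : Type*} [AddCommGroup N] [Module k N]
    (f : (List V →₀ k) →ₗ[k] N) (X : Submodule k N)
    (h : ∀ w ∈ L, w.length = d → f (Finsupp.single w 1) ∈ X) {x : List V →₀ k}
    (hx : x ∈ chains k L d) : f x ∈ X := by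
  rw [chains, Finsupp.supported_eq_span_single] at hx
  have : Submodule.span k ((fun i => Finsupp.single i (1 : k)) '' {w | w ∈ L ∧ w.length = d}) ≤
      X.comap f := by
    rw [Submodule.span_le]
    rintro _ ⟨w, hw, rfl⟩
    exact h w hw.1 hw.2
  exact this hx

lemma pre_mem_chains {L L' : Set (List V)} {d : ℕ} {v : V} (h : ∀ w ∈ L, v :: w ∈ L')
    {x : List V →₀ k} (hx : x ∈ chains k L d) : pre k v x ∈ chains k L' (d + 1) := by
  refine chains_induction (pre k v) _ (fun w hw hd => ?_) hx
  rw [pre_single, ← hd]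
  exact single_mem_chains (h w hw) 1

/-- Closure under passing to subwords. -/
def SubwordClosed (L : Set (List V)) : Prop := ∀ w ∈ L, ∀ w', w'.Sublist w → w' ∈ L

lemma SubwordClosed.bdry_mem {L : Set (List V)} (hL : SubwordClosed L) {d : ℕ}
    {x : List V →₀ k} (hx : x ∈ chains k L (d + 1)) : bdry k x ∈ chains k L d := by
  have key : ∀ (w : List V) (L : Set (List V)), SubwordClosed L → w ∈ L → ∀ d, w.length = d + 1 →
      wordBoundary k w ∈ chains k L d := by
    intro w
    induction w with
    | nil => intro L _ _ d hd; simp at hd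
    | cons v w ih =>
      intro L hL hw d hd
      obtain rfl : w.length = d := by simpa using hd
      refine sub_mem (single_mem_chains (hL _ hw _ (List.sublist_cons_self _ _)) 1) ?_
      cases w with
      | nil => simp [wordBoundary]
      | cons u w =>
        refine pre_mem_chains (L := {w' | v :: w' ∈ L}) (fun _ h => h) (ih _ ?_ hw _ rfl)
        intro w₁ h₁ w₂ h₂
        exact hL _ h₁ _ (List.Sublist.cons_cons v h₂)
  refine chains_induction (bdry k) _ (fun w hw hd => ?_) hx
  rw [bdry_single]
  exact key w L hL hw d hd

lemma bdry_of_mem_chains_zero {L : Set (List V)} {x : List V →₀ k} (hx : x ∈ chains k L 0) :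
    bdry k x = 0 := by
  have : bdry k x ∈ (⊥ : Submodule k (List V →₀ k)) := by
    refine chains_induction (bdry k) _ (fun w hw hd => ?_) hx
    rw [List.length_eq_zero_iff.1 hd, bdry_single]
    exact zero_mem _
  simpa using this

lemma exists_add_of_mem_chains_union {X Y : Set (List V)} {d : ℕ} {x : List V →₀ k}
    (hx : x ∈ chains k (X ∪ Y) d) : ∃ a ∈ chains k X d, ∃ b ∈ chains k Y d, a + b = x := by
  rw [← Submodule.mem_sup, chains, chains, ← Finsupp.supported_union]
  refine Finsupp.supported_mono ?_ hx
  rintro w ⟨h | h, hd⟩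
  · exact Or.inl ⟨h, hd⟩
  · exact Or.inr ⟨h, hd⟩

lemma mem_chains_inter {X Y : Set (List V)} {d : ℕ} {x : List V →₀ k}
    (hX : x ∈ chains k X d) (hY : x ∈ chains k Y d) : x ∈ chains k (X ∩ Y) d := by
  rw [chains, Finsupp.mem_supported] at *
  exact fun w hw => ⟨⟨(hX hw).1, (hY hw).1⟩, (hX hw).2⟩

variable (k) in
/-- Every cycle of degree `d` is a boundary. -/
def ExactAt (L : Set (List V)) (d : ℕ) : Prop :=
  ∀ x ∈ chains k L d, bdry k x = 0 → ∃ y ∈ chains k L (d + 1), bdry k y = x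

/-- The language has the homology of a sphere up to degree `d`, with fundamental cycle `z`. -/
structure Spherical (L : Set (List V)) (d : ℕ) (z : List V →₀ k) : Prop where
  mem : z ∈ chains k L d
  cycle : bdry k z = 0
  exactAt : ∀ e < d, ExactAt k L e
  top : ∀ x ∈ chains k L d, bdry k x = 0 →
    ∃ r : k, ∃ y ∈ chains k L (d + 1), x = r • z + bdry k y

/-- Prepending the apex is a contracting homotopy. -/
lemma exactAt_of_cone {L : Set (List V)} (v : V) (h : ∀ w ∈ L, v :: w ∈ L) (d : ℕ) :
    ExactAt k L d := by
  intro x hx hx0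
  exact ⟨pre k v x, pre_mem_chains h hx, by rw [bdry_pre, hx0, map_zero, sub_zero]⟩

/-- In the lowest degree every chain is a cycle, so the two parts can be filled separately and the
intersection plays no role. -/
lemma exactAt_union_zero {X Y : Set (List V)} (hX : ExactAt k X 0) (hY : ExactAt k Y 0) :
    ExactAt k (X ∪ Y) 0 := by
  intro x hx _
  obtain ⟨a, ha, b, hb, rfl⟩ := exists_add_of_mem_chains_union hx
  obtain ⟨a', ha', rfl⟩ := hX a ha (bdry_of_mem_chains_zero ha)
  obtain ⟨b', hb', rfl⟩ := hY b hb (bdry_of_mem_chains_zero hb)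
  exact ⟨a' + b', add_mem (chains_mono Set.subset_union_left _ ha')
    (chains_mono Set.subset_union_right _ hb'), map_add _ _ _⟩

/-! ### Mayer–Vietoris arguments for unions of languages -/

section MayerVietoris

variable {X Y : Set (List V)} (cX : SubwordClosed X) (cY : SubwordClosed Y)

include cX cY in
lemma mayerVietoris_boundary {d : ℕ} {a b : List V →₀ k} (ha : a ∈ chains k X (d + 1))
    (hb : b ∈ chains k Y (d + 1)) (h : bdry k (a + b) = 0) : bdry k a ∈ chains k (X ∩ Y) d := by
  refine mem_chains_inter (cX.bdry_mem ha) ?_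
  rw [map_add, add_eq_zero_iff_eq_neg] at h
  rw [h]
  exact neg_mem (cY.bdry_mem hb)

lemma bdry_bdry (x : List V →₀ k) : bdry k (bdry k x) = 0 := by
  have : ∀ w : List V, bdry k (wordBoundary k w) = 0 := by
    intro w
    induction w with
    | nil => simp [wordBoundary]
    | cons v w ih => rw [wordBoundary, map_sub, bdry_pre, bdry_single, ih]; simp
  suffices h : bdry k ∘ₗ bdry k = (0 : (List V →₀ k) →ₗ[k] _) from LinearMap.congr_fun h x
  ext w : 2
  simp [bdry_single, this]

include cX cY in
lemma exactAt_union_succ {d : ℕ} (hX : ExactAt k X (d + 1)) (hY : ExactAt k Y (d + 1))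
    (hXY : ExactAt k (X ∩ Y) d) : ExactAt k (X ∪ Y) (d + 1) := by
  intro x hx hx0
  obtain ⟨a, ha, b, hb, rfl⟩ := exists_add_of_mem_chains_union hx
  obtain ⟨c, hc, hc'⟩ := hXY _ (mayerVietoris_boundary cX cY ha hb hx0) (bdry_bdry a)
  obtain ⟨a', ha', ea⟩ := hX (a - c) (sub_mem ha (chains_mono Set.inter_subset_left _ hc))
    (by rw [map_sub, hc', sub_self])
  obtain ⟨b', hb', eb⟩ := hY (b + c) (add_mem hb (chains_mono Set.inter_subset_right _ hc))
    (by rw [map_add, hc', add_comm, ← map_add, hx0])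
  refine ⟨a' + b', add_mem (chains_mono Set.subset_union_left _ ha')
    (chains_mono Set.subset_union_right _ hb'), ?_⟩
  rw [map_add, ea, eb]; abel

include cX cY in
lemma exactAt_union (hX : ∀ d, ExactAt k X d) (hY : ∀ d, ExactAt k Y d)
    (hXY : ∀ d, ExactAt k (X ∩ Y) d) (d : ℕ) : ExactAt k (X ∪ Y) d := by
  cases d with
  | zero => exact exactAt_union_zero (hX 0) (hY 0)
  | succ d => exact exactAt_union_succ cX cY (hX _) (hY _) (hXY d)

-- Suspension: two acyclic pieces glued along a sphere give a sphere of one dimension more, whose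
-- fundamental cycle is the difference of two fillings of the old one.
include cX cY in
lemma spherical_union {d : ℕ} {z : List V →₀ k} (hX : ∀ d, ExactAt k X d)
    (hY : ∀ d, ExactAt k Y d) (hXY : Spherical (X ∩ Y) d z) {a b : List V →₀ k}
    (ha : a ∈ chains k X (d + 1)) (hb : b ∈ chains k Y (d + 1)) (ea : bdry k a = z)
    (eb : bdry k b = z) : Spherical (X ∪ Y) (d + 1) (a - b) where
  mem := sub_mem (chains_mono Set.subset_union_left _ ha) (chains_mono Set.subset_union_right _ hb)
  cycle := by rw [map_sub, ea, eb, sub_self]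
  exactAt e he := by
    cases e with
    | zero => exact exactAt_union_zero (hX 0) (hY 0)
    | succ e => exact exactAt_union_succ cX cY (hX _) (hY _) (hXY.exactAt e (by omega))
  top x hx hx0 := by
    obtain ⟨u, hu, v, hv, rfl⟩ := exists_add_of_mem_chains_union hx
    obtain ⟨r, c, hc, hc'⟩ := hXY.top _ (mayerVietoris_boundary cX cY hu hv hx0) (bdry_bdry u)
    obtain ⟨u', hu', eu⟩ := hX _ (u - r • a - c) (sub_mem (sub_mem hu (Submodule.smul_mem _ r ha))
      (chains_mono Set.inter_subset_left _ hc)) (by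
        rw [map_sub, map_sub, map_smul, ea, hc']; abel)
    obtain ⟨v', hv', ev⟩ := hY _ (v + r • b + c) (add_mem (add_mem hv (Submodule.smul_mem _ r hb))
      (chains_mono Set.inter_subset_right _ hc)) (by
        rw [map_add, add_comm, ← eq_neg_iff_add_eq_zero] at hx0
        rw [map_add, map_add, map_smul, eb, hx0, hc']; abel)
    refine ⟨r, u' + v', add_mem (chains_mono Set.subset_union_left _ hu')
      (chains_mono Set.subset_union_right _ hv'), ?_⟩
    rw [map_add, eu, ev, smul_sub]; abel

end MayerVietoris

end Words

/-! ### Joins with a circle -/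

section Join

variable {k : Type} [CommRing k] {Ω : Type} [DecidableEq Ω] {M : ℕ}

/-- The join of the language `K` with the simplicial complex with facets `𝓕` on the letters
`(ω, s)`. -/
def joinLang (ω : Ω) (𝓕 : Set (Set (ZMod M))) (K : Set (List (Ω × ZMod M))) :
    Set (List (Ω × ZMod M)) :=
  {w | w.filter (fun v => v.1 ≠ ω) ∈ K ∧ ∃ B ∈ 𝓕, ∀ s, (ω, s) ∈ w → s ∈ B}

variable {ω : Ω} {K : Set (List (Ω × ZMod M))}

lemma SubwordClosed.joinLang (hK : SubwordClosed K) (𝓕 : Set (Set (ZMod M))) :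
    SubwordClosed (joinLang ω 𝓕 K) := by
  rintro w ⟨h, B, hB, hw⟩ w' hw'
  exact ⟨hK _ h _ (hw'.filter _), B, hB, fun s hs => hw s (hw'.subset hs)⟩

lemma joinLang_union (𝓕 𝓕' : Set (Set (ZMod M))) :
    joinLang ω 𝓕 K ∪ joinLang ω 𝓕' K = joinLang ω (𝓕 ∪ 𝓕') K := by
  ext w
  simp only [joinLang, Set.mem_union, Set.mem_ofPred_eq]
  constructor
  · rintro (⟨h, B, hB, hw⟩ | ⟨h, B, hB, hw⟩)
    · exact ⟨h, B, Or.inl hB, hw⟩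
    · exact ⟨h, B, Or.inr hB, hw⟩
  · rintro ⟨h, B, hB | hB, hw⟩
    · exact Or.inl ⟨h, B, hB, hw⟩
    · exact Or.inr ⟨h, B, hB, hw⟩

/-- If the facets of `𝓖` are exactly the maximal intersections of facets of `𝓕` and `𝓕'`, then the
join with `𝓖` is the intersection of the joins. -/
lemma joinLang_inter {𝓕 𝓕' 𝓖 : Set (Set (ZMod M))}
    (h₁ : ∀ B ∈ 𝓕, ∀ B' ∈ 𝓕', ∃ E ∈ 𝓖, B ∩ B' ⊆ E)
    (h₂ : ∀ E ∈ 𝓖, (∃ B ∈ 𝓕, E ⊆ B) ∧ ∃ B ∈ 𝓕', E ⊆ B) :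
    joinLang ω 𝓕 K ∩ joinLang ω 𝓕' K = joinLang ω 𝓖 K := by
  ext w
  constructor
  · rintro ⟨⟨h, B, hB, hw⟩, ⟨-, B', hB', hw'⟩⟩
    obtain ⟨E, hE, hBE⟩ := h₁ B hB B' hB'
    exact ⟨h, E, hE, fun s hs => hBE ⟨hw s hs, hw' s hs⟩⟩
  · rintro ⟨h, E, hE, hw⟩
    obtain ⟨⟨B, hB, hEB⟩, B', hB', hEB'⟩ := h₂ E hE
    exact ⟨⟨h, B, hB, fun s hs => hEB (hw s hs)⟩, ⟨h, B', hB', fun s hs => hEB' (hw s hs)⟩⟩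

lemma joinLang_empty (hK : ∀ w ∈ K, ∀ v ∈ w, v.1 ≠ ω) : joinLang ω {∅} K = K := by
  ext w
  constructor
  · rintro ⟨h, B, rfl, hw⟩
    rwa [List.filter_eq_self.2] at h
    rintro ⟨ω', s⟩ hv
    simp only [ne_eq, decide_not, Bool.not_eq_eq_eq_not, Bool.not_true, decide_eq_false_iff_not]
    rintro rfl
    exact hw s hv
  · intro h
    refine ⟨?_, ∅, rfl, fun s hs => absurd rfl (hK w h _ hs)⟩
    rwa [List.filter_eq_self.2]
    intro v hv
    simpa using hK w h v hv

lemma cons_mem_joinLang {B : Set (ZMod M)} {s : ZMod M} (hs : s ∈ B) {w : List (Ω × ZMod M)}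
    (hw : w ∈ joinLang ω {B} K) : (ω, s) :: w ∈ joinLang ω {B} K := by
  obtain ⟨h, _, rfl, hw⟩ := hw
  refine ⟨by simpa using h, _, rfl, fun s' hs' => ?_⟩
  rcases List.mem_cons.1 hs' with h' | h'
  · obtain rfl : s' = s := (Prod.ext_iff.1 h').2
    exact hs
  · exact hw s' h'

lemma exactAt_joinLang_singleton {B : Set (ZMod M)} {s : ZMod M} (hs : s ∈ B) (d : ℕ) :
    ExactAt k (joinLang ω {B} K) d :=
  exactAt_of_cone (ω, s) (fun _ => cons_mem_joinLang hs) d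

lemma joinLang_mono {𝓕 𝓖 : Set (Set (ZMod M))} (h : ∀ B ∈ 𝓕, ∃ E ∈ 𝓖, B ⊆ E) :
    joinLang ω 𝓕 K ⊆ joinLang ω 𝓖 K := by
  rintro w ⟨h', B, hB, hw⟩
  obtain ⟨E, hE, hBE⟩ := h B hB
  exact ⟨h', E, hE, fun s hs => hBE (hw s hs)⟩

/-- The edges `{i, i + 1}` for `i < l`. -/
def pathEdges (M l : ℕ) : Set (Set (ZMod M)) := {B | ∃ i < l, B = {(i : ZMod M), (i : ZMod M) + 1}}

/-- The edges `{a, a + 1}` of the circle. -/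
def circleEdges (M : ℕ) : Set (Set (ZMod M)) := {B | ∃ a : ZMod M, B = {a, a + 1}}

lemma natCast_inj_of_lt {i j : ℕ} (hi : i < M) (hj : j < M) : (i : ZMod M) = j ↔ i = j := by
  refine ⟨fun h => ?_, fun h => by rw [h]⟩
  have := (ZMod.natCast_eq_natCast_iff' i j M).1 h
  rwa [Nat.mod_eq_of_lt hi, Nat.mod_eq_of_lt hj] at this

lemma pathEdges_succ (l : ℕ) :
    pathEdges M (l + 1) = pathEdges M l ∪ {{(l : ZMod M), (l : ZMod M) + 1}} := by
  ext B
  simp only [pathEdges, Set.mem_ofPred_eq, Set.mem_union, Set.mem_singleton_iff]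
  constructor
  · rintro ⟨i, hi, rfl⟩
    rcases Nat.lt_succ_iff_lt_or_eq.1 hi with h | rfl
    · exact Or.inl ⟨i, h, rfl⟩
    · exact Or.inr rfl
  · rintro (⟨i, hi, rfl⟩ | rfl)
    · exact ⟨i, by omega, rfl⟩
    · exact ⟨l, by omega, rfl⟩

lemma circleEdges_eq [NeZero M] : circleEdges M = pathEdges M M := by
  ext B
  constructor
  · rintro ⟨a, rfl⟩
    exact ⟨a.val, ZMod.val_lt a, by simp⟩
  · rintro ⟨i, -, rfl⟩
    exact ⟨i, rfl⟩

/-- An arc is contractible, and so is its join with anything: edges, which are cones, are attached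
one at a time along a single vertex. The bound on `l` keeps the vertices `0, …, l + 1` distinct, so
that the arc does not close up. -/
lemma exactAt_path (cK : SubwordClosed K) (l : ℕ) (hl : l + 1 < M) (d : ℕ) :
    ExactAt k (joinLang ω (pathEdges M (l + 1)) K) d := by
  induction l generalizing d with
  | zero =>
    have : pathEdges M 1 = {{((0 : ℕ) : ZMod M), ((0 : ℕ) : ZMod M) + 1}} := by
      rw [pathEdges_succ]; ext; simp [pathEdges]
    rw [zero_add, this]
    exact exactAt_joinLang_singleton (s := ((0 : ℕ) : ZMod M)) (by simp) d
  | succ l ih =>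
    rw [pathEdges_succ, ← joinLang_union]
    refine exactAt_union (cK.joinLang _) (cK.joinLang _) (ih (by omega))
      (exactAt_joinLang_singleton (s := ((l + 1 : ℕ) : ZMod M)) (by simp)) ?_ d
    rw [joinLang_inter (𝓖 := {{((l + 1 : ℕ) : ZMod M)}})]
    · exact exactAt_joinLang_singleton (s := ((l + 1 : ℕ) : ZMod M)) (Set.mem_singleton _)
    · rintro _ ⟨i, hi, rfl⟩ _ rfl
      refine ⟨_, rfl, ?_⟩
      rintro s ⟨h1, rfl | h2⟩
      · rfl
      · exfalso
        have h3 : s = ((l + 2 : ℕ) : ZMod M) := by rw [h2]; push_cast; ring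
        rcases h1 with h1 | h1
        · rw [h3, natCast_inj_of_lt (by omega) (by omega)] at h1; omega
        · have h4 : s = ((i + 1 : ℕ) : ZMod M) := by rw [h1]; push_cast; ring
          rw [h3, natCast_inj_of_lt (by omega) (by omega)] at h4; omega
    · rintro _ rfl
      exact ⟨⟨_, ⟨l, by omega, rfl⟩, by simp⟩, ⟨_, rfl, by simp⟩⟩

variable (k) in
/-- The path from `(ω, a)` to `(ω, a + l)`, joined with a chain. -/
def path (ω : Ω) (a : ZMod M) (l : ℕ) (x : List (Ω × ZMod M) →₀ k) : List (Ω × ZMod M) →₀ k :=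
  ∑ i ∈ Finset.range l, pre k (ω, a + i) (pre k (ω, a + i + 1) x)

variable (k) in
/-- The fundamental cycle of the circle at `ω`, joined with a chain. -/
def circle [NeZero M] (ω : Ω) (x : List (Ω × ZMod M) →₀ k) : List (Ω × ZMod M) →₀ k :=
  ∑ a : ZMod M, pre k (ω, a) (pre k (ω, a + 1) x)

lemma bdry_path (a : ZMod M) (l : ℕ) {x : List (Ω × ZMod M) →₀ k} (hx : bdry k x = 0) :
    bdry k (path k ω a l x) = pre k (ω, a + l) x - pre k (ω, a) x := by
  have h : ∀ i : ℕ, bdry k (pre k (ω, a + i) (pre k (ω, a + i + 1) x)) =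
      pre k (ω, a + (i + 1 : ℕ)) x - pre k (ω, a + i) x := by
    intro i
    rw [bdry_pre, bdry_pre, hx, map_zero, sub_zero]
    push_cast
    rw [add_assoc]
  rw [path, map_sum, Finset.sum_congr rfl fun i _ => h i,
    Finset.sum_range_sub fun i : ℕ => pre k (ω, a + (i : ZMod M)) x]
  simp

lemma path_add (a : ZMod M) (l l' : ℕ) (x : List (Ω × ZMod M) →₀ k) :
    path k ω a (l + l') x = path k ω a l x + path k ω (a + (l : ZMod M)) l' x := by
  rw [path, Finset.sum_range_add, path, path]
  simp [add_assoc]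

lemma path_modulus [NeZero M] (a : ZMod M) (x : List (Ω × ZMod M) →₀ k) :
    path k ω a M x = circle k ω x := by
  have h : ∀ f : ZMod M → (List (Ω × ZMod M) →₀ k),
      ∑ i ∈ Finset.range M, f (a + i) = ∑ b, f b := by
    intro f
    refine Finset.sum_nbij' (fun i => a + i) (fun b => (b - a).val) (by simp)
      (fun b _ => Finset.mem_range.2 (ZMod.val_lt _)) (fun i hi => ?_) (fun b _ => by simp)
      (fun _ _ => rfl)
    simp [ZMod.val_natCast_of_lt (Finset.mem_range.1 hi)]
  exact h fun b => pre k (ω, b) (pre k (ω, b + 1) x)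

lemma bdry_circle [NeZero M] (x : List (Ω × ZMod M) →₀ k) :
    bdry k (circle k ω x) = circle k ω (bdry k x) := by
  have h : ∀ a : ZMod M, bdry k (pre k (ω, a) (pre k (ω, a + 1) x)) =
      pre k (ω, a) (pre k (ω, a + 1) (bdry k x)) + (pre k (ω, a + 1) x - pre k (ω, a) x) := by
    intro a
    rw [bdry_pre, bdry_pre, map_sub]; abel
  rw [circle, map_sum, Finset.sum_congr rfl fun a _ => h a, Finset.sum_add_distrib,
    Finset.sum_sub_distrib, circle,
    Fintype.sum_equiv (Equiv.addRight (1 : ZMod M)) (fun a => pre k (ω, a + 1) x)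
      (fun a => pre k (ω, a) x) (fun _ => rfl), sub_self, add_zero]

lemma pre_mem_joinLang (hK : ∀ w ∈ K, ∀ v ∈ w, v.1 ≠ ω) {B : Set (ZMod M)} {s : ZMod M}
    (hs : s ∈ B) {d : ℕ} {x : List (Ω × ZMod M) →₀ k} (hx : x ∈ chains k K d) :
    pre k (ω, s) x ∈ chains k (joinLang ω {B} K) (d + 1) := by
  refine pre_mem_chains (fun w hw => cons_mem_joinLang hs ?_) hx
  have : w ∈ joinLang ω {∅} K := by rwa [joinLang_empty hK]
  exact joinLang_mono (by rintro _ rfl; exact ⟨B, rfl, by simp⟩) this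

lemma pre_pre_mem_joinLang (hK : ∀ w ∈ K, ∀ v ∈ w, v.1 ≠ ω) {B : Set (ZMod M)} {s s' : ZMod M}
    (hs : s ∈ B) (ht : s' ∈ B) {d : ℕ} {x : List (Ω × ZMod M) →₀ k} (hx : x ∈ chains k K d) :
    pre k (ω, s) (pre k (ω, s') x) ∈ chains k (joinLang ω {B} K) (d + 2) :=
  pre_mem_chains (fun _ => cons_mem_joinLang hs) (pre_mem_joinLang hK ht hx)

/-- Joining with a circle of length at least three is a double suspension. -/
theorem spherical_joinLang_circle [NeZero M] (hM : 3 ≤ M) (cK : SubwordClosed K)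
    (hK : ∀ w ∈ K, ∀ v ∈ w, v.1 ≠ ω) {d : ℕ} {z : List (Ω × ZMod M) →₀ k}
    (h : Spherical K d z) : Spherical (joinLang ω (circleEdges M) K) (d + 2) (circle k ω z) := by
  obtain ⟨l, hl⟩ : ∃ l, M = l + 3 := ⟨M - 3, by omega⟩
  -- `q = -1`. The circle is the arc from `0` to `q` together with the closing edge `{q, 0}`; since
  -- `M ≥ 3` no edge of the arc contains both ends, so the two pieces meet in two points.
  set q : ZMod M := ((l + 2 : ℕ) : ZMod M) with hq
  have q1 : q + 1 = 0 := by
    have := ZMod.natCast_self M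
    rw [hq, ← Nat.cast_succ, ← this]
    congr 1
    omega
  have q0 : q ≠ 0 := by
    intro h0
    rw [hq, ← Nat.cast_zero, natCast_inj_of_lt (by omega) (by omega)] at h0
    omega
  -- First suspension: the join with two points.
  have two : Spherical (joinLang ω {{q}, {0}} K) (d + 1) (pre k (ω, q) z - pre k (ω, 0) z) := by
    have := spherical_union (k := k) (cK.joinLang (ω := ω) {{q}}) (cK.joinLang (ω := ω) {{0}})
      (exactAt_joinLang_singleton (Set.mem_singleton q))
      (exactAt_joinLang_singleton (Set.mem_singleton 0))
      (d := d) (z := z) (by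
        rw [joinLang_inter (𝓖 := {∅}), joinLang_empty hK]
        · exact h
        · rintro _ rfl _ rfl
          refine ⟨∅, rfl, ?_⟩
          rintro s ⟨h1, h2⟩
          exact q0 (h1.symm.trans h2)
        · rintro _ rfl
          exact ⟨⟨_, rfl, by simp⟩, _, rfl, by simp⟩)
      (pre_mem_joinLang hK (Set.mem_singleton q) h.mem)
      (pre_mem_joinLang hK (Set.mem_singleton 0) h.mem)
      (by rw [bdry_pre, h.cycle, map_zero, sub_zero])
      (by rw [bdry_pre, h.cycle, map_zero, sub_zero])
    rwa [joinLang_union] at this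
  have hXY : joinLang ω (pathEdges M (l + 2)) K ∩ joinLang ω {{q, q + 1}} K =
      joinLang ω {{q}, {0}} K := by
    refine joinLang_inter ?_ ?_
    · rintro _ ⟨i, hi, rfl⟩ _ rfl
      rw [q1]
      by_cases hiq : q ∈ ({(i : ZMod M), (i : ZMod M) + 1} : Set (ZMod M))
      · refine ⟨{q}, by simp, ?_⟩
        rintro s ⟨h1, rfl | rfl⟩
        · rfl
        · exfalso
          have e2 : (0 : ZMod M) = ((0 : ℕ) : ZMod M) := by simp
          have e3 : (i : ZMod M) + 1 = ((i + 1 : ℕ) : ZMod M) := by simp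
          rw [Set.mem_insert_iff, Set.mem_singleton_iff, hq, e3,
            natCast_inj_of_lt (by omega) (by omega), natCast_inj_of_lt (by omega) (by omega)] at hiq
          rw [Set.mem_insert_iff, Set.mem_singleton_iff, e2, e3,
            natCast_inj_of_lt (by omega) (by omega), natCast_inj_of_lt (by omega) (by omega)] at h1
          omega
      · refine ⟨{0}, by simp, ?_⟩
        rintro s ⟨h1, rfl | rfl⟩
        · exact absurd h1 hiq
        · rfl
    · rintro _ (rfl | rfl)
      · refine ⟨⟨_, ⟨l + 1, by omega, rfl⟩, ?_⟩, _, rfl, by simp⟩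
        rw [Set.singleton_subset_iff]
        right
        rw [Set.mem_singleton_iff, hq]; push_cast; ring
      · exact ⟨⟨_, ⟨0, by omega, rfl⟩, by simp⟩, _, rfl, by simp [q1]⟩
  -- Second suspension. The arc and the closing edge, the latter with a sign, are two fillings of
  -- the same cycle, and their difference is the whole circle.
  have := spherical_union (k := k) (cK.joinLang (ω := ω) (pathEdges M (l + 2)))
    (cK.joinLang (ω := ω) {{q, q + 1}}) (exactAt_path cK (l + 1) (by omega))
    (exactAt_joinLang_singleton (Set.mem_insert q _)) (hXY ▸ two)
    (a := path k ω 0 (l + 2) z) (b := -pre k (ω, q) (pre k (ω, q + 1) z))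
    (by
      refine Submodule.sum_mem _ fun i hi => ?_
      refine chains_mono (joinLang_mono ?_) _ (pre_pre_mem_joinLang hK
        (B := {(i : ZMod M), (i : ZMod M) + 1}) (Set.mem_insert_iff.2 (Or.inl (zero_add _)))
        (Set.mem_insert_of_mem _ (by simp)) h.mem)
      rintro _ rfl
      exact ⟨_, ⟨i, Finset.mem_range.1 hi, rfl⟩, le_rfl⟩)
    (neg_mem (pre_pre_mem_joinLang hK (Set.mem_insert _ _)
      (Set.mem_insert_of_mem _ (Set.mem_singleton _)) h.mem))
    (by rw [bdry_path _ _ h.cycle, zero_add])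
    (by rw [map_neg, bdry_pre, bdry_pre, h.cycle, q1]; simp)
  rw [joinLang_union, ← pathEdges_succ, show l + 2 + 1 = M by omega, ← circleEdges_eq,
    sub_neg_eq_add] at this
  have e : path k ω 0 (l + 2) z + pre k (ω, q) (pre k (ω, q + 1) z) = circle k ω z := by
    have e' : path k ω 0 (l + 2 + 1) z = circle k ω z := by
      rw [← path_modulus 0]
      exact congrArg (path k ω 0 · z) (by omega)
    rw [← e', path_add 0 (l + 2) 1]
    simp only [path, Finset.sum_range_one, Nat.cast_zero, zero_add, add_zero, hq]
  rwa [e] at this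

/-- The join of the circles indexed by a list. -/
def sphereLang (M : ℕ) : List Ω → Set (List (Ω × ZMod M))
  | [] => {[]}
  | ω :: l => joinLang ω (circleEdges M) (sphereLang M l)

variable (k M) in
/-- The fundamental cycle of a join of circles. -/
def sphereCycle [NeZero M] : List Ω → (List (Ω × ZMod M) →₀ k)
  | [] => Finsupp.single [] 1
  | ω :: l => circle k ω (sphereCycle l)

lemma mem_sphereLang_fst {l : List Ω} {w : List (Ω × ZMod M)} (hw : w ∈ sphereLang M l) :
    ∀ v ∈ w, v.1 ∈ l := by
  induction l generalizing w with
  | nil => rintro v hv; rw [show w = [] from hw] at hv; simp at hv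
  | cons ω l ih =>
    intro v hv
    by_cases h : v.1 = ω
    · simp [h]
    · exact List.mem_cons_of_mem _ (ih hw.1 v (List.mem_filter.2 ⟨hv, by simpa using h⟩))

lemma subwordClosed_sphereLang (l : List Ω) : SubwordClosed (sphereLang M l) := by
  induction l with
  | nil =>
    rintro w hw w' hw'
    rw [show w = [] from hw] at hw'
    exact List.sublist_nil.1 hw'
  | cons ω l ih => exact ih.joinLang _

theorem spherical_sphereLang [NeZero M] (hM : 3 ≤ M) {l : List Ω} (hl : l.Nodup) :
    Spherical (sphereLang M l) (2 * l.length) (sphereCycle k M l) := by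
  induction l with
  | nil =>
    -- The empty join is the sphere of dimension `-1`: in the augmented complex its fundamental
    -- cycle is the empty word, in degree `0`.
    refine ⟨single_mem_chains (k := k) (L := sphereLang M []) (w := []) (Set.mem_singleton _) 1,
      bdry_single k [], fun e he => by simp at he,
      fun x hx _ => ⟨x [], 0, zero_mem _, ?_⟩⟩
    rw [map_zero, add_zero, sphereCycle, Finsupp.smul_single, smul_eq_mul, mul_one]
    ext w
    by_cases hw : w = []
    · subst hw; simp
    · rw [Finsupp.single_apply, if_neg (Ne.symm hw)]
      by_contra h
      exact hw (hx (Finsupp.mem_support_iff.2 h)).1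
  | cons ω l ih =>
    rw [List.nodup_cons] at hl
    exact spherical_joinLang_circle hM (subwordClosed_sphereLang l)
      (fun w hw v hv (h : v.1 = ω) => hl.1 (h ▸ mem_sphereLang_fst hw v hv)) (ih hl.2)

/-- A description free of the order of the list, from which stability under permuting and rotating
the circles can be read off. -/
lemma mem_sphereLang_iff {l : List Ω} (hl : l.Nodup) {w : List (Ω × ZMod M)} :
    w ∈ sphereLang M l ↔ (∀ v ∈ w, v.1 ∈ l) ∧
      ∀ ω ∈ l, ∃ a, ∀ s, (ω, s) ∈ w → s = a ∨ s = a + 1 := by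
  induction l generalizing w with
  | nil =>
    constructor
    · rintro h; rw [show w = [] from h]; simp
    · rintro ⟨h, -⟩
      exact List.eq_nil_iff_forall_not_mem.2 fun v hv => by simpa using h v hv
  | cons ω l ih =>
    rw [List.nodup_cons] at hl
    constructor
    · intro h
      refine ⟨mem_sphereLang_fst h, fun ω' hω' => ?_⟩
      obtain ⟨h1, _, ⟨a, rfl⟩, h2⟩ := h
      rcases List.mem_cons.1 hω' with rfl | h'
      · exact ⟨a, h2⟩
      · obtain ⟨a, ha⟩ := ((ih hl.2).1 h1).2 ω' h'
        refine ⟨a, fun s hs => ha s (List.mem_filter.2 ⟨hs, ?_⟩)⟩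
        simpa using fun h : ω' = ω => hl.1 (h ▸ h')
    · rintro ⟨h1, h2⟩
      obtain ⟨a, ha⟩ := h2 ω (by simp)
      refine ⟨(ih hl.2).2 ⟨fun v hv => ?_, fun ω' hω' => ?_⟩, _, ⟨a, rfl⟩, ha⟩
      · rw [List.mem_filter] at hv
        have := h1 v hv.1
        simp only [List.mem_cons] at this
        exact this.resolve_left (by simpa using hv.2)
      · obtain ⟨b, hb⟩ := h2 ω' (List.mem_cons_of_mem _ hω')
        exact ⟨b, fun s hs => hb s (List.mem_of_mem_filter hs)⟩

end Join

/-! ### Passing to the exterior algebra -/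

section Wedge

variable (k : Type) [CommRing k] {V : Type}

/-- The generator of the exterior algebra given by a letter. -/
def letter (v : V) : ExteriorAlgebra k (V →₀ k) := ExteriorAlgebra.ι k (Finsupp.single v 1)

/-- The map from ordered chains to alternating chains. -/
def wedge : (List V →₀ k) →ₗ[k] ExteriorAlgebra k (V →₀ k) :=
  Finsupp.linearCombination k fun w => (w.map (letter k)).prod

lemma wedge_single (w : List V) : wedge k (Finsupp.single w 1) = (w.map (letter k)).prod := by
  simp [wedge]

lemma wedge_pre (v : V) (x : List V →₀ k) : wedge k (pre k v x) = letter k v * wedge k x := by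
  suffices h : wedge k ∘ₗ pre k v = LinearMap.mulLeft k (letter k v) ∘ₗ wedge k from
    LinearMap.congr_fun h x
  ext w
  simp [wedge_single]

/-- Contraction with the functional sending every letter to `1` is an antiderivation that obeys the
same recursion as the boundary. In particular a chain killed by `wedge` has its boundary killed too.
-/
lemma wedge_bdry (x : List V →₀ k) : wedge k (bdry k x) =
    CliffordAlgebra.contractLeft (Finsupp.linearCombination k fun _ : V => (1 : k)) (wedge k x) := by
  have key : ∀ w : List V, wedge k (wordBoundary k w) = CliffordAlgebra.contractLeft
      (Finsupp.linearCombination k fun _ : V => (1 : k)) (w.map (letter k)).prod := by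
    intro w
    induction w with
    | nil => simp [wordBoundary]
    | cons v w ih =>
      rw [wordBoundary, map_sub, wedge_pre, ih, wedge_single, List.map_cons, List.prod_cons]
      conv_rhs => rw [letter, ExteriorAlgebra.ι, CliffordAlgebra.contractLeft_ι_mul]
      simp [letter, ExteriorAlgebra.ι]
  suffices h : wedge k ∘ₗ bdry k = (CliffordAlgebra.contractLeft
      (Finsupp.linearCombination k fun _ : V => (1 : k))) ∘ₗ wedge k from LinearMap.congr_fun h x
  ext w
  simp [bdry_single, key, wedge_single]

lemma prod_letter_eq_zero {w : List V} (h : ¬w.Nodup) : (w.map (letter k)).prod = 0 := by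
  rw [List.nodup_iff_injective_get] at h
  simp only [Function.Injective, not_forall] at h
  obtain ⟨i, j, hij, hne⟩ := h
  have := (ExteriorAlgebra.ιMulti k w.length).map_eq_zero_of_eq
    (fun i => Finsupp.single (w.get i) (1 : k)) (by simp only [hij]) hne
  rw [ExteriorAlgebra.ιMulti_apply] at this
  rw [← this]
  congr 1
  conv_lhs => rw [← List.ofFn_get w]
  rw [List.map_ofFn]
  rfl

lemma commute_letter_mul (u v s t : V) :
    Commute (letter k u * letter k v) (letter k s * letter k t) := by
  have h : ∀ a b : V, letter k a * letter k b = -(letter k b * letter k a) := fun a b =>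
    eq_neg_of_add_eq_zero_left (ExteriorAlgebra.ι_add_mul_swap _ _)
  have h' : ∀ c : V, Commute (letter k u * letter k v) (letter k c) := fun c => by
    change _ * _ = _ * _
    rw [mul_assoc, h v c, mul_neg, ← mul_assoc, h u c, neg_mul, neg_neg, mul_assoc]
  exact (h' s).mul_right (h' t)

/-- The action of a map of letters on chains. -/
def act (σ : V → V) : (List V →₀ k) →ₗ[k] (List V →₀ k) := Finsupp.lmapDomain k k (List.map σ)

@[simp] lemma act_single (σ : V → V) (w : List V) (r : k) :
    act k σ (Finsupp.single w r) = Finsupp.single (w.map σ) r := by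
  simp [act, Finsupp.lmapDomain]

lemma act_pre (σ : V → V) (v : V) (x : List V →₀ k) :
    act k σ (pre k v x) = pre k (σ v) (act k σ x) := by
  suffices h : act k σ ∘ₗ pre k v = pre k (σ v) ∘ₗ act k σ from LinearMap.congr_fun h x
  ext w : 2
  simp

lemma act_act (σ τ : V → V) (x : List V →₀ k) : act k σ (act k τ x) = act k (σ ∘ τ) x := by
  suffices h : act k σ ∘ₗ act k τ = act k (σ ∘ τ) from LinearMap.congr_fun h x
  ext w : 2
  simp

lemma act_bdry (σ : V → V) (x : List V →₀ k) : act k σ (bdry k x) = bdry k (act k σ x) := by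
  have key : ∀ w : List V, act k σ (wordBoundary k w) = wordBoundary k (w.map σ) := by
    intro w
    induction w with
    | nil => simp [wordBoundary]
    | cons v w ih => rw [wordBoundary, map_sub, act_pre, ih, act_single]; rfl
  suffices h : act k σ ∘ₗ bdry k = bdry k ∘ₗ act k σ from LinearMap.congr_fun h x
  ext w : 2
  simp [bdry_single, key]

lemma act_mem_chains (σ : V → V) {L : Set (List V)} (hL : ∀ w ∈ L, w.map σ ∈ L) {d : ℕ}
    {x : List V →₀ k} (hx : x ∈ chains k L d) : act k σ x ∈ chains k L d := by
  refine chains_induction (act k σ) _ (fun w hw hd => ?_) hx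
  rw [act_single, ← hd, ← List.length_map σ]
  exact single_mem_chains (hL w hw) 1

lemma wedge_act (σ : V → V) (x : List V →₀ k) :
    wedge k (act k σ x) = ExteriorAlgebra.map (Finsupp.lmapDomain k k σ) (wedge k x) := by
  suffices h : wedge k ∘ₗ act k σ =
      (ExteriorAlgebra.map (Finsupp.lmapDomain k k σ)).toLinearMap ∘ₗ wedge k from
    LinearMap.congr_fun h x
  ext w
  simp only [LinearMap.coe_comp, Function.comp_apply, Finsupp.lsingle_apply, act_single,
    wedge_single, AlgHom.toLinearMap_apply, map_list_prod, List.map_map]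
  congr 2
  funext v
  simp [letter, Finsupp.lmapDomain]

end Wedge

/-! ### The fundamental class of a join of circles in the exterior algebra -/

section Sphere

variable (k : Type) [CommRing k] {Ω : Type} [DecidableEq Ω] {M : ℕ}

/-- A repetition-free word uses at most the two ends of one edge from each circle. Hence longer
words vanish in the exterior algebra, and the top-dimensional sphere has no boundaries there. -/
lemma length_le_of_mem_sphereLang {l : List Ω} {w : List (Ω × ZMod M)}
    (hw : w ∈ sphereLang M l) (hn : w.Nodup) : w.length ≤ 2 * l.length := by
  induction l generalizing w with
  | nil => rw [show w = [] from hw]; simp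
  | cons ω l ih =>
    obtain ⟨h1, _, ⟨a, rfl⟩, h2⟩ := hw
    have e1 := ih h1 (hn.filter _)
    have e2 : (w.filter fun v => ¬decide (v.1 ≠ ω)).length ≤ 2 := by
      refine List.Subperm.length_le (l₂ := [(ω, a), (ω, a + 1)])
        ((hn.filter _).subperm fun v hv => ?_)
      rw [List.mem_filter] at hv
      obtain ⟨ω', s⟩ := v
      obtain rfl : ω' = ω := by simpa using hv.2
      rcases h2 s hv.1 with h | h <;> rw [h] <;> simp
    have e3 := List.length_eq_length_filter_add (l := w) (fun v => decide (v.1 ≠ ω))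
    simp only [List.length_cons]
    simp only [decide_not, Bool.not_eq_eq_eq_not] at e1 e2 e3 ⊢
    simp at e1 e2 e3
    omega

lemma wedge_eq_zero_of_mem {l : List Ω} {x : List (Ω × ZMod M) →₀ k}
    (hx : x ∈ chains k (sphereLang M l) (2 * l.length + 1)) : wedge k x = 0 := by
  have : wedge k x ∈ (⊥ : Submodule k (ExteriorAlgebra k (Ω × ZMod M →₀ k))) := by
    refine chains_induction (wedge k) _ (fun w hw hd => ?_) hx
    rw [wedge_single, prod_letter_eq_zero]
    · exact zero_mem _
    · intro hn
      have := length_le_of_mem_sphereLang hw hn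
      omega
  simpa using this

variable [NeZero M]

variable (M) in
/-- The image of the fundamental cycle of a circle in the exterior algebra. -/
def circleWedge (ω : Ω) : ExteriorAlgebra k (Ω × ZMod M →₀ k) :=
  ∑ a : ZMod M, letter k (ω, a) * letter k (ω, a + 1)

lemma wedge_circle (ω : Ω) (x : List (Ω × ZMod M) →₀ k) :
    wedge k (circle k ω x) = circleWedge k M ω * wedge k x := by
  rw [circle, map_sum, circleWedge, Finset.sum_mul]
  refine Finset.sum_congr rfl fun a _ => ?_
  rw [wedge_pre, wedge_pre, mul_assoc]

lemma wedge_sphereCycle (l : List Ω) :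
    wedge k (sphereCycle k M l) = (l.map (circleWedge k M)).prod := by
  induction l with
  | nil => simp [sphereCycle, wedge_single]
  | cons ω l ih => rw [sphereCycle, wedge_circle, ih, List.map_cons, List.prod_cons]

lemma commute_circleWedge (ω ω' : Ω) : Commute (circleWedge k M ω) (circleWedge k M ω') :=
  Commute.sum_left _ _ _ fun _ _ => Commute.sum_right _ _ _ fun _ _ => commute_letter_mul k _ _ _ _

lemma contractLeft_circleWedge_mul (D : Module.Dual k (Ω × ZMod M →₀ k)) (ω : Ω)
    (y : ExteriorAlgebra k (Ω × ZMod M →₀ k)) (hy : CliffordAlgebra.contractLeft D y = 0) :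
    CliffordAlgebra.contractLeft D (circleWedge k M ω * y) =
      ∑ a : ZMod M, (D (Finsupp.single (ω, a) 1) • (letter k (ω, a + 1) * y) -
        D (Finsupp.single (ω, a + 1) 1) • (letter k (ω, a) * y)) := by
  rw [circleWedge, Finset.sum_mul, map_sum]
  refine Finset.sum_congr rfl fun a _ => ?_
  rw [mul_assoc]
  have e : ∀ (v : Ω × ZMod M) x, CliffordAlgebra.contractLeft D (letter k v * x) =
      D (Finsupp.single v 1) • x - letter k v * CliffordAlgebra.contractLeft D x := fun v x =>
    CliffordAlgebra.contractLeft_ι_mul D _ x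
  rw [e, e, hy, mul_zero, sub_zero, mul_smul_comm]

/-- Contracting with the coordinates of the vertices `0` and `1` of the first circle strips off its
factor: the edge `{0, 1}` contributes the remaining product once. The other edge at `0` ends in
`-1`, which differs from `1` because `M ≥ 3`. -/
lemma prod_circleWedge_ne_zero [Nontrivial k] (hM : 3 ≤ M) {l : List Ω} (hl : l.Nodup) :
    (l.map (circleWedge k M)).prod ≠ 0 := by
  have vanish : ∀ (D : Module.Dual k (Ω × ZMod M →₀ k)) (l : List Ω),
      (∀ ω ∈ l, ∀ a, D (Finsupp.single (ω, a) 1) = 0) →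
      CliffordAlgebra.contractLeft D (l.map (circleWedge k M)).prod = 0 := by
    intro D l h
    induction l with
    | nil => simp
    | cons ω l ih =>
      rw [List.map_cons, List.prod_cons, contractLeft_circleWedge_mul k D ω _
        (ih fun ω' hω' => h ω' (List.mem_cons_of_mem _ hω'))]
      simp [h ω (by simp)]
  induction l with
  | nil => simp
  | cons ω l ih =>
    rw [List.nodup_cons] at hl
    intro h0
    rw [List.map_cons, List.prod_cons] at h0
    set y := (l.map (circleWedge k M)).prod with hy
    have hc : ∀ b : ZMod M, CliffordAlgebra.contractLeft (Finsupp.lapply (ω, b)) y = 0 := by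
      intro b
      refine vanish _ l fun ω' hω' a => ?_
      rw [Finsupp.lapply_apply, Finsupp.single_apply, if_neg]
      intro h
      obtain rfl : ω' = ω := (Prod.ext_iff.1 h).1
      exact hl.1 hω'
    have h1 := contractLeft_circleWedge_mul k (Finsupp.lapply (ω, 0)) ω y (hc 0)
    rw [h0, map_zero] at h1
    have h2 : ∑ a : ZMod M, ((Finsupp.lapply (ω, (0 : ZMod M)) : (Ω × ZMod M →₀ k) →ₗ[k] k)
        (Finsupp.single (ω, a) 1) • (letter k (ω, a + 1) * y) -
        (Finsupp.lapply (ω, (0 : ZMod M)) : (Ω × ZMod M →₀ k) →ₗ[k] k)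
          (Finsupp.single (ω, a + 1) 1) • (letter k (ω, a) * y)) =
        letter k (ω, 1) * y - letter k (ω, -1) * y := by
      rw [Finset.sum_sub_distrib]
      congr 1
      · rw [Finset.sum_eq_single 0]
        · simp
        · intro b _ hb
          simp [hb]
        · simp
      · rw [Finset.sum_eq_single (-1)]
        · simp
        · intro b _ hb
          have : b + 1 ≠ 0 := fun h => hb (eq_neg_of_add_eq_zero_left h)
          simp [this]
        · simp
    rw [h2] at h1
    have h3 := congrArg (CliffordAlgebra.contractLeft
      (Finsupp.lapply (ω, (1 : ZMod M)) : (Ω × ZMod M →₀ k) →ₗ[k] k)) h1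
    have e : ∀ (v : Ω × ZMod M), CliffordAlgebra.contractLeft
        (Finsupp.lapply (ω, (1 : ZMod M)) : (Ω × ZMod M →₀ k) →ₗ[k] k) (letter k v * y) =
        (Finsupp.single v (1 : k) (ω, 1)) • y := fun v => by
      refine (CliffordAlgebra.contractLeft_ι_mul _ _ _).trans ?_
      rw [hc 1, mul_zero, sub_zero, Finsupp.lapply_apply]
    have hne : (-1 : ZMod M) ≠ 1 := by
      intro h
      have h' : ((2 : ℕ) : ZMod M) = ((0 : ℕ) : ZMod M) := by
        push_cast
        linear_combination -h
      rw [natCast_inj_of_lt (by omega) (by omega)] at h'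
      omega
    rw [map_zero, map_sub, e, e] at h3
    simp [hne] at h3
    exact ih hl.2 h3.symm

/-- A permutation of the circles followed by rotations. -/
def rotate (τ : Ω → Ω) (κ : Ω → ZMod M) (v : Ω × ZMod M) : Ω × ZMod M := (τ v.1, v.2 + κ v.1)

lemma act_circle (τ : Ω → Ω) (κ : Ω → ZMod M) (ω : Ω) (x : List (Ω × ZMod M) →₀ k) :
    act k (rotate τ κ) (circle k ω x) = circle k (τ ω) (act k (rotate τ κ) x) := by
  rw [circle, map_sum, circle]
  refine Fintype.sum_equiv (Equiv.addRight (κ ω)) _ _ fun a => ?_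
  rw [act_pre, act_pre]
  simp only [rotate, Equiv.coe_addRight]
  rw [add_right_comm]

lemma wedge_act_sphereCycle (τ : Ω → Ω) (κ : Ω → ZMod M) (l : List Ω) :
    wedge k (act k (rotate τ κ) (sphereCycle k M l)) =
      ((l.map τ).map (circleWedge k M)).prod := by
  induction l with
  | nil => simp [sphereCycle, wedge_single]
  | cons ω l ih =>
    rw [sphereCycle, act_circle, wedge_circle, ih, List.map_cons, List.map_cons, List.prod_cons]

lemma map_rotate_mem_sphereLang {l : List Ω} (hl : l.Nodup) (hall : ∀ ω, ω ∈ l)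
    (τ : Equiv.Perm Ω) (κ : Ω → ZMod M) {w : List (Ω × ZMod M)} (hw : w ∈ sphereLang M l) :
    w.map (rotate τ κ) ∈ sphereLang M l := by
  rw [mem_sphereLang_iff hl] at hw ⊢
  refine ⟨fun v _ => hall _, fun ω _ => ?_⟩
  obtain ⟨a, ha⟩ := hw.2 (τ.symm ω) (hall _)
  refine ⟨a + κ (τ.symm ω), fun s hs => ?_⟩
  obtain ⟨⟨ω', s'⟩, hv, hv'⟩ := List.mem_map.1 hs
  simp only [rotate, Prod.mk.injEq] at hv'
  obtain ⟨rfl, rfl⟩ := hv'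
  rw [Equiv.symm_apply_apply] at ha ⊢
  rcases ha s' hv with h | h
  · exact Or.inl (by rw [h])
  · exact Or.inr (by rw [h]; ring)

/-- A functional on top-dimensional cycles of a join of circles which is invariant under
permutations and rotations of the circles. -/
theorem exists_invariant_functional (F : Type) [Field F] (hM : 3 ≤ M) {l : List Ω} (hl : l.Nodup)
    (hall : ∀ ω, ω ∈ l) :
    ∃ Θ : (List (Ω × ZMod M) →₀ F) →ₗ[F] F, Θ (sphereCycle F M l) = 1 ∧
      ∀ (τ : Equiv.Perm Ω) (κ : Ω → ZMod M), ∀ x ∈ chains F (sphereLang M l) (2 * l.length),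
        bdry F x = 0 → Θ (act F (rotate τ κ) x) = Θ x := by
  have hne := prod_circleWedge_ne_zero F hM hl
  rw [← wedge_sphereCycle] at hne
  obtain ⟨ξ, hξ⟩ : ∃ ξ : Module.Dual F (ExteriorAlgebra F (Ω × ZMod M →₀ F)),
      ξ (wedge F (sphereCycle F M l)) ≠ 0 := by
    by_contra! h
    exact hne ((Module.forall_dual_apply_eq_zero_iff F _).1 h)
  -- A top cycle is a multiple of the fundamental one plus a boundary, and `wedge` kills that
  -- boundary. The fundamental cycle maps to a product of commuting even elements, unchanged by
  -- rotations and reorderings; no sign appears.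
  refine ⟨(ξ (wedge F (sphereCycle F M l)))⁻¹ • ξ ∘ₗ wedge F, ?_, fun τ κ x hx hx0 => ?_⟩
  · simp [inv_mul_cancel₀ hξ]
  · obtain ⟨r, y, hy, rfl⟩ := (spherical_sphereLang (k := F) hM hl).top x hx hx0
    have e1 : wedge F (bdry F y) = 0 := by
      rw [wedge_bdry, wedge_eq_zero_of_mem F hy, map_zero]
    have e2 : wedge F (act F (rotate τ κ) (sphereCycle F M l)) = wedge F (sphereCycle F M l) := by
      rw [wedge_act_sphereCycle, wedge_sphereCycle]
      refine List.Perm.prod_eq' (List.Perm.map _ ?_) ?_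
      · exact (List.perm_ext_iff_of_nodup (hl.map τ.injective) hl).2 fun ω =>
          ⟨fun _ => hall _, fun _ => List.mem_map.2 ⟨τ.symm ω, hall _, by simp⟩⟩
      · rw [List.map_map, List.pairwise_map]
        exact List.pairwise_of_forall fun _ _ => commute_circleWedge F _ _
    have e3 : wedge F (act F (rotate τ κ) (bdry F y)) = 0 := by
      rw [wedge_act, e1, map_zero]
    simp only [LinearMap.smul_apply, LinearMap.comp_apply, map_add, map_smul, e1, e2, e3]

end Sphere

/-! ### The explicit chain map for a group rotating all circles -/

section RotationChain

variable (k : Type) [CommRing k] {Ω : Type} [DecidableEq Ω] {M : ℕ} [NeZero M]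

/-- Going forward from `a` to `b` and on to `c` exceeds the direct path from `a` to `c` by a full
turn exactly when the addition of the two differences carries. -/
lemma path_carry (ω : Ω) (a b c : ZMod M) (x : List (Ω × ZMod M) →₀ k) :
    path k ω b (c - b).val x - (path k ω a (c - a).val x - path k ω a (b - a).val x) =
      ((carry (b - a) (c - b) : ℤ) : k) • circle k ω x := by
  have hM : (M : ℤ) ≠ 0 := Int.natCast_ne_zero.2 (NeZero.ne M)
  have hc := mul_carry (b - a) (c - b)
  have e1 : path k ω a ((b - a).val + (c - b).val) x =
      path k ω a (b - a).val x + path k ω b (c - b).val x := by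
    rw [path_add]; simp
  have e2 : b - a + (c - b) = c - a := by ring
  rw [e2] at hc
  rcases lt_or_ge ((b - a).val + (c - b).val) M with h | h
  · have h3 := ZMod.val_add_of_lt h
    rw [e2] at h3
    have h0 : carry (b - a) (c - b) = 0 := by
      refine (mul_eq_zero.1 (hc.trans ?_)).resolve_left hM
      rw [h3]; push_cast; ring
    rw [h3, e1, h0]
    simp
  · have h3 := ZMod.val_add_val_of_le h
    rw [e2] at h3
    have h0 : carry (b - a) (c - b) = 1 := by
      refine mul_left_cancel₀ hM (hc.trans ?_)
      have : ((b - a).val : ℤ) + (c - b).val = (c - a).val + M := by exact_mod_cast h3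
      linarith
    rw [h3, path_add, path_modulus] at e1
    rw [h0, Int.cast_one, one_smul, eq_sub_iff_add_eq'.2 e1]
    abel

/-- Joining with the fundamental cycle of a circle, as a linear map. -/
def circleHom (ω : Ω) : (List (Ω × ZMod M) →₀ k) →ₗ[k] (List (Ω × ZMod M) →₀ k) :=
  ∑ a : ZMod M, pre k (ω, a) ∘ₗ pre k (ω, a + 1)

lemma circleHom_apply (ω : Ω) (x : List (Ω × ZMod M) →₀ k) : circleHom k ω x = circle k ω x := by
  simp [circleHom, circle]

/-- The equivariant chains in a join of circles attached to a sequence of rotations. -/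
def rotationChain : List Ω → ℕ → (ℕ → ZMod M) → (List (Ω × ZMod M) →₀ k)
  | _, 0, _ => Finsupp.single [] 1
  | [], _ + 1, _ => 0
  | ω :: _, 1, a => pre k (ω, a 0) (Finsupp.single [] 1)
  | ω :: _, 2, a => path k ω (a 0) (a 1 - a 0).val (Finsupp.single [] 1)
  | ω :: l, d + 3, a => ((carry (a 1 - a 0) (a 2 - a 1) : ℤ) : k) •
      circle k ω (rotationChain l (d + 1) fun j => a (j + 2))

lemma rotationChain_zero (l : List Ω) (a : ℕ → ZMod M) :
    rotationChain k l 0 a = Finsupp.single [] 1 := by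
  cases l <;> rfl

lemma nil_mem_sphereLang (l : List Ω) : [] ∈ sphereLang M l := by
  induction l with
  | nil => rfl
  | cons ω l ih => exact ⟨by simpa using ih, {0, 0 + 1}, ⟨0, rfl⟩, by simp⟩

lemma circle_mem_chains {ω : Ω} {l : List Ω} (h : ω ∉ l) {d : ℕ} {x : List (Ω × ZMod M) →₀ k}
    (hx : x ∈ chains k (sphereLang M l) d) :
    circle k ω x ∈ chains k (sphereLang M (ω :: l)) (d + 2) := by
  refine Submodule.sum_mem _ fun a _ => chains_mono (joinLang_mono ?_) _ (pre_pre_mem_joinLang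
    (fun w hw v hv (e : v.1 = ω) => h (e ▸ mem_sphereLang_fst hw v hv)) (B := {a, a + 1})
    (Set.mem_insert _ _) (Set.mem_insert_of_mem _ (Set.mem_singleton _)) hx)
  rintro _ rfl
  exact ⟨_, ⟨a, rfl⟩, le_rfl⟩

lemma rotationChain_mem {l : List Ω} (hl : l.Nodup) (d : ℕ) (a : ℕ → ZMod M) :
    rotationChain k l d a ∈ chains k (sphereLang M l) d := by
  induction l generalizing d a with
  | nil =>
    cases d with
    | zero => exact single_mem_chains (nil_mem_sphereLang []) 1
    | succ d => exact zero_mem _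
  | cons ω l ih =>
    rw [List.nodup_cons] at hl
    have hs : Finsupp.single [] 1 ∈ chains k (sphereLang M l) 0 :=
      single_mem_chains (nil_mem_sphereLang l) 1
    have hω : ∀ w ∈ sphereLang M l, ∀ v ∈ w, v.1 ≠ ω := fun w hw v hv e =>
      hl.1 (e ▸ mem_sphereLang_fst hw v hv)
    match d with
    | 0 => exact single_mem_chains (nil_mem_sphereLang _) 1
    | 1 =>
      refine chains_mono (joinLang_mono ?_) _
        (pre_mem_joinLang hω (B := {a 0, a 0 + 1}) (Set.mem_insert _ _) hs)
      rintro _ rfl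
      exact ⟨_, ⟨a 0, rfl⟩, le_rfl⟩
    | 2 =>
      refine Submodule.sum_mem _ fun (i : ℕ) _ => chains_mono (joinLang_mono ?_) _
        (pre_pre_mem_joinLang hω (B := {a 0 + i, a 0 + i + 1}) (Set.mem_insert _ _)
          (Set.mem_insert_of_mem _ (Set.mem_singleton _)) hs)
      rintro _ rfl
      exact ⟨_, ⟨a 0 + i, rfl⟩, le_rfl⟩
    | d + 3 => exact Submodule.smul_mem _ _ (circle_mem_chains k hl.1 (ih hl.2 (d + 1) _))

lemma rotationChain_dependsOn (l : List Ω) (d : ℕ) :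
    DependsOn d (rotationChain k (M := M) l d) := by
  induction l generalizing d with
  | nil => intro a b _; cases d <;> rfl
  | cons ω l ih =>
    intro a b h
    match d with
    | 0 => rfl
    | 1 => simp only [rotationChain]; rw [h 0 (by omega)]
    | 2 => simp only [rotationChain]; rw [h 0 (by omega), h 1 (by omega)]
    | d + 3 =>
      simp only [rotationChain]
      rw [h 0 (by omega), h 1 (by omega), h 2 (by omega),
        ih (d + 1) _ _ fun i hi => h (i + 2) (by omega)]

lemma act_rotationChain (l : List Ω) (d : ℕ) (c : ZMod M) (a : ℕ → ZMod M) :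
    act k (rotate id fun _ => c) (rotationChain k l d a) =
      rotationChain k l d fun j => a j + c := by
  induction l generalizing d a with
  | nil =>
    cases d with
    | zero => simp [rotationChain]
    | succ d => simp [rotationChain]
  | cons ω l ih =>
    match d with
    | 0 => simp [rotationChain]
    | 1 => simp [rotationChain, rotate]
    | 2 =>
      simp only [rotationChain, path, map_sum, act_pre, act_single, add_sub_add_right_eq_sub]
      refine Finset.sum_congr rfl fun i _ => ?_
      simp only [rotate, id]
      rw [add_right_comm (a 0) c, add_right_comm (a 0 + (i : ZMod M)) c]
      rfl
    | d + 3 =>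
      simp only [rotationChain, map_smul, act_circle, ih, add_sub_add_right_eq_sub]
      rfl

/-- The chains have the form of a cup product of the carry cocycle with the chains of the remaining
circles, so the Leibniz rule leaves only the coboundary of the second factor. For `d = 0` the paths
produce the carry. -/
lemma altSum_rotationChain_cons (ω : Ω) (l : List Ω) (d : ℕ) (a : ℕ → ZMod M) :
    altSum (d + 3) (rotationChain k (ω :: l) (d + 2)) a =
      ((carry (a 1 - a 0) (a 2 - a 1) : ℤ) : k) •
        circle k ω (altSum (d + 1) (rotationChain k l d) fun j => a (j + 2)) := by
  cases d with
  | zero =>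
    simp only [altSum, rotationChain_zero, sub_zero]
    rw [← path_carry]
    rfl
  | succ d =>
    have hc := carry_cocycle (a 1 - a 0) (a 2 - a 1) (a 3 - a 2)
    rw [show a 1 - a 0 + (a 2 - a 1) = a 2 - a 0 by ring,
      show a 2 - a 1 + (a 3 - a 2) = a 3 - a 1 by ring] at hc
    have hc' : ((carry (a 2 - a 1) (a 3 - a 2) : ℤ) : k) = (carry (a 2 - a 0) (a 3 - a 2) : ℤ) -
        (carry (a 1 - a 0) (a 3 - a 1) : ℤ) + (carry (a 1 - a 0) (a 2 - a 1) : ℤ) := by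
      have := congrArg (Int.cast : ℤ → k) hc
      push_cast at this
      linear_combination this
    have e1 : altSum (d + 1) (fun u => rotationChain k (ω :: l) (d + 3)
        (scons (a 0) (scons (a 1) (scons (a 2) u)))) (fun j => a (j + 3)) =
        ((carry (a 1 - a 0) (a 2 - a 1) : ℤ) : k) • circle k ω (altSum (d + 1)
          (fun u => rotationChain k l (d + 1) (scons (a 2) u)) fun j => a (j + 3)) := by
      rw [← circleHom_apply]
      refine Eq.trans ?_ (altSum_map ((((carry (a 1 - a 0) (a 2 - a 1) : ℤ) : k) •
        circleHom k ω).toAddMonoidHom) (d + 1) _ _).symm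
      congr 1
      funext u
      change _ = ((carry (a 1 - a 0) (a 2 - a 1) : ℤ) : k) • circleHom k ω _
      rw [circleHom_apply]
      rfl
    have e0 : altSum (d + 1 + 1) (rotationChain k l (d + 1)) (fun j => a (j + 2)) =
        rotationChain k l (d + 1) (fun j => a (j + 3)) - altSum (d + 1)
          (fun u => rotationChain k l (d + 1) (scons (a 2) u)) fun j => a (j + 3) := rfl
    have e2 : altSum (d + 1 + 3) (rotationChain k (ω :: l) (d + 3)) a =
        ((carry (a 2 - a 1) (a 3 - a 2) : ℤ) : k) •
            circle k ω (rotationChain k l (d + 1) fun j => a (j + 3)) -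
          (((carry (a 2 - a 0) (a 3 - a 2) : ℤ) : k) •
            circle k ω (rotationChain k l (d + 1) fun j => a (j + 3)) -
          (((carry (a 1 - a 0) (a 3 - a 1) : ℤ) : k) •
            circle k ω (rotationChain k l (d + 1) fun j => a (j + 3)) -
          altSum (d + 1) (fun u => rotationChain k (ω :: l) (d + 3)
            (scons (a 0) (scons (a 1) (scons (a 2) u)))) (fun j => a (j + 3)))) := rfl
    rw [e2, e1, e0, hc', ← circleHom_apply, ← circleHom_apply, ← circleHom_apply, map_sub,
      smul_sub, add_smul, sub_smul]
    abel

lemma bdry_rotationChain (l : List Ω) (d : ℕ) (hd : d < 2 * l.length) (a : ℕ → ZMod M) :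
    bdry k (rotationChain k l (d + 1) a) = altSum (d + 1) (rotationChain k l d) a := by
  have hnil : bdry k (Finsupp.single ([] : List (Ω × ZMod M)) 1) = 0 := by
    rw [bdry_single]; rfl
  induction l generalizing d a with
  | nil => simp at hd
  | cons ω l ih =>
    match d with
    | 0 =>
      rw [rotationChain, bdry_pre, hnil]
      simp [altSum, rotationChain]
    | 1 =>
      simp only [rotationChain, altSum]
      rw [bdry_path _ _ hnil]
      simp
    | d + 2 =>
      rw [altSum_rotationChain_cons, ← ih d (by simp at hd; omega), ← bdry_circle, ← map_smul]
      rfl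

/-- The product of the carries of consecutive pairs of differences. -/
def carryProd : ℕ → (ℕ → ZMod M) → k
  | 0, _ => 1
  | n + 1, a => ((carry (a 1 - a 0) (a 2 - a 1) : ℤ) : k) * carryProd n fun j => a (j + 2)

/-- The obstruction to extending the chains past the top dimension: each circle contributes one
carry. -/
lemma altSum_rotationChain_top (l : List Ω) (a : ℕ → ZMod M) :
    altSum (2 * l.length + 1) (rotationChain k l (2 * l.length)) a =
      carryProd k l.length a • sphereCycle k M l := by
  induction l generalizing a with
  | nil => simp [altSum, rotationChain, carryProd, sphereCycle]
  | cons ω l ih =>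
    rw [List.length_cons, mul_add, mul_one, altSum_rotationChain_cons, ih, carryProd, mul_smul,
      sphereCycle, ← circleHom_apply, map_smul, circleHom_apply]

end RotationChain

/-! ### Equivariant chain maps extending a given one -/

section Extension

variable {k T G C : Type} [CommRing k] [AddCommGroup T] [Module k T] [Group G] [Group C]

/-- `G` acts freely on sequences, so an equivariant family of fillings may be chosen on sequences
with first entry `1` and then translated. Exactness below degree `N` provides the fillings, and `ψ`
is used wherever it is already defined. `φ d` reads `d` entries, since the complex is augmented. -/
theorem exists_equivariant_extension (i : C →* G) (hi : Function.Injective i)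
    (ρ : G → T →ₗ[k] T) (ρ_mul : ∀ g h x, ρ (g * h) x = ρ g (ρ h x))
    (δ : T →ₗ[k] T) (hδ : ∀ g x, δ (ρ g x) = ρ g (δ x)) (X : ℕ → Submodule k T)
    (hX : ∀ d g, ∀ x ∈ X d, ρ g x ∈ X d) (N : ℕ)
    (exact' : ∀ d < N, ∀ x ∈ X d, δ x = 0 → ∃ y ∈ X (d + 1), δ y = x)
    (ψ : ℕ → (ℕ → C) → T) (ψX : ∀ d c, ψ d c ∈ X d) (ψD : ∀ d, DependsOn d (ψ d))
    (ψρ : ∀ d c u, ψ d ((c * ·) ∘ u) = ρ (i c) (ψ d u))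
    (ψδ : ∀ d < N, ∀ u, δ (ψ (d + 1) u) = altSum (d + 1) (ψ d) u) (e : T)
    (he : ∀ u, ψ 0 u = e) (heρ : ∀ g, ρ g e = e) (heδ : δ e = 0) :
    ∃ φ : ℕ → (ℕ → G) → T, (∀ d ≤ N, (∀ w, φ d w ∈ X d) ∧ DependsOn d (φ d) ∧
      (∀ g w, φ d ((g * ·) ∘ w) = ρ g (φ d w)) ∧ ∀ u : ℕ → C, φ d (i ∘ u) = ψ d u) ∧
      ∀ d < N, ∀ w, δ (φ (d + 1) w) = altSum (d + 1) (φ d) w := by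
  induction N with
  | zero =>
    refine ⟨fun _ _ => e, fun d hd => ?_, fun d hd => by omega⟩
    obtain rfl : d = 0 := by omega
    exact ⟨fun w => he (fun _ => 1) ▸ ψX 0 _, fun _ _ _ => rfl, fun g w => (heρ g).symm,
      fun u => (he u).symm⟩
  | succ N ih =>
    obtain ⟨φ, h1, h2⟩ := ih (fun d hd => exact' d (by omega)) (fun d hd => ψδ d (by omega))
    obtain ⟨hφX, hφD, hφρ, hφψ⟩ := h1 N le_rfl
    have hcyc : ∀ w, δ (altSum (N + 1) (φ N) w) = 0 := by
      intro w
      refine (altSum_map δ.toAddMonoidHom (N + 1) (φ N) w).trans ?_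
      change altSum (N + 1) (fun u => δ (φ N u)) w = 0
      cases N with
      | zero =>
        have : ∀ u, δ (φ 0 u) = 0 := by
          intro u
          have : φ 0 u = e := by
            rw [← he fun _ => 1, ← hφψ]
            exact hφD _ _ (by simp)
          rw [this, heδ]
        simp [altSum, this]
      | succ N =>
        simp only [h2 N (by omega)]
        exact altSum_altSum (N + 1) (φ N) w
    have hex : ∀ w, ∃ y ∈ X (N + 1), δ y = altSum (N + 1) (φ N) w := fun w =>
      exact' N (by omega) _ (altSum_mem (X N) _ _ hφX w) (hcyc w)
    choose f hfX hfδ using hex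
    -- Translate the first entry to `1` and overwrite the irrelevant tail by `1`: the choice then
    -- depends only on the entries that matter, and sequences coming from `C` are recognised.
    let nrm : (ℕ → G) → ℕ → G := fun w j => if j < N + 1 then (w 0)⁻¹ * w j else 1
    have nrmD : ∀ w w', (∀ j < N + 1, w j = w' j) → nrm w = nrm w' := by
      intro w w' h
      funext j
      simp only [nrm]
      split_ifs with hj
      · rw [h j hj, h 0 (by omega)]
      · rfl
    have nrm_mul : ∀ g w, nrm ((g * ·) ∘ w) = nrm w := by
      intro g w; funext j
      simp only [nrm, Function.comp_apply]
      split_ifs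
      · group
      · rfl
    classical
    let f' : (ℕ → G) → T := fun w =>
      if h : ∃ c : ℕ → C, i ∘ c = nrm w then ψ (N + 1) h.choose else f (nrm w)
    have f'X : ∀ w, f' w ∈ X (N + 1) := by
      intro w
      simp only [f']
      split_ifs
      · exact ψX _ _
      · exact hfX _
    have f'δ : ∀ w, δ (f' w) = altSum (N + 1) (φ N) (nrm w) := by
      intro w
      simp only [f']
      split_ifs with h
      · rw [ψδ N (by omega)]
        conv_rhs => rw [← h.choose_spec, altSum_comp]
        simp only [hφψ]
      · exact hfδ _
    have f'_congr : ∀ w w', nrm w = nrm w' → f' w = f' w' := by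
      intro w w' h
      simp only [f', h]
    let φ' : (ℕ → G) → T := fun w => ρ (w 0) (f' w)
    refine ⟨fun d => if d = N + 1 then φ' else φ d, fun d hd => ?_, fun d hd => ?_⟩
    · by_cases hdN : d = N + 1
      · subst hdN
        simp only [if_pos]
        refine ⟨fun w => hX _ _ _ (f'X w), fun w w' hw => ?_, fun g w => ?_, fun u => ?_⟩
        · simp only [φ']
          rw [hw 0 (by omega), f'_congr w w' (nrmD w w' hw)]
        · simp only [φ']
          rw [f'_congr _ _ (nrm_mul g w), Function.comp_apply, ρ_mul]
        · let c : ℕ → C := fun j => if j < N + 1 then (u 0)⁻¹ * u j else 1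
          have hc : i ∘ c = nrm (i ∘ u) := by
            funext j
            simp only [c, nrm, Function.comp_apply]
            split_ifs <;> simp
          have hex : ∃ c : ℕ → C, i ∘ c = nrm (i ∘ u) := ⟨c, hc⟩
          have hcc : hex.choose = c := by
            funext j
            exact hi (congrFun (hex.choose_spec.trans hc.symm) j)
          have : f' (i ∘ u) = ψ (N + 1) c := by
            simp only [f']
            rw [dif_pos hex, hcc]
          simp only [φ', this]
          rw [Function.comp_apply, ← ψρ]
          refine ψD _ _ _ fun j hj => ?_
          simp only [c, if_pos hj, Function.comp_apply, mul_inv_cancel_left]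
      · simp only [if_neg hdN]
        exact h1 d (by omega)
    · simp only [if_neg (show d ≠ N + 1 by omega), Nat.add_right_cancel_iff]
      by_cases hdN : d = N
      · subst hdN
        simp only [if_pos]
        intro w
        simp only [φ']
        rw [hδ, f'δ]
        refine (altSum_map (ρ (w 0)).toAddMonoidHom _ _ _).trans ?_
        have : (fun u => (ρ (w 0)).toAddMonoidHom (φ d u)) = fun u => φ d ((w 0 * ·) ∘ u) :=
          funext fun u => (hφρ _ u).symm
        rw [this, ← altSum_comp]
        refine hφD.altSum _ _ fun j hj => ?_
        simp only [nrm, if_pos hj, Function.comp_apply, mul_inv_cancel_left]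
      · simp only [if_neg hdN]
        exact h2 d (by omega)

end Extension

/-! ### The Euler class of a monomial representation -/

section Euler

variable {p : ℕ} [Fact p.Prime] {P : Type} [Group P]

/-- The rotation of the circles over the cosets of `A` given by a group element and a character
`χ` of `A`. -/
def rotationCocycle {M : ℕ} (A : Subgroup P) (χ : P → ZMod M) (g : P) (ω : P ⧸ A) : ZMod M :=
  χ ((g • ω).out⁻¹ * g * ω.out)

lemma out_inv_mul_mem (A : Subgroup P) (g : P) (ω : P ⧸ A) :
    (g • ω).out⁻¹ * g * ω.out ∈ A := by
  rw [mul_assoc, ← QuotientGroup.eq, QuotientGroup.out_eq']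
  conv_lhs => rw [← QuotientGroup.out_eq' ω]
  rfl

/-- A character of `A` that agrees on the central subgroup `C` with a given one yields a class on
`P` restricting to a power of the Chern class on `C`. -/
theorem exists_eulerClass [Finite P] {M : ℕ} [NeZero M] (hM : 3 ≤ M) (A C : Subgroup P)
    (hCA : C ≤ A) (hC : C ≤ Subgroup.center P) (χ : P → ZMod M)
    (hχ : ∀ a ∈ A, ∀ b ∈ A, χ (a * b) = χ a + χ b) :
    ∃ (U : HStar p P) (F : (ℕ → P) → ZMod p), Represents (2 * A.index) F U ∧
      ∀ w : ℕ → C, F (C.subtype ∘ w) = carryProd (ZMod p) A.index fun j => χ (w j) := by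
  classical
  have : Fintype (P ⧸ A) := Fintype.ofFinite _
  set l : List (P ⧸ A) := Finset.univ.toList with hl
  have hnd : l.Nodup := Finset.nodup_toList _
  have hall : ∀ ω, ω ∈ l := by simp [hl]
  have hlen : l.length = A.index := by
    rw [hl, Finset.length_toList, Finset.card_univ, Subgroup.index, Nat.card_eq_fintype_card]
  rw [← hlen]
  obtain ⟨Θ, hΘ1, hΘ⟩ := exists_invariant_functional (ZMod p) hM hnd hall
  -- The monomial action induced from `χ`: coset representatives turn `g` into a permutation of the
  -- circles and a rotation of each.
  let σ : P → (P ⧸ A) × ZMod M → (P ⧸ A) × ZMod M := fun g =>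
    rotate (MulAction.toPerm g : Equiv.Perm (P ⧸ A)) (rotationCocycle A χ g)
  have σ_mul : ∀ g h, σ (g * h) = σ g ∘ σ h := by
    intro g h
    funext ⟨ω, s⟩
    have e : ((g * h) • ω).out⁻¹ * (g * h) * ω.out =
        ((g • h • ω).out⁻¹ * g * (h • ω).out) * ((h • ω).out⁻¹ * h * ω.out) := by
      rw [mul_smul]; group
    simp only [σ, rotate, rotationCocycle, Function.comp_apply, MulAction.toPerm_apply]
    rw [e, hχ _ (out_inv_mul_mem A g _) _ (out_inv_mul_mem A h _), mul_smul, add_assoc,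
      add_comm (χ _)]
  -- Central elements of `A` fix all cosets and rotate every circle by the same amount.
  have σ_C : ∀ c : C, σ c = rotate id fun _ => χ c := by
    intro c
    funext ⟨ω, s⟩
    have hc : ∀ g, g * (c : P) = c * g := fun g => Subgroup.mem_center_iff.1 (hC c.2) g
    have e1 : (c : P) • ω = ω := by
      conv_lhs => rw [← QuotientGroup.out_eq' ω]
      conv_rhs => rw [← QuotientGroup.out_eq' ω]
      change ((c * ω.out : P) : P ⧸ A) = _
      rw [QuotientGroup.eq, ← hc]
      simpa using hCA c.2
    simp only [σ, rotate, rotationCocycle, MulAction.toPerm_apply, e1, id]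
    rw [hc, mul_assoc, inv_mul_cancel, mul_one]
  obtain ⟨φ, h1, h2⟩ := exists_equivariant_extension (k := ZMod p) C.subtype C.subtype_injective
    (fun g => act (ZMod p) (σ g)) (fun g h x => by rw [σ_mul, act_act])
    (bdry (ZMod p)) (fun g x => (act_bdry _ _ x).symm) (chains (ZMod p) (sphereLang M l))
    (fun d g x hx => act_mem_chains _ _ (fun w hw => map_rotate_mem_sphereLang hnd hall _ _ hw) hx)
    (2 * l.length) (fun d hd x hx hx0 => (spherical_sphereLang hM hnd).exactAt d hd x hx hx0)
    (fun d u => rotationChain (ZMod p) l d fun j => χ (u j))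
    (fun d u => rotationChain_mem _ hnd d _)
    (fun d u u' h => rotationChain_dependsOn _ l d _ _ fun i hi => by rw [h i hi])
    (fun d c u => by
      simp only [Subgroup.subtype_apply, σ_C, act_rotationChain]
      congr 1
      funext j
      rw [Function.comp_apply, Subgroup.coe_mul, hχ _ (hCA c.2) _ (hCA (u j).2), add_comm])
    (fun d hd u => by
      rw [bdry_rotationChain _ _ _ hd]
      exact altSum_comp (fun c : C => χ c) (d + 1) (rotationChain (ZMod p) l d) u)
    (Finsupp.single [] 1) (fun u => rotationChain_zero _ _ _) (fun g => by simp)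
    (by rw [bdry_single]; rfl)
  obtain ⟨hφX, hφD, hφρ, hφψ⟩ := h1 (2 * l.length) le_rfl
  have hlpos : 0 < l.length := by rw [hlen]; exact Nat.pos_of_ne_zero A.index_ne_zero_of_finite
  obtain ⟨m, hm⟩ : ∃ m, 2 * l.length = m + 1 := ⟨2 * l.length - 1, by omega⟩
  have hcyc : ∀ w, bdry (ZMod p) (altSum (2 * l.length + 1) (φ (2 * l.length)) w) = 0 := by
    intro w
    refine (altSum_map (bdry (ZMod p)).toAddMonoidHom _ _ w).trans ?_
    change altSum (2 * l.length + 1) (fun u => bdry (ZMod p) (φ (2 * l.length) u)) w = 0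
    rw [hm]
    simp only [h2 m (by omega)]
    exact altSum_altSum (m + 1) (φ m) w
  -- The obstruction cochain. `Θ` is invariant only on cycles, which is why `hcyc` is needed;
  -- closedness is `altSum_altSum`.
  let F : (ℕ → P) → ZMod p := fun w => Θ (altSum (2 * l.length + 1) (φ (2 * l.length)) w)
  have FD : DependsOn (2 * l.length + 1) F := fun w w' h => by
    simp only [F]; rw [hφD.altSum w w' h]
  have FI : InvariantUnder (fun _ => True) F := by
    intro g _ w
    simp only [F]
    rw [altSum_comp, ← hΘ (MulAction.toPerm g) (rotationCocycle A χ g) _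
      (altSum_mem _ _ _ hφX w) (hcyc w)]
    congr 1
    simp only [hφρ]
    exact (altSum_map (act (ZMod p) (σ g)).toAddMonoidHom _ _ w).symm
  have Fδ : ∀ w, altSum (2 * l.length + 2) F w = 0 := by
    intro w
    refine (altSum_map Θ.toAddMonoidHom _ _ w).symm.trans ?_
    rw [altSum_altSum, map_zero]
  obtain ⟨U, hU⟩ := exists_represents FD FI Fδ
  refine ⟨U, F, hU, fun w => ?_⟩
  simp only [F]
  rw [altSum_comp]
  simp only [hφψ]
  have e := altSum_comp (fun c : C => χ c) (2 * l.length + 1)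
    (rotationChain (ZMod p) l (2 * l.length)) w
  rw [altSum_rotationChain_top] at e
  refine (congrArg Θ e.symm).trans ?_
  rw [map_smul, hΘ1, smul_eq_mul, mul_one]
  rfl

end Euler

/-! ### Extending characters -/

section Characters

/-- Scaling residues modulo `p` to residues modulo `p * q` preserves carries. -/
lemma carry_scale {p q : ℕ} [NeZero p] [NeZero q] (a b : ZMod p) :
    carry ((q * a.val : ℕ) : ZMod (p * q)) ((q * b.val : ℕ) : ZMod (p * q)) = carry a b := by
  have hval : ∀ c : ZMod p, (((q * c.val : ℕ) : ZMod (p * q)).val : ℤ) = q * c.val := by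
    intro c
    rw [ZMod.val_natCast_of_lt]
    · push_cast; rfl
    · rw [mul_comm p q]
      exact Nat.mul_lt_mul_of_pos_left (ZMod.val_lt c) (Nat.pos_of_ne_zero (NeZero.ne q))
  have hab := mul_carry a b
  have hsum : ((q * a.val : ℕ) : ZMod (p * q)) + ((q * b.val : ℕ) : ZMod (p * q)) =
      ((q * (a + b).val : ℕ) : ZMod (p * q)) := by
    have h1 : ((q * a.val + q * b.val : ℤ) : ZMod (p * q)) =
        ((q * (a + b).val + (p * q : ℕ) * carry a b : ℤ) : ZMod (p * q)) := by
      congr 1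
      push_cast
      linear_combination -(q : ℤ) * hab
    rw [Int.cast_add (q * (a + b).val : ℤ), Int.cast_mul ((p * q : ℕ) : ℤ), Int.cast_natCast,
      ZMod.natCast_self, zero_mul, add_zero] at h1
    push_cast at h1 ⊢
    exact h1
  have hpq : ((p * q : ℕ) : ℤ) ≠ 0 := Int.natCast_ne_zero.2 (NeZero.ne (p * q))
  refine mul_left_cancel₀ hpq ?_
  rw [mul_carry, hsum, hval, hval, hval]
  push_cast
  linear_combination -(q : ℤ) * hab

/-- A mod `p` character of a subgroup of a finite abelian group extends to a character with values
in a cyclic group. -/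
lemma exists_character_extension {p : ℕ} [Fact p.Prime] {A : Type} [CommGroup A] [Finite A]
    (C : Subgroup A) (x : C → ZMod p) (hx : ∀ c d, x (c * d) = x c + x d) :
    ∃ (q : ℕ) (_ : NeZero q) (χ : A → ZMod (p * q)), 3 ≤ p * q ∧
      (∀ a b, χ (a * b) = χ a + χ b) ∧ ∀ c : C, χ c = ((q * (x c).val : ℕ) : ZMod (p * q)) := by
  have hp := (Fact.out : p.Prime).two_le
  have hq0 : 2 * Monoid.exponent A ≠ 0 := mul_ne_zero two_ne_zero Monoid.exponent_ne_zero_of_finite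
  -- A multiple of the exponent makes every complex character of `A` take values in the `p q`-th
  -- roots of unity. The factor `2` guarantees polygons with at least three vertices.
  set q := 2 * Monoid.exponent A with hq
  have : NeZero q := ⟨hq0⟩
  have hpq0 : p * q ≠ 0 := NeZero.ne (p * q)
  have hpr := Complex.isPrimitiveRoot_exp (p * q) hpq0
  set ζ : ℂˣ := (hpr.isUnit hpq0).unit with hζdef
  have hζ : IsPrimitiveRoot ζ (p * q) := hpr.isUnit_unit hpq0
  have key : ∀ m n : ℕ, ((m : ZMod p) = n) → ζ ^ (q * m) = ζ ^ (q * n) := by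
    intro m n h
    rw [pow_eq_pow_iff_modEq, ← hζ.eq_orderOf, mul_comm p q]
    exact Nat.ModEq.mul_left' q ((ZMod.natCast_eq_natCast_iff m n p).1 h)
  let f : C →* ℂˣ :=
    { toFun := fun c => ζ ^ (q * (x c).val)
      map_one' := by
        have : x 1 = 0 := by simpa using hx 1 1
        simp [this]
      map_mul' := fun c d => by
        rw [← pow_add, ← mul_add]
        refine key _ _ ?_
        rw [hx]; simp }
  -- Characters with values in `ℂˣ` extend from subgroups of finite abelian groups.
  obtain ⟨g, hg⟩ := MonoidHom.domRestrict_surjective ℂ C f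
  have hgm : ∀ a, g a ∈ Subgroup.zpowers ζ := by
    intro a
    rw [hζ.zpowers_eq, mem_rootsOfUnity, ← map_pow]
    have : a ^ (p * q) = 1 := by
      rw [hq, ← mul_assoc, mul_comm, pow_mul, Monoid.pow_exponent_eq_one, one_pow]
    rw [this, map_one]
  refine ⟨q, inferInstance, fun a => hζ.zmodEquivZPowers.symm (Additive.ofMul ⟨g a, hgm a⟩),
    ?_, ?_, ?_⟩
  · have := Nat.pos_of_ne_zero (Monoid.exponent_ne_zero_of_finite (G := A))
    nlinarith
  · intro a b
    rw [← map_add]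
    refine congrArg _ (Additive.toMul.injective (Subtype.ext ?_))
    exact map_mul g a b
  · intro c
    rw [AddEquiv.symm_apply_eq, hζ.zmodEquivZPowers_apply_coe_nat]
    refine Additive.toMul.injective (Subtype.ext ?_)
    exact DFunLike.congr_fun hg c

end Characters

/-! ### Powers of Bocksteins as restrictions of Euler classes -/

section Powers

variable {p : ℕ} [Fact p.Prime] {G : Type} [Group G]

lemma represents_one : Represents (p := p) (G := G) 0 (fun _ => 1) 1 :=
  ⟨oneCocycle p G, fun _ => rfl, rfl⟩

lemma oneCocycle_inv_mul (f : Cocycle p G 1) (g h : G) :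
    f.1 (fun _ => g⁻¹ * h) = (f.1 fun _ => h) - f.1 fun _ => g := by
  have := oneCocycle_add f g (g⁻¹ * h)
  rw [mul_inv_cancel_left] at this
  rw [eq_sub_iff_add_eq, add_comm]
  exact this.symm

/-- The carry cochain represents the Bockstein, and `carryProd` is by construction its iterated
homogeneous cup product. -/
lemma represents_bockstein_pow (f : Cocycle p G 1) (n : ℕ) :
    Represents (2 * n) (fun w => carryProd (ZMod p) n fun j => f.1 fun _ => w j)
      (inDegree p G 2 (bockstein 1 (cls p G 1 f)) ^ n) := by
  induction n with
  | zero => exact represents_one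
  | succ n ih =>
    have h := (represents_bockstein f).mul ih
    rw [← pow_succ', show 2 + 2 * n = 2 * (n + 1) by ring] at h
    convert h using 2 with w
    simp only [carryProd, hcup, oneCocycle_inv_mul]
    congr 1
    simp only [add_comm]

lemma carryProd_congr {k : Type} [CommRing k] {M N : ℕ} (n : ℕ) {a : ℕ → ZMod M}
    {b : ℕ → ZMod N}
    (h : ∀ i j l, carry (a j - a i) (a l - a j) = carry (b j - b i) (b l - b j)) :
    carryProd k n a = carryProd k n b := by
  induction n generalizing a b with
  | zero => rfl
  | succ n ih => simp only [carryProd]; rw [h, ih fun i j l => h _ _ _]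

/-- The `[P : A]`-th power of a Bockstein on a central subgroup of an abelian subgroup `A` is
restricted from `P`. -/
theorem exists_res_eq_bockstein_pow {P : Type} [Group P] [Finite P] (A C : Subgroup P)
    (hA : IsMulCommutative A) (hCA : C ≤ A) (hC : C ≤ Subgroup.center P) (h : H p C 1) :
    ∃ a : H p P (2 * A.index), res p C.subtype (inDegree p P _ a) =
      inDegree p C 2 (bockstein 1 h) ^ A.index := by
  classical
  obtain ⟨f, rfl⟩ := cls_surjective 1 h
  let x : C.subgroupOf A → ZMod p := fun c => f.1 fun _ => (⟨c.1.1, c.2⟩ : C)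
  have hx : ∀ c d, x (c * d) = x c + x d := fun c d =>
    (oneCocycle_add f ⟨c.1.1, c.2⟩ ⟨d.1.1, d.2⟩)
  let _ : CommGroup A := { (inferInstance : Group A) with mul_comm := hA.is_comm.comm }
  obtain ⟨q, hq, χ, hM, hχ, hχC⟩ := exists_character_extension (C.subgroupOf A) x hx
  have : NeZero (p * q) := ⟨by omega⟩
  -- The value `0` off `A` is harmless: rotations evaluate the character only on elements of `A`.
  obtain ⟨U, F, hF, hFC⟩ := exists_eulerClass (p := p) hM A C hCA hC
    (fun g => if hg : g ∈ A then χ ⟨g, hg⟩ else 0) fun a ha b hb => by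
      rw [dif_pos ha, dif_pos hb, dif_pos (mul_mem ha hb), ← hχ]; rfl
  obtain ⟨u, -, hu⟩ := id hF
  refine ⟨_, (congrArg (res p C.subtype) hu.symm).trans ?_⟩
  refine (hF.res C.subtype).unique ?_
  have hy := represents_bockstein_pow f A.index
  convert hy using 2 with w
  rw [hFC]
  -- On `C` the character is `q` times `f`, and scaling from `ℤ/p` to `ℤ/pq` preserves carries, so
  -- the two cochains coincide.
  refine carryProd_congr _ fun i j l => ?_
  have key : ∀ c : C, (if hg : (c : P) ∈ A then χ ⟨c, hg⟩ else 0) =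
      ((q * (f.1 fun _ => c).val : ℕ) : ZMod (p * q)) := fun c => by
    rw [dif_pos (hCA c.2)]
    exact hχC ⟨⟨c.1, hCA c.2⟩, c.2⟩
  have key' : ∀ c d : C, (if hg : (d : P) ∈ A then χ ⟨d, hg⟩ else 0) -
      (if hg : (c : P) ∈ A then χ ⟨c, hg⟩ else 0) =
      ((q * ((f.1 fun _ => d) - (f.1 fun _ => c)).val : ℕ) : ZMod (p * q)) := fun c d => by
    rw [← oneCocycle_inv_mul, ← key, dif_pos (hCA c.2), dif_pos (hCA d.2),
      dif_pos (hCA (c⁻¹ * d).2), sub_eq_iff_eq_add', ← hχ]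
    congr 1
    exact Subtype.ext (mul_inv_cancel_left (c : P) d).symm
  rw [key', key', carry_scale]

end Powers

/-! ### Commutation of classes of degree two -/

section Commutation

variable {p : ℕ} {G : Type} [Group G]

/-- The commutator is the coboundary of Steenrod's cup-one product, given below as `K`; in degree
two no sign intervenes. -/
lemma Represents.mul_comm_two {F H : (ℕ → G) → ZMod p} {u v : HStar p G}
    (hF : Represents 2 F u) (hH : Represents 2 H v) : u * v = v * u := by
  have seq : ∀ {F : (ℕ → G) → ZMod p} {u}, Represents 2 F u → ∃ f : G → G → G → ZMod p,
      (∀ w, F w = f (w 0) (w 1) (w 2)) ∧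
      (∀ a b c d, f b c d - f a c d + f a b d - f a b c = 0) ∧
      ∀ g a b c, f (g * a) (g * b) (g * c) = f a b c := by
    intro F u h
    have hf : ∀ w, F w = F (scons (w 0) (scons (w 1) fun _ => w 2)) := fun w =>
      h.dependsOn _ _ fun i hi => by interval_cases i <;> rfl
    refine ⟨fun a b c => F (scons a (scons b fun _ => c)), hf, fun a b c d => ?_,
      fun g a b c => ?_⟩
    · have := h.closed (scons a (scons b (scons c fun _ => d)))
      simp only [altSum_succ, altSum_zero] at this
      simp only [hf (stail _), hf (scons _ (stail _)), hf (scons _ (scons _ (stail _))),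
        hf (scons _ (scons _ (scons _ (stail _))))] at this
      simp only [scons_zero, scons_succ, stail_apply] at this
      linear_combination this
    · beta_reduce
      rw [← h.invariant g trivial (scons a (scons b fun _ => c))]
      simp only [comp_scons]
      rfl
  obtain ⟨f, hf, hfc, hfi⟩ := seq hF
  obtain ⟨h, hh, hhc, hhi⟩ := seq hH
  rw [← sub_eq_zero]
  refine ((hF.mul hH).sub (hH.mul hF)).eq_zero (d := 3)
    (K := fun w => f (w 0) (w 1) (w 3) * h (w 1) (w 2) (w 3) -
      f (w 0) (w 2) (w 3) * h (w 0) (w 1) (w 2)) ?_ ?_ ?_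
  · intro w w' e
    simp only [e 0 (by omega), e 1 (by omega), e 2 (by omega), e 3 (by omega)]
  · intro g _ w
    simp only [Function.comp_apply, hfi, hhi]
  · intro w
    simp only [hcup, altSum_succ, altSum_zero, hf, hh, scons, stail]
    linear_combination -(hfc (w 0) (w 2) (w 3) (w 4)) * h (w 0) (w 1) (w 2) +
      hfc (w 0) (w 1) (w 3) (w 4) * h (w 1) (w 2) (w 3) -
      hfc (w 0) (w 1) (w 2) (w 4) * h (w 2) (w 3) (w 4) +
      f (w 0) (w 3) (w 4) * hhc (w 0) (w 1) (w 2) (w 3) +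
      f (w 0) (w 1) (w 4) * hhc (w 1) (w 2) (w 3) (w 4)

end Commutation

/-! ### Generators of the cohomology of an elementary abelian group -/

section Generation

variable {p : ℕ} [Fact p.Prime] {G : Type} [Group G]

lemma altSum_const {M : Type*} [AddCommGroup M] (d : ℕ) (r : M) (w : ℕ → G) :
    altSum d (fun _ => r) w = if Even d then 0 else r := by
  induction d generalizing w with
  | zero => simp [altSum_zero]
  | succ d ih =>
    rw [altSum_succ, ih]
    by_cases h : Even d <;> simp [h, Nat.even_add_one]

/-- Constant cochains of positive degree represent zero. -/
lemma Represents.eq_zero_of_const {d : ℕ} {F : (ℕ → G) → ZMod p} {u : HStar p G}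
    (h : Represents (d + 1) F u) (r : ZMod p) (hr : ∀ w, F w = r) : u = 0 := by
  -- The coboundary of a constant is `0` or the constant itself, alternately. In the first parity
  -- closedness forces `r = 0`; in the second the constant is its own primitive one degree lower.
  by_cases hd : Even d
  · refine h.eq_zero (K := fun _ => 0) (fun _ _ _ => rfl) (fun _ _ _ => rfl) fun w => ?_
    have := h.closed w
    rw [funext hr, altSum_const, if_neg (by simp [Nat.even_add_one, hd])] at this
    rw [altSum_const, hr, this, ite_self]
  · refine h.eq_zero (K := fun _ => r) (fun _ _ _ => rfl) (fun _ _ _ => rfl) fun w => ?_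
    rw [altSum_const, if_neg (by simpa [Nat.even_add] using hd), hr]

lemma Represents.res_res {d : ℕ} {F : (ℕ → G) → ZMod p} {u : HStar p G}
    (h : Represents d F u) (φ ψ : G →* G) :
    ModPCohomology.res p φ (ModPCohomology.res p ψ u) = ModPCohomology.res p (ψ.comp φ) u :=
  ((h.res ψ).res φ).unique (h.res (ψ.comp φ))

variable {ι : Type*}

/-- The span of the right multiples of the `n`-th powers of the members of `y`. -/
def powerSpan (y : ι → HStar p G) (n : ℕ) : Submodule (ZMod p) (HStar p G) :=
  Submodule.span (ZMod p) {z | ∃ (i : ι) (b : HStar p G), z = y i ^ n * b}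

lemma powerSpan_mul_right {y : ι → HStar p G} {n : ℕ} {z : HStar p G} (hz : z ∈ powerSpan y n)
    (b : HStar p G) : z * b ∈ powerSpan y n := by
  induction hz using Submodule.span_induction with
  | mem z hz =>
    obtain ⟨i, c, rfl⟩ := hz
    exact Submodule.subset_span ⟨i, c * b, mul_assoc _ _ _⟩
  | zero => rw [zero_mul]; exact zero_mem _
  | add z z' _ _ h h' => rw [add_mul]; exact add_mem h h'
  | smul r z _ h => rw [smul_mul_assoc]; exact Submodule.smul_mem _ r h

lemma powerSpan_mul_left {y : ι → HStar p G} {n : ℕ} {a z : HStar p G}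
    (ha : ∀ i, Commute a (y i)) (hz : z ∈ powerSpan y n) : a * z ∈ powerSpan y n := by
  induction hz using Submodule.span_induction with
  | mem z hz =>
    obtain ⟨i, c, rfl⟩ := hz
    refine Submodule.subset_span ⟨i, a * c, ?_⟩
    rw [← mul_assoc, ((ha i).pow_right n).eq, mul_assoc]
  | zero => rw [mul_zero]; exact zero_mem _
  | add z z' _ _ h h' => rw [mul_add]; exact add_mem h h'
  | smul r z _ h => rw [mul_smul_comm]; exact Submodule.smul_mem _ r h

variable [DecidableEq ι] (S : ι → CentralSplitting p G) {ξ y : ι → HStar p G}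

/-- In degrees above `|s| (2 n - 1)`, every class pulled back along the projection to the
coordinates in `s` lies in the span of the multiples of the `n`-th powers of the `y i`. -/
theorem res_mem_powerSpan
    (hS : ∀ i j g, (S j).x ((S i).ρ g) = if j = i then 0 else (S j).x g)
    (hinj : ∀ g, (∀ i, (S i).x g = 0) → g = 1)
    (hξ : ∀ i, Represents 1 (fun w => (S i).x ((w 0)⁻¹ * w 1)) (ξ i))
    (hy : ∀ i, Represents 2 (fun w => ((carry ((S i).x ((w 0)⁻¹ * w 1))
      ((S i).x ((w 1)⁻¹ * w 2)) : ℤ) : ZMod p)) (y i))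
    {n : ℕ} (hn : 0 < n) (s : Finset ι) (φ : G →* G)
    (hφ : ∀ j g, (S j).x (φ g) = if j ∈ s then (S j).x g else 0) {m : ℕ}
    (hm : s.card * (2 * n - 1) < m) {F : (ℕ → G) → ZMod p} {u : HStar p G}
    (hu : Represents m F u) : res p φ u ∈ powerSpan y n := by
  -- With no coordinates left `φ` is trivial and the pulled-back cochain is constant.
  induction s using Finset.induction_on generalizing φ m F u with
  | empty =>
    obtain ⟨d, rfl⟩ : ∃ d, m = d + 1 := ⟨m - 1, by simp at hm; omega⟩
    rw [(hu.res φ).eq_zero_of_const (F fun _ => 1) fun w => ?_]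
    · exact zero_mem _
    · congr 1
      funext i
      exact hinj _ fun j => by simpa using hφ j (w i)
  | insert i s his ih =>
    rw [Finset.card_insert_of_notMem his, add_mul, one_mul] at hm
    have hφi : ∀ g, (S i).x (φ g) = (S i).x g := fun g => by simp [hφ]
    have hφ' : ∀ j g, (S j).x (((S i).ρ.comp φ) g) = if j ∈ s then (S j).x g else 0 := by
      intro j g
      rw [MonoidHom.comp_apply, hS, hφ]
      by_cases hj : j = i
      · subst hj; simp [his]
      · simp [hj]
    have hyφ : res p φ (y i) = y i := by
      refine ((hy i).res φ).unique ?_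
      convert hy i using 2 with w
      simp only [Function.comp_apply, ← map_inv, ← map_mul, hφi]
    -- Divide repeatedly by `y i`. The remainders are pulled back along the projection to `s`, in
    -- degrees `m - 2N` and `m - 2N - 1`. For `N ≤ n - 1` both exceed `|s| (2n - 1)`, so the
    -- induction hypothesis applies; this is where `2n - 1` per coordinate comes from. At `N = n`
    -- the quotient term lies in the span itself.
    have key : ∀ N ≤ n, ∃ v, (∃ F, Represents (m - 2 * N) F v) ∧
        res p φ u - y i ^ N * res p φ v ∈ powerSpan y n := by
      intro N
      induction N with
      | zero => exact fun _ => ⟨u, ⟨F, by simpa using hu⟩, by simp⟩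
      | succ N ihN =>
        intro hN
        obtain ⟨v, ⟨V, hV⟩, hv⟩ := ihN (by omega)
        obtain ⟨r, hr⟩ : ∃ r, m - 2 * N = r + 2 := ⟨m - 2 * N - 2, by omega⟩
        rw [hr] at hV
        obtain ⟨t, v', ⟨T, hT⟩, hv', hdec⟩ := (S i).exists_decomposition hV (hξ i) (hy i)
        refine ⟨v', by rwa [show m - 2 * (N + 1) = r by omega], ?_⟩
        have h1 : res p φ v = res p ((S i).ρ.comp φ) v +
            res p ((S i).ρ.comp φ) t * res p φ (ξ i) + y i * res p φ v' := by
          conv_lhs => rw [hdec]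
          rw [map_add, map_add, map_mul, map_mul, hV.res_res, hT.res_res, hyφ]
        have h2 : res p φ u - y i ^ (N + 1) * res p φ v' =
            (res p φ u - y i ^ N * res p φ v) + y i ^ N * (res p ((S i).ρ.comp φ) v +
              res p ((S i).ρ.comp φ) t * res p φ (ξ i)) := by
          rw [h1, pow_succ]
          noncomm_ring
        rw [h2]
        refine add_mem hv (powerSpan_mul_left (fun j => ?_) (add_mem ?_
          (powerSpan_mul_right ?_ _)))
        · exact Commute.pow_left ((hy i).mul_comm_two (hy j)) N
        · exact ih _ hφ' (by omega) hV
        · exact ih _ hφ' (by omega) hT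
    obtain ⟨v, -, hv⟩ := key n le_rfl
    have := add_mem hv (Submodule.subset_span (s := {z | ∃ (i : ι) (b : HStar p G),
      z = y i ^ n * b}) ⟨i, res p φ v, rfl⟩ : y i ^ n * res p φ v ∈ powerSpan y n)
    rwa [sub_add_cancel] at this

/-- A character is a cocycle of degree one. -/
lemma exists_cocycle_of_character (x : G → ZMod p) (hx : ∀ g h, x (g * h) = x g + x h) :
    ∃ f : Cocycle p G 1, ∀ g, (f.1 fun _ => g) = x g := by
  have hinv : ∀ g h, x (g⁻¹ * h) = x h - x g := fun g h => by
    rw [eq_sub_iff_add_eq, add_comm, ← hx, mul_inv_cancel_left]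
  obtain ⟨u, f, hf, -⟩ := exists_represents (p := p) (d := 1)
    (F := fun w : ℕ → G => x ((w 0)⁻¹ * w 1))
    (fun w w' h => by simp only [h 0 (by omega), h 1 (by omega)])
    (fun g _ w => by simp) (fun w => by
      simp only [altSum_succ, altSum_zero, scons, stail, hinv]
      ring)
  refine ⟨f, fun g => ?_⟩
  have := hf (partialProd fun _ => g)
  rw [quot_partialProd] at this
  refine this.trans (congrArg x ?_)
  exact congrFun (quot_partialProd fun _ => g) 0

end Generation

/-! ### The bound on the degrees of generators -/

section Bound

variable {p : ℕ} [Fact p.Prime] {P : Type} [Group P]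

/-- The splitting of `C(P)` off the line spanned by a basis vector. -/
def basisSplitting {ι : Type*} (b : Module.Basis ι (ZMod p) (Additive (C p P))) (i : ι) :
    CentralSplitting p (C p P) where
  x g := b.repr (Additive.ofMul g) i
  t := (b i).toMul
  ρ := MonoidHom.mk' (fun g => (Additive.ofMul g - b.repr (Additive.ofMul g) i • b i).toMul) <| by
    intro g h
    rw [← toMul_add, ofMul_mul, map_add, Finsupp.add_apply, add_smul]
    congr 1
    abel
  x_mul g h := by rw [ofMul_mul, map_add, Finsupp.add_apply]
  t_comm g := Subtype.ext (Subgroup.mem_center_iff.1 g.2.1 _)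
  t_pow := Subtype.ext (b i).toMul.2.2
  x_t := by simp
  eq_mul g := by
    apply Additive.ofMul.injective
    change _ = (Additive.ofMul g - b.repr (Additive.ofMul g) i • b i) +
      (b.repr (Additive.ofMul g) i).val • b i
    rw [← Nat.cast_smul_eq_nsmul (ZMod p), ZMod.natCast_val, ZMod.cast_id, sub_add_cancel]

lemma basisSplitting_x_ρ {ι : Type*} [DecidableEq ι]
    (b : Module.Basis ι (ZMod p) (Additive (C p P))) (i j : ι) (g : C p P) :
    (basisSplitting b j).x ((basisSplitting b i).ρ g) =
      if j = i then 0 else (basisSplitting b j).x g := by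
  change b.repr (Additive.ofMul g - b.repr (Additive.ofMul g) i • b i) j = if j = i then 0 else
    b.repr (Additive.ofMul g) j
  rw [map_sub, map_smul, b.repr_self, Finsupp.sub_apply, Finsupp.smul_apply,
    Finsupp.single_apply]
  by_cases h : j = i
  · subst h; simp
  · simp [h, Ne.symm h]

/-- If the `n`-th powers of the Bocksteins on `C(P)` are restricted from `P`, then
`H*(BC(P))` is generated over `H*(BP)` in degrees at most `c(P) (2 n - 1)`. -/
theorem e_le_of_bockstein_pow_mem_range [Finite P] {n : ℕ} (hn : 0 < n)
    (hres : ∀ h : H p (C p P) 1, ∃ a : H p P (2 * n), resC p P (inDegree p P _ a) =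
      inDegree p (C p P) 2 (bockstein 1 h) ^ n) :
    e p P ≤ ((c p P * (2 * n - 1) : ℕ) : ℕ∞) := by
  have : Module.Finite (ZMod p) (Additive (C p P)) := Module.Finite.of_finite
  let b := Module.finBasis (ZMod p) (Additive (C p P))
  choose f hf using fun i => exists_cocycle_of_character (basisSplitting b i).x
    (basisSplitting b i).x_mul
  refine iSup₂_le fun m hm => ?_
  obtain ⟨z, hz⟩ := hm
  by_contra! hlt
  rw [Nat.cast_lt] at hlt
  apply hz
  obtain ⟨u, rfl⟩ := cls_surjective m z
  -- Each power is restricted from degree `2 * n > 0`, so its multiples are decomposable.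
  have hle : powerSpan (fun i => inDegree p (C p P) 2 (bockstein 1 (cls p (C p P) 1 (f i)))) n ≤
      decomposables p P := by
    refine Submodule.span_mono ?_
    rintro _ ⟨i, d, rfl⟩
    obtain ⟨a, ha⟩ := hres (cls p (C p P) 1 (f i))
    exact ⟨2 * n, a, d, by omega, by rw [ha]⟩
  have hmem := res_mem_powerSpan (basisSplitting b)
    (ξ := fun i => inDegree p (C p P) 1 (cls p (C p P) 1 (f i)))
    (y := fun i => inDegree p (C p P) 2 (bockstein 1 (cls p (C p P) 1 (f i))))
    (fun i j g => basisSplitting_x_ρ b i j g)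
    (fun g hg => Additive.ofMul.injective (b.repr.map_eq_zero_iff.1 (Finsupp.ext hg)))
    (fun i => by
      convert represents_cls (f i) using 2 with w
      rw [← hf]
      refine congrArg (f i).1 (funext fun j => ?_)
      obtain rfl : j = 0 := Subsingleton.elim _ _
      rfl)
    (fun i => by
      simp only [← hf]
      exact represents_bockstein (f i))
    hn Finset.univ (MonoidHom.id _) (fun j g => by simp) (m := m)
    (by rw [Finset.card_univ, Fintype.card_fin]; exact hlt) (represents_cls u)
  have hid : res p (MonoidHom.id _) (inDegree p (C p P) m (cls p (C p P) m u)) =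
      inDegree p (C p P) m (cls p (C p P) m u) :=
    ((represents_cls u).res (MonoidHom.id _)).unique (represents_cls u)
  rw [hid] at hmem
  exact hle hmem

/-- A central subgroup is contained in every abelian subgroup of maximal order. -/
lemma le_of_le_center_of_maximal [Finite P] {A K : Subgroup P} (hA : IsMulCommutative A)
    (hmax : ∀ B : Subgroup P, IsMulCommutative B → Nat.card B ≤ Nat.card A)
    (hK : K ≤ Subgroup.center P) : K ≤ A := by
  -- Adjoining central elements keeps the subgroup abelian, so maximality of the order gives `A ⊔ K
  -- = A`.
  have hcomm : IsMulCommutative (A ⊔ K : Subgroup P) := by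
    have h : A ⊔ K ≤ Subgroup.centralizer (A ⊔ K : Subgroup P) := by
      have hA' : A ≤ Subgroup.centralizer (A : Set P) := fun a ha b hb =>
        congrArg Subtype.val (hA.is_comm.comm ⟨b, hb⟩ ⟨a, ha⟩)
      have hAK : A ⊔ K ≤ Subgroup.centralizer (A : Set P) :=
        sup_le hA' (hK.trans (Subgroup.center_le_centralizer _))
      rw [Subgroup.le_centralizer_iff]
      exact sup_le (Subgroup.le_centralizer_iff.1 hAK)
        (hK.trans (Subgroup.center_le_centralizer _))
    exact ⟨⟨fun a b => Subtype.ext (h b.2 a a.2)⟩⟩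
  have := Subgroup.eq_of_le_of_card_ge (le_sup_left : A ≤ A ⊔ K) (hmax _ hcomm)
  rw [this]
  exact le_sup_right

end Bound

end ModPCohomology

end

open ModPCohomology in
theorem mainTheorem5 (p : ℕ) [Fact p.Prime] (P : Type) [Group P] [Finite P] (hP : IsPGroup p P)
    (A : Subgroup P) (hA : IsMulCommutative A)
    (hmax : ∀ B : Subgroup P, IsMulCommutative B → Nat.card B ≤ Nat.card A) :
    (∀ x : Module.Basis (Fin (c p P)) (ZMod p) (H p (C p P) 1),
      Algebra.adjoin (ZMod p) (Set.range fun i =>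
          inDegree p (C p P) 2 (bockstein 1 (x i)) ^ (Nat.card P / Nat.card A)) ≤
        (resC p P).range) ∧
    e p P ≤ ((c p P * (2 * (Nat.card P / Nat.card A) - 1) : ℕ) : ℕ∞) := by
  have hindex : Nat.card P / Nat.card A = A.index :=
    Nat.div_eq_of_eq_mul_right Nat.card_pos A.card_mul_index.symm
  rw [hindex]
  have hcenter : C p P ≤ Subgroup.center P := fun _ hx => hx.1
  have hres := exists_res_eq_bockstein_pow (p := p) A (C p P) hA
    (le_of_le_center_of_maximal hA hmax hcenter) hcenter
  refine ⟨fun x => Algebra.adjoin_le ?_,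
    e_le_of_bockstein_pow_mem_range (Nat.pos_of_ne_zero A.index_ne_zero_of_finite) hres⟩
  rintro _ ⟨i, rfl⟩
  obtain ⟨a, ha⟩ := hres (x i)
  exact ⟨_, ha⟩
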